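/- **Setting.** A model with $m$ inputs and $p$ outputs is identified with its transfer function, a real rational matrix $H(s)\in\mathbb R(s)^{p\times m}$ (equivalently $H(s)=C(sE-A)^{-1}B+D$ for a real descriptor system with regular pencil $sE-A$). A model splits uniquely as $H=H_{\rm sp}+P_H$ with $H_{\rm sp}$ strictly proper and $P_H$ a polynomial matrix. The strictly proper part *has order $r$* if $H_{\rm sp}(s)=C(sE-A)^{-1}B$ for real matrices with $E,A\in\mathbb R^{r\times r}$ and $E$ nonsingular. A model is *stable* if all its finite poles lie in the open left half-plane. Put $$\|H\|_{\mathcal H_2}=\Big(\frac1{2\pi}\int_{-\infty}^{\infty}\|H(\imath\omega)\|_{\rm F}^2\,d\omega\Big)^{1/2}\in[0,\infty].$$ **Theorem.** Let $G=G_{\rm sp}+P$ be a stable model decomposed into its strictly proper and polynomial parts, and let $\widetilde G=\widetilde G_{\rm sp}+\widetilde P$ be a model whose strictly proper part $\widetilde G_{\rm sp}$ has order $r$. Let $\mathcal S$ be either the set of all models or the set of all stable models. Suppose that $\widetilde G\in\mathcal S$ and that $\widetilde G$ minimizes $\|G-H\|_{\mathcal H_2}$ over all $H\in\mathcal S$ whose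 strictly proper part has order $r$. 1. Then $\widetilde P=P$, and $\widetilde G_{\rm sp}$ lies in $\mathcal S$ and minimizes $\|G_{\rm sp}-H\|_{\mathcal H_2}$ over all strictly proper $H\in\mathcal S$ of order $r$. 2. Let moreover $\widetilde G_{\rm sp}(s)=\widetilde C(s\widetilde E-\widetilde A)^{-1}\widetilde B$ with real matrices and $\widetilde E,\widetilde A\in\mathbb R^{r\times r}$, where the pencil $s\widetilde E-\widetilde A$ has distinct eigenvalues $\widetilde\lambda_1,\dots,\widetilde\lambda_r\in\mathbb C$ with right and left eigenvectors $z_i,y_i\in\mathbb C^r$, that is, $\widetilde A z_i=\widetilde\lambda_i\widetilde E z_i$, $\;y_i^*\widetilde A=\widetilde\lambda_i y_i^*\widetilde E$ and $y_i^*\widetilde E z_j=\delta_{ij}$. Put $\mathsf c_i=\widetilde C z_i$ and $\mathsf b_i^T=y_i^*\widetilde B$. Then, unless $\widetilde G=G$, no $-\widetilde\lambda_i$ is a pole of $G$ or of $\widetilde G$; and for $i=1,\dots,r$ $$G(-\widetilde\lambda_i)\mathsf b_i=\widetilde G(-\widetilde\lambda_i)\mathsf b_i,\qquad \mathsf c_i^TG(-\widetilde\lambda_i)=\mathsf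 c_i^T\widetilde G(-\widetilde\lambda_i),\qquad \mathsf c_i^TG'(-\widetilde\lambda_i)\mathsf b_i=\mathsf c_i^T\widetilde G'(-\widetilde\lambda_i)\mathsf b_i .$$ (If $\widetilde G=G$ and $-\widetilde\lambda_i$ is a common pole, these identities are understood as void.) -/

import Mathlib

open scoped Matrix Polynomial ENNReal

namespace ModelReduction

/-- Real rational `p × m` matrix functions.  These are the transfer functions of (regular) real
descriptor systems with `m` inputs and `p` outputs, and a model is identified with its transfer
function. -/
abbrev RatMatrix (p m : ℕ) : Type := Matrix (Fin p) (Fin m) (RatFunc ℝ)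

/-- The transfer function `C (s E - A)⁻¹ B` as a matrix of rational functions of `s`.  It is only
used when the pencil `s E - A` is regular, so that the inverse over the field `ℝ(s)` is the true
one. -/
noncomputable def transferFunction {r p m : ℕ} (E A : Matrix (Fin r) (Fin r) ℝ)
    (B : Matrix (Fin r) (Fin m) ℝ) (C : Matrix (Fin p) (Fin r) ℝ) : RatMatrix p m :=
  C.map RatFunc.C *
    ((RatFunc.X : RatFunc ℝ) • E.map RatFunc.C - A.map RatFunc.C)⁻¹ * B.map RatFunc.C

/-- A matrix of real polynomials regarded as a rational matrix. -/
noncomputable def ofPoly {p m : ℕ} (P : Matrix (Fin p) (Fin m) ℝ[X]) : RatMatrix p m :=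
  P.map (algebraMap ℝ[X] (RatFunc ℝ))

/-- `H` is strictly proper (`H(s) → 0` as `s → ∞`): in each entry the degree of the numerator is
smaller than the degree of the denominator. -/
def IsStrictlyProper {p m : ℕ} (H : RatMatrix p m) : Prop :=
  ∀ i j, (H i j).num.degree < (H i j).denom.degree

/-- `H(s) = C (s E - A)⁻¹ B` for some real matrices with state dimension `r` and `E` nonsingular,
i.e. `H` is the transfer function of a strictly proper system of order `r`. -/
def HasOrder {p m : ℕ} (r : ℕ) (H : RatMatrix p m) : Prop :=
  ∃ (E A : Matrix (Fin r) (Fin r) ℝ) (B : Matrix (Fin r) (Fin m) ℝ) (C : Matrix (Fin p) (Fin r) ℝ),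
    IsUnit E.det ∧ H = transferFunction E A B C

/-- The strictly proper models of order `r`. -/
def strictlyProperModels (p m r : ℕ) : Set (RatMatrix p m) := {H | HasOrder r H}

/-- The models whose strictly proper part has order `r`; the polynomial part is arbitrary. -/
def models (p m r : ℕ) : Set (RatMatrix p m) :=
  {H | ∃ (Hsp : RatMatrix p m) (P : Matrix (Fin p) (Fin m) ℝ[X]),
    HasOrder r Hsp ∧ H = Hsp + ofPoly P}

/-- The finite complex number `s` is a pole of (some entry of) `H`. -/
def IsPole {p m : ℕ} (H : RatMatrix p m) (s : ℂ) : Prop :=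
  ∃ i j, Polynomial.aeval s (H i j).denom = 0

/-- All finite poles lie in the open left half-plane. -/
def IsStable {p m : ℕ} (H : RatMatrix p m) : Prop :=
  ∀ s : ℂ, IsPole H s → s.re < 0

/-- The value `H(s)` at a complex number `s` which is not a pole of `H`. -/
noncomputable def evalAt {p m : ℕ} (H : RatMatrix p m) (s : ℂ) : Matrix (Fin p) (Fin m) ℂ :=
  H.map (RatFunc.eval (algebraMap ℝ ℂ) s)

/-- The complex derivative `H'(s)` at a complex number `s` which is not a pole of `H`. -/
noncomputable def derivAt {p m : ℕ} (H : RatMatrix p m) (s : ℂ) : Matrix (Fin p) (Fin m) ℂ :=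
  Matrix.of fun i j => deriv (fun z : ℂ => evalAt H z i j) s

/-- `((1 / 2π) ∫ ‖H(iω)‖_F² dω)^(1/2)` with values in `[0, ∞]`, where `‖·‖_F` is the Frobenius
norm; it is `∞` when the integral diverges. -/
noncomputable def h2Norm {p m : ℕ} (H : RatMatrix p m) : ℝ≥0∞ :=
  (ENNReal.ofReal (1 / (2 * Real.pi)) *
    ∫⁻ ω : ℝ, ∑ i, ∑ j, ‖evalAt H (Complex.I * (ω : ℂ)) i j‖ₑ ^ 2) ^ (1 / 2 : ℝ)

/-- `Gr` belongs to the class `𝒞` and minimizes the error `‖G - Gr‖` over this class. -/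
def IsH2Minimizer {p m : ℕ} (G : RatMatrix p m) (𝒞 : Set (RatMatrix p m))
    (Gr : RatMatrix p m) : Prop :=
  Gr ∈ 𝒞 ∧ IsMinOn (fun H => h2Norm (G - H)) 𝒞 Gr

end ModelReduction

open ModelReduction

/-! Polynomial part. Adding `P` to any competitor of `Gsp` gives a competitor of `G` with the same
error, and the zero model has every order, so the optimal error is at most the finite norm of the
stable, strictly proper `Gsp`. A nonzero polynomial in the error would keep it away from zero at
infinity and make its norm infinite. Hence `Pr = P` and the problem is one for `Gsp`
(`minimizer_polynomial_part`).

Stationarity. Biorthogonality forces `E` to be nonsingular, so `E = 1` may be assumed, and the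
optimal strictly proper part is `∑ cᵢ bᵢᵀ / (s - λᵢ)`. With `D` the error, optimality along a curve
of admissible models with initial direction `K` gives `∑ ∫ D(iω) K(-iω) dω = 0`
(`re_sum_integral_eq_zero`, `variation_bilinear`). Written without conjugation, this condition is
complex linear in `K`, so that real perturbations of single matrix entries combine into complex
directions built from eigenvectors.

Evaluation. For `f` holomorphic on the closed right half-plane and `O(1/s)` at infinity,
orthogonality to `1 / (s - μ)` on the axis, with `Re μ > 0`, means `f μ = 0`
(`HardyLike.eq_zero_of_integral`). If all `λᵢ` are stable, perturbing `C`, `B` and `A` produces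
kernels with a simple, simple and double pole at `-λᵢ`, whence the right, left and bitangential
derivative conditions (`IsModal.interpolation`).

Two obstacles remain. If some `cᵢ` or `bᵢ` vanishes, the model wastes a state: any first order term
`u vᵀ / (s - a)`, with `a` not an eigenvalue, can be added without raising the order. Stationarity
in all these directions forces `D = 0`, which is the exceptional case (`IsModal.eq_of_hidden`).
Otherwise every residue `cᵢ bᵢᵀ` is nonzero, and every `λᵢ` must be stable (`IsModal.re_neg`). A
residue on the axis contradicts finite energy. For `λᵢ` in the right half-plane, either stability is
violated outright, or, when all models compete, `C` can be varied in the direction of the antistable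
part, which is orthogonal to the rest of the error and therefore vanishes. -/

open ModelReduction

/-! ### Values, poles and growth of real rational functions at complex points. -/

namespace ModelReduction
open Filter Topology Asymptotics
open Bornology (cobounded)

/-- The value of a real rational function at a complex point which is not a pole. -/
noncomputable def ratVal (f : RatFunc ℝ) (s : ℂ) : ℂ := RatFunc.eval (algebraMap ℝ ℂ) s f

/-- The complex point `s` is not a pole of `f`. -/
def Regular (f : RatFunc ℝ) (s : ℂ) : Prop := Polynomial.aeval s f.denom ≠ 0

theorem ratVal_eq (f : RatFunc ℝ) (s : ℂ) :
    ratVal f s = Polynomial.aeval s f.num / Polynomial.aeval s f.denom := rfl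

theorem evalAt_apply {p m : ℕ} (H : RatMatrix p m) (s : ℂ) (i : Fin p) (j : Fin m) :
    evalAt H s i j = ratVal (H i j) s := rfl

theorem not_isPole_iff {p m : ℕ} {H : RatMatrix p m} {s : ℂ} :
    ¬ IsPole H s ↔ ∀ i j, Regular (H i j) s := by
  simp [IsPole, Regular]

theorem ratVal_add {f g : RatFunc ℝ} {s : ℂ} (hf : Regular f s) (hg : Regular g s) :
    ratVal (f + g) s = ratVal f s + ratVal g s := RatFunc.eval_add _ _ hf hg

theorem ratVal_mul {f g : RatFunc ℝ} {s : ℂ} (hf : Regular f s) (hg : Regular g s) :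
    ratVal (f * g) s = ratVal f s * ratVal g s := RatFunc.eval_mul _ _ hf hg

/-- Cancellation can only remove poles, so any multiple of the reduced denominator may be tested
instead of the denominator itself. -/
theorem Regular.of_dvd {f : RatFunc ℝ} {q : ℝ[X]} {s : ℂ} (h : f.denom ∣ q)
    (hq : Polynomial.aeval s q ≠ 0) : Regular f s := by
  intro h0
  obtain ⟨c, rfl⟩ := h
  rw [map_mul, h0, zero_mul] at hq
  exact hq rfl

theorem Regular.add {f g : RatFunc ℝ} {s : ℂ} (hf : Regular f s) (hg : Regular g s) :
    Regular (f + g) s :=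
  .of_dvd (RatFunc.denom_add_dvd f g) (by rw [map_mul]; exact mul_ne_zero hf hg)

theorem Regular.mul {f g : RatFunc ℝ} {s : ℂ} (hf : Regular f s) (hg : Regular g s) :
    Regular (f * g) s :=
  .of_dvd (RatFunc.denom_mul_dvd f g) (by rw [map_mul]; exact mul_ne_zero hf hg)

theorem regular_algebraMap (q : ℝ[X]) (s : ℂ) : Regular (algebraMap ℝ[X] (RatFunc ℝ) q) s := by
  simp [Regular]

theorem regular_C (a : ℝ) (s : ℂ) : Regular (RatFunc.C a) s := by simp [Regular]

theorem ratVal_C (a : ℝ) (s : ℂ) : ratVal (RatFunc.C a) s = a := by simp [ratVal]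

theorem ratVal_algebraMap (q : ℝ[X]) (s : ℂ) :
    ratVal (algebraMap ℝ[X] (RatFunc ℝ) q) s = Polynomial.aeval s q := by
  simp [ratVal_eq]

theorem Regular.neg {f : RatFunc ℝ} {s : ℂ} (hf : Regular f s) : Regular (-f) s := by
  have := (regular_C (-1) s).mul hf
  simpa using this

theorem ratVal_neg {f : RatFunc ℝ} {s : ℂ} (hf : Regular f s) : ratVal (-f) s = - ratVal f s := by
  have := ratVal_mul (regular_C (-1) s) hf
  rw [ratVal_C] at this
  simpa using this

theorem Regular.sub {f g : RatFunc ℝ} {s : ℂ} (hf : Regular f s) (hg : Regular g s) :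
    Regular (f - g) s := by
  rw [sub_eq_add_neg]; exact hf.add hg.neg

theorem ratVal_sub {f g : RatFunc ℝ} {s : ℂ} (hf : Regular f s) (hg : Regular g s) :
    ratVal (f - g) s = ratVal f s - ratVal g s := by
  rw [sub_eq_add_neg, ratVal_add hf hg.neg, ratVal_neg hg, sub_eq_add_neg]

theorem regular_div {a q : ℝ[X]} {s : ℂ} (hq : Polynomial.aeval s q ≠ 0) :
    Regular (algebraMap ℝ[X] (RatFunc ℝ) a / algebraMap ℝ[X] (RatFunc ℝ) q) s :=
  .of_dvd (RatFunc.denom_div_dvd a q) hq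

theorem ratVal_div {a q : ℝ[X]} {s : ℂ} (hq : Polynomial.aeval s q ≠ 0) :
    ratVal (algebraMap ℝ[X] (RatFunc ℝ) a / algebraMap ℝ[X] (RatFunc ℝ) q) s =
      Polynomial.aeval s a / Polynomial.aeval s q := by
  have hq0 : q ≠ 0 := by rintro rfl; simp at hq
  have h := ratVal_mul (regular_div (a := a) hq) (regular_algebraMap q s)
  rw [div_mul_cancel₀ _ (by simpa using hq0), ratVal_algebraMap, ratVal_algebraMap] at h
  rw [h, mul_div_cancel_right₀ _ hq]

theorem finite_not_regular (f : RatFunc ℝ) : {s : ℂ | ¬ Regular f s}.Finite := by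
  have h0 : f.denom.map (algebraMap ℝ ℂ) ≠ 0 := by
    simpa [Polynomial.map_eq_zero] using f.denom_ne_zero
  refine (Polynomial.finite_setOfPred_isRoot h0).subset fun s hs => ?_
  simpa [Regular, Polynomial.IsRoot, Polynomial.eval_map_algebraMap] using hs

theorem eventually_regular_cofinite (f : RatFunc ℝ) : ∀ᶠ s in cofinite, Regular f s :=
  finite_not_regular f

theorem cobounded_le_cofinite : cobounded ℂ ≤ cofinite := Bornology.le_cofinite ℂ

theorem eventually_regular_cobounded (f : RatFunc ℝ) : ∀ᶠ s in cobounded ℂ, Regular f s :=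
  (eventually_regular_cofinite f).filter_mono cobounded_le_cofinite

theorem Regular.eventually {f : RatFunc ℝ} {s : ℂ} (hf : Regular f s) :
    ∀ᶠ z in 𝓝 s, Regular f z :=
  (Polynomial.continuous_aeval f.denom).continuousAt.eventually_ne hf

theorem Regular.differentiableAt {f : RatFunc ℝ} {s : ℂ} (hf : Regular f s) :
    DifferentiableAt ℂ (ratVal f) s := by
  have : ratVal f = fun s => Polynomial.aeval s f.num / Polynomial.aeval s f.denom := by
    ext s; exact ratVal_eq f s
  rw [this]
  exact (Polynomial.differentiable_aeval f.num s).div (Polynomial.differentiable_aeval f.denom s) hf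

theorem ratVal_conj (f : RatFunc ℝ) (s : ℂ) :
    ratVal f ((starRingEnd ℂ) s) = (starRingEnd ℂ) (ratVal f s) := by
  have h : ∀ q : ℝ[X], Polynomial.aeval ((starRingEnd ℂ) s) q =
      (starRingEnd ℂ) (Polynomial.aeval s q) := fun q => by
    exact Polynomial.aeval_conj q s
  rw [ratVal_eq, ratVal_eq, h, h, map_div₀]

/-- The value is zero only at roots of the numerator or, because division by zero gives zero, at
poles; for `f ≠ 0` both sets are finite. -/
theorem eq_zero_of_frequently_ratVal {f : RatFunc ℝ} {T : Set ℂ} (hT : T.Infinite)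
    (h : ∀ s ∈ T, ratVal f s = 0) : f = 0 := by
  by_contra hf
  have h0 : f.num.map (algebraMap ℝ ℂ) ≠ 0 := by
    simpa [Polynomial.map_eq_zero] using RatFunc.num_ne_zero hf
  refine hT (((Polynomial.finite_setOfPred_isRoot h0).union (finite_not_regular f)).subset
    fun s hs => ?_)
  by_cases hr : Regular f s
  · left
    have := h s hs
    rw [ratVal_eq, div_eq_zero_iff, or_iff_left hr] at this
    simpa [Polynomial.IsRoot, Polynomial.eval_map_algebraMap] using this
  · exact Or.inr hr

theorem ratVal_isBigO {f : RatFunc ℝ} (hf : f.num.degree < f.denom.degree) :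
    ratVal f =O[cobounded ℂ] fun s => s⁻¹ := by
  set a := f.num.map (algebraMap ℝ ℂ)
  set q := f.denom.map (algebraMap ℝ ℂ)
  -- Strict properness leaves room for one more factor `s` in the numerator; this factor is the gain
  -- `s⁻¹`.
  have hdeg : (Polynomial.X * a).degree ≤ q.degree := by
    rw [Polynomial.degree_mul, Polynomial.degree_X, Polynomial.degree_map, Polynomial.degree_map,
      add_comm]
    exact Nat.WithBot.add_one_le_of_lt hf
  have h := Polynomial.isBigO_cobounded_of_degree_le hdeg
  have h2 := h.mul (isBigO_refl (fun s => s⁻¹ * (q.eval s)⁻¹) (cobounded ℂ))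
  refine h2.congr' ?_ ?_
  · filter_upwards [Bornology.eventually_ne_cobounded (0 : ℂ)] with s hs
    simp only [Polynomial.eval_mul, Polynomial.eval_X]
    rw [ratVal_eq, ← Polynomial.eval_map_algebraMap, ← Polynomial.eval_map_algebraMap]
    field_simp
    rfl
  · filter_upwards [eventually_regular_cobounded f] with s hs
    have : q.eval s ≠ 0 := by
      rw [Polynomial.eval_map_algebraMap]; exact hs
    field_simp

theorem polynomial_isBigO_one_of_ne_zero {q : ℝ[X]} (hq : q ≠ 0) :
    (fun _ => (1 : ℂ)) =O[cobounded ℂ] fun s : ℂ => Polynomial.aeval s q := by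
  have h0 : q.map (algebraMap ℝ ℂ) ≠ 0 := by simpa [Polynomial.map_eq_zero] using hq
  have := Polynomial.isBigO_cobounded_of_degree_le (P := (1 : ℂ[X])) (Q := q.map (algebraMap ℝ ℂ))
    (by rw [Polynomial.degree_one]; exact Polynomial.zero_le_degree_iff.2 h0)
  simpa [Polynomial.eval_map_algebraMap] using this

theorem not_isPole_add {p m : ℕ} {H K : RatMatrix p m} {s : ℂ} (hH : ¬ IsPole H s)
    (hK : ¬ IsPole K s) : ¬ IsPole (H + K) s := by
  rw [not_isPole_iff] at *
  exact fun i j => (hH i j).add (hK i j)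

theorem not_isPole_sub {p m : ℕ} {H K : RatMatrix p m} {s : ℂ} (hH : ¬ IsPole H s)
    (hK : ¬ IsPole K s) : ¬ IsPole (H - K) s := by
  rw [not_isPole_iff] at *
  exact fun i j => (hH i j).sub (hK i j)

theorem not_isPole_ofPoly {p m : ℕ} (P : Matrix (Fin p) (Fin m) ℝ[X]) (s : ℂ) :
    ¬ IsPole (ofPoly P) s :=
  not_isPole_iff.2 fun i j => regular_algebraMap (P i j) s

theorem evalAt_add {p m : ℕ} {H K : RatMatrix p m} {s : ℂ} (hH : ¬ IsPole H s)
    (hK : ¬ IsPole K s) : evalAt (H + K) s = evalAt H s + evalAt K s := by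
  rw [not_isPole_iff] at *
  ext i j
  exact ratVal_add (hH i j) (hK i j)

theorem evalAt_sub {p m : ℕ} {H K : RatMatrix p m} {s : ℂ} (hH : ¬ IsPole H s)
    (hK : ¬ IsPole K s) : evalAt (H - K) s = evalAt H s - evalAt K s := by
  rw [not_isPole_iff] at *
  ext i j
  exact ratVal_sub (hH i j) (hK i j)

theorem IsStable.not_isPole {p m : ℕ} {H : RatMatrix p m} (hH : IsStable H) {s : ℂ}
    (hs : 0 ≤ s.re) : ¬ IsPole H s := fun h => (hH s h).not_ge hs

theorem isStable_of {p m : ℕ} {H : RatMatrix p m} (h : ∀ s : ℂ, 0 ≤ s.re → ¬ IsPole H s) :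
    IsStable H := fun s hs => by
  by_contra hre
  exact h s (not_lt.1 hre) hs

theorem IsStable.add {p m : ℕ} {H K : RatMatrix p m} (hH : IsStable H) (hK : IsStable K) :
    IsStable (H + K) :=
  isStable_of fun _ hs => not_isPole_add (hH.not_isPole hs) (hK.not_isPole hs)

theorem IsStable.sub {p m : ℕ} {H K : RatMatrix p m} (hH : IsStable H) (hK : IsStable K) :
    IsStable (H - K) :=
  isStable_of fun _ hs => not_isPole_sub (hH.not_isPole hs) (hK.not_isPole hs)

theorem isStable_ofPoly {p m : ℕ} (P : Matrix (Fin p) (Fin m) ℝ[X]) : IsStable (ofPoly P) :=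
  isStable_of fun s _ => not_isPole_ofPoly P s

theorem eventually_not_isPole_cofinite {p m : ℕ} (H : RatMatrix p m) :
    ∀ᶠ s in cofinite, ¬ IsPole H s := by
  simp_rw [not_isPole_iff, eventually_all]
  exact fun i j => eventually_regular_cofinite _

theorem eventually_not_isPole_cobounded {p m : ℕ} (H : RatMatrix p m) :
    ∀ᶠ s in cobounded ℂ, ¬ IsPole H s :=
  (eventually_not_isPole_cofinite H).filter_mono cobounded_le_cofinite

end ModelReduction

/-! ### State-space realizations and resolvent estimates. -/

namespace ModelReduction
open Filter Topology Asymptotics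
open Bornology (cobounded)

variable {r p m : ℕ}

/-- Pull `E` out of the pencil, `s E - A = E (s - E⁻¹ A)`, and absorb its inverse into the input
matrix. -/
theorem transferFunction_eq_one {E A : Matrix (Fin r) (Fin r) ℝ} (hE : IsUnit E.det)
    (B : Matrix (Fin r) (Fin m) ℝ) (C : Matrix (Fin p) (Fin r) ℝ) :
    transferFunction E A B C = transferFunction 1 (E⁻¹ * A) (E⁻¹ * B) C := by
  have hE' : IsUnit (E.map RatFunc.C).det := by
    have := hE.map (RatFunc.C (K := ℝ))
    rwa [RingHom.map_det] at this
  have h1 : ∀ {k : ℕ} (M : Matrix (Fin r) (Fin k) ℝ),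
      E.map RatFunc.C * (E⁻¹ * M).map RatFunc.C = M.map RatFunc.C := fun M => by
    rw [← Matrix.map_mul, Matrix.mul_nonsing_inv_cancel_left _ _ hE]
  have h2 : (RatFunc.X : RatFunc ℝ) • E.map RatFunc.C - A.map RatFunc.C =
      E.map RatFunc.C * ((RatFunc.X : RatFunc ℝ) • (1 : Matrix (Fin r) (Fin r) ℝ).map RatFunc.C -
        (E⁻¹ * A).map RatFunc.C) := by
    rw [Matrix.mul_sub, h1, Matrix.mul_smul, ← Matrix.map_mul, mul_one]
  unfold transferFunction
  rw [h2, Matrix.mul_inv_rev]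
  simp only [Matrix.mul_assoc]
  congr 2
  rw [← h1 B, Matrix.nonsing_inv_mul_cancel_left _ _ hE']

/-- The pencil `s - A` at a complex point. -/
noncomputable def pencil (A : Matrix (Fin r) (Fin r) ℝ) (s : ℂ) : Matrix (Fin r) (Fin r) ℂ :=
  s • 1 - A.map Complex.ofReal

theorem aeval_charpoly (A : Matrix (Fin r) (Fin r) ℝ) (s : ℂ) :
    Polynomial.aeval s A.charpoly = (pencil A s).det := by
  rw [Matrix.charpoly, ← AlgHom.coe_toRingHom, RingHom.map_det]
  congr 1
  ext i j
  by_cases h : i = j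
  · subst h; simp [pencil, Matrix.charmatrix_apply_eq]
  · simp [pencil, Matrix.charmatrix_apply_ne _ _ _ h, Matrix.one_apply_ne h]

/-- The numerator of a transfer function over the characteristic polynomial. -/
noncomputable def tfNum (A : Matrix (Fin r) (Fin r) ℝ) (B : Matrix (Fin r) (Fin m) ℝ)
    (C : Matrix (Fin p) (Fin r) ℝ) : Matrix (Fin p) (Fin m) ℝ[X] :=
  C.map Polynomial.C * A.charmatrix.adjugate * B.map Polynomial.C

/-- Cramer's rule over `ℝ[X]`. It shows that poles can occur only at roots of the characteristic
polynomial, and lets evaluation at complex points pass through polynomials. -/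
theorem transferFunction_apply (A : Matrix (Fin r) (Fin r) ℝ) (B : Matrix (Fin r) (Fin m) ℝ)
    (C : Matrix (Fin p) (Fin r) ℝ) (i : Fin p) (j : Fin m) :
    transferFunction 1 A B C i j = algebraMap ℝ[X] (RatFunc ℝ) (tfNum A B C i j) /
      algebraMap ℝ[X] (RatFunc ℝ) A.charpoly := by
  have h1 : (RatFunc.X : RatFunc ℝ) • (1 : Matrix (Fin r) (Fin r) ℝ).map RatFunc.C -
      A.map RatFunc.C = A.charmatrix.map (algebraMap ℝ[X] (RatFunc ℝ)) := by
    ext i j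
    by_cases h : i = j
    · subst h; simp [Matrix.charmatrix_apply_eq]
    · simp [Matrix.charmatrix_apply_ne _ _ _ h, Matrix.one_apply_ne h]
  have h2 : (A.charmatrix.map (algebraMap ℝ[X] (RatFunc ℝ))).det =
      algebraMap ℝ[X] (RatFunc ℝ) A.charpoly := by
    rw [Matrix.charpoly, RingHom.map_det]; rfl
  have h3 : (A.charmatrix.map (algebraMap ℝ[X] (RatFunc ℝ))).adjugate =
      A.charmatrix.adjugate.map (algebraMap ℝ[X] (RatFunc ℝ)) := by
    exact (RingHom.map_adjugate (algebraMap ℝ[X] (RatFunc ℝ)) A.charmatrix).symm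
  have hC : ∀ {k l : ℕ} (M : Matrix (Fin k) (Fin l) ℝ),
      M.map RatFunc.C = (M.map Polynomial.C).map (algebraMap ℝ[X] (RatFunc ℝ)) := fun M => by
    ext i j; simp
  rw [transferFunction, h1, Matrix.inv_def, h2, h3, hC C, hC B, Matrix.mul_smul, Matrix.smul_mul,
    ← Matrix.map_mul, ← Matrix.map_mul, Ring.inverse_eq_inv, Matrix.smul_apply, Matrix.map_apply,
    smul_eq_mul, div_eq_mul_inv, mul_comm]
  rfl

theorem aeval_tfNum (A : Matrix (Fin r) (Fin r) ℝ) (B : Matrix (Fin r) (Fin m) ℝ)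
    (C : Matrix (Fin p) (Fin r) ℝ) (s : ℂ) :
    (tfNum A B C).map (Polynomial.aeval s) =
      C.map Complex.ofReal * (pencil A s).adjugate * B.map Complex.ofReal := by
  have h1 : A.charmatrix.adjugate.map (Polynomial.aeval s) = (pencil A s).adjugate := by
    have := RingHom.map_adjugate (Polynomial.aeval s : ℝ[X] →ₐ[ℝ] ℂ).toRingHom A.charmatrix
    refine this.trans ?_
    congr 1
    ext i j
    by_cases h : i = j
    · subst h; simp [pencil, Matrix.charmatrix_apply_eq]
    · simp [pencil, Matrix.charmatrix_apply_ne _ _ _ h, Matrix.one_apply_ne h]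
  have hC : ∀ {k l : ℕ} (M : Matrix (Fin k) (Fin l) ℝ),
      (M.map Polynomial.C).map (Polynomial.aeval s) = M.map Complex.ofReal := fun M => by
    ext i j; simp
  rw [tfNum, Matrix.map_mul, Matrix.map_mul, h1, hC, hC]

theorem not_isPole_transferFunction {A : Matrix (Fin r) (Fin r) ℝ} {s : ℂ}
    (hs : IsUnit (pencil A s).det) (B : Matrix (Fin r) (Fin m) ℝ) (C : Matrix (Fin p) (Fin r) ℝ) :
    ¬ IsPole (transferFunction 1 A B C) s :=
  not_isPole_iff.2 fun i j => by
    rw [transferFunction_apply]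
    exact regular_div (by rw [aeval_charpoly]; exact hs.ne_zero)

theorem evalAt_transferFunction {A : Matrix (Fin r) (Fin r) ℝ} {s : ℂ}
    (hs : IsUnit (pencil A s).det) (B : Matrix (Fin r) (Fin m) ℝ) (C : Matrix (Fin p) (Fin r) ℝ) :
    evalAt (transferFunction 1 A B C) s =
      C.map Complex.ofReal * (pencil A s)⁻¹ * B.map Complex.ofReal := by
  ext i j
  rw [evalAt_apply, transferFunction_apply, ratVal_div (by rw [aeval_charpoly]; exact hs.ne_zero),
    aeval_charpoly, Matrix.inv_def, Matrix.mul_smul, Matrix.smul_mul, ← aeval_tfNum,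
    Ring.inverse_eq_inv, Matrix.smul_apply, smul_eq_mul, div_eq_mul_inv, mul_comm]
  rfl

theorem eventually_isUnit_pencil_cofinite (A : Matrix (Fin r) (Fin r) ℝ) :
    ∀ᶠ s in cofinite, IsUnit (pencil A s).det := by
  have h0 : A.charpoly.map (algebraMap ℝ ℂ) ≠ 0 := by
    simpa [Polynomial.map_eq_zero] using A.charpoly_monic.ne_zero
  refine (Polynomial.finite_setOfPred_isRoot h0).subset fun s hs => ?_
  have hs' : (pencil A s).det = 0 := by simpa [isUnit_iff_ne_zero] using hs
  show (A.charpoly.map (algebraMap ℝ ℂ)).IsRoot s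
  rw [Polynomial.IsRoot, Polynomial.eval_map_algebraMap, aeval_charpoly, hs']

attribute [local instance] Matrix.linftyOpNormedRing Matrix.linftyOpNormedAlgebra

theorem norm_apply_le_linfty {n : ℕ} (M : Matrix (Fin n) (Fin n) ℂ) (i j : Fin n) :
    ‖M i j‖ ≤ ‖M‖ := by
  rw [Matrix.linfty_opNorm_def]
  have h1 : ‖M i j‖₊ ≤ ∑ j, ‖M i j‖₊ :=
    Finset.single_le_sum (f := fun j => ‖M i j‖₊) (fun _ _ => zero_le) (Finset.mem_univ j)
  have h2 : (∑ j, ‖M i j‖₊) ≤ Finset.univ.sup fun i => ∑ j, ‖M i j‖₊ :=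
    Finset.le_sup (f := fun i => ∑ j, ‖M i j‖₊) (Finset.mem_univ i)
  exact_mod_cast h1.trans h2

/-- From `s R = 1 + A R` one gets `(|s| - ‖A‖) ‖R‖ ≤ ‖1‖`, and `|s| - ‖A‖ ≥ |s| / 2` for large `s`.
The norm `‖1‖` is kept because it is zero when `r = 0`. -/
theorem pencil_inv_isBigO (A : Matrix (Fin r) (Fin r) ℝ) :
    (fun s => (pencil A s)⁻¹) =O[cobounded ℂ] fun s => s⁻¹ := by
  set a := ‖A.map Complex.ofReal‖
  refine IsBigO.of_bound (2 * ‖(1 : Matrix (Fin r) (Fin r) ℂ)‖) ?_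
  filter_upwards [(eventually_isUnit_pencil_cofinite A).filter_mono cobounded_le_cofinite,
    (tendsto_norm_cobounded_atTop (E := ℂ)).eventually (eventually_ge_atTop (2 * a + 1))] with s hs hsa
  have ha : 0 ≤ a := norm_nonneg _
  have h1 : s • (pencil A s)⁻¹ = 1 + A.map Complex.ofReal * (pencil A s)⁻¹ := by
    have := Matrix.mul_nonsing_inv _ hs
    nth_rewrite 1 [pencil] at this
    rw [Matrix.sub_mul, Matrix.smul_mul, one_mul] at this
    rw [← this, sub_add_cancel]
  have h2 : ‖s‖ * ‖(pencil A s)⁻¹‖ ≤ ‖(1 : Matrix (Fin r) (Fin r) ℂ)‖ + a * ‖(pencil A s)⁻¹‖ := by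
    rw [← norm_smul, h1]
    exact (norm_add_le _ _).trans (by gcongr; exact norm_mul_le _ _)
  have hspos : 0 < ‖s‖ := by linarith
  rw [norm_inv, ← div_eq_mul_inv, le_div_iff₀ hspos]
  have h3 : 0 ≤ ‖(pencil A s)⁻¹‖ := norm_nonneg _
  nlinarith

theorem entry_isBigO {α : Type*} {l : Filter α} {n : ℕ} {M : α → Matrix (Fin n) (Fin n) ℂ}
    {g : α → ℂ} (h : M =O[l] g) (C : Matrix (Fin p) (Fin n) ℂ) (B : Matrix (Fin n) (Fin m) ℂ)
    (i : Fin p) (j : Fin m) : (fun s => (C * M s * B) i j) =O[l] g := by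
  simp only [Matrix.mul_apply, Finset.sum_mul]
  refine IsBigO.fun_sum fun k _ => ?_
  refine IsBigO.fun_sum fun l' _ => ?_
  have h0 : (fun s => M s l' k) =O[l] M :=
    IsBigO.of_bound 1 (Eventually.of_forall fun s => by
      simpa using norm_apply_le_linfty (M s) l' k)
  have := h0.trans h
  simp_rw [mul_comm (C i l'), mul_assoc]
  simpa [mul_comm] using this.const_mul_left (C i l' * B k j)

theorem evalAt_transferFunction_isBigO (A : Matrix (Fin r) (Fin r) ℝ)
    (B : Matrix (Fin r) (Fin m) ℝ) (C : Matrix (Fin p) (Fin r) ℝ) (i : Fin p) (j : Fin m) :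
    (fun s => evalAt (transferFunction 1 A B C) s i j) =O[cobounded ℂ] fun s => s⁻¹ := by
  refine (entry_isBigO (pencil_inv_isBigO A) (C.map Complex.ofReal) (B.map Complex.ofReal)
    i j).congr' ?_ .rfl
  filter_upwards [(eventually_isUnit_pencil_cofinite A).filter_mono cobounded_le_cofinite] with s hs
  rw [evalAt_transferFunction hs]

theorem HasOrder.exists_one {H : RatMatrix p m} (h : HasOrder r H) :
    ∃ (A : Matrix (Fin r) (Fin r) ℝ) (B : Matrix (Fin r) (Fin m) ℝ) (C : Matrix (Fin p) (Fin r) ℝ),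
      H = transferFunction 1 A B C := by
  obtain ⟨E, A, B, C, hE, rfl⟩ := h
  exact ⟨_, _, _, transferFunction_eq_one hE B C⟩

theorem hasOrder_one (A : Matrix (Fin r) (Fin r) ℝ) (B : Matrix (Fin r) (Fin m) ℝ)
    (C : Matrix (Fin p) (Fin r) ℝ) : HasOrder r (transferFunction 1 A B C) :=
  ⟨1, A, B, C, by simp, rfl⟩

theorem HasOrder.isBigO {H : RatMatrix p m} (h : HasOrder r H) (i : Fin p) (j : Fin m) :
    ratVal (H i j) =O[cobounded ℂ] fun s => s⁻¹ := by
  obtain ⟨A, B, C, rfl⟩ := h.exists_one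
  exact evalAt_transferFunction_isBigO A B C i j

theorem pencil_add_smul (A Δ : Matrix (Fin r) (Fin r) ℝ) (s : ℂ) (t : ℝ) :
    pencil (A + t • Δ) s = pencil A s - (t : ℂ) • Δ.map Complex.ofReal := by
  ext i j
  simp [pencil]
  ring

/-- The resolvent identity. -/
theorem pencil_inv_sub {A Δ : Matrix (Fin r) (Fin r) ℝ} {s : ℂ} {t : ℝ}
    (hs : IsUnit (pencil A s).det) (ht : IsUnit (pencil (A + t • Δ) s).det) :
    (pencil (A + t • Δ) s)⁻¹ - (pencil A s)⁻¹ =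
      (t : ℂ) • ((pencil (A + t • Δ) s)⁻¹ * Δ.map Complex.ofReal * (pencil A s)⁻¹) := by
  set D := Δ.map Complex.ofReal
  set R := (pencil A s)⁻¹
  set Rt := (pencil (A + t • Δ) s)⁻¹
  have h1 : Rt * (pencil A s - (t : ℂ) • D) * R = R := by
    rw [← pencil_add_smul, Matrix.nonsing_inv_mul _ ht, one_mul]
  have h2 : Rt * (pencil A s - (t : ℂ) • D) * R = Rt - (t : ℂ) • (Rt * D * R) := by
    rw [Matrix.mul_sub, Matrix.sub_mul, Matrix.mul_assoc Rt, Matrix.mul_nonsing_inv _ hs, mul_one,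
      Matrix.mul_smul, Matrix.smul_mul]
  rw [sub_eq_iff_eq_add, ← sub_eq_iff_eq_add']
  exact h2.symm.trans h1

/-- A bound for the resolvent of a perturbed matrix at a point where the perturbation is small
compared with the resolvent of the unperturbed one. -/
theorem pencil_perturb {A Δ : Matrix (Fin r) (Fin r) ℝ} {s : ℂ} (hs : IsUnit (pencil A s).det)
    {t : ℝ} (ht : |t| * (‖Δ.map Complex.ofReal‖ * ‖(pencil A s)⁻¹‖) ≤ 1 / 2) :
    IsUnit (pencil (A + t • Δ) s).det ∧
      ‖(pencil (A + t • Δ) s)⁻¹‖ ≤ 2 * ‖(pencil A s)⁻¹‖ := by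
  set D := Δ.map Complex.ofReal
  set R := (pencil A s)⁻¹
  have hle : ‖(t : ℂ) • (D * R)‖ ≤ 1 / 2 := by
    rw [norm_smul, Complex.norm_real, Real.norm_eq_abs]
    exact (mul_le_mul_of_nonneg_left (norm_mul_le _ _) (abs_nonneg _)).trans ht
  -- Neumann series: the perturbed pencil is the old one times a factor within `1 / 2` of the
  -- identity.
  have hu : IsUnit (1 - (t : ℂ) • (D * R)) :=
    isUnit_one_sub_of_norm_lt_one (hle.trans_lt (by norm_num))
  have hfac : pencil (A + t • Δ) s = (1 - (t : ℂ) • (D * R)) * pencil A s := by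
    rw [pencil_add_smul, Matrix.sub_mul, one_mul, Matrix.smul_mul, Matrix.mul_assoc,
      Matrix.nonsing_inv_mul _ hs, mul_one]
  have hunit : IsUnit (pencil (A + t • Δ) s).det := by
    rw [hfac, Matrix.det_mul]
    exact ((Matrix.isUnit_iff_isUnit_det _).1 hu).mul hs
  refine ⟨hunit, ?_⟩
  set Rt := (pencil (A + t • Δ) s)⁻¹
  -- The resolvent identity bounds `Rt` by `R` plus half of `Rt` itself; the last term is then
  -- absorbed on the left.
  have h3 : ‖Rt‖ ≤ ‖R‖ + ‖Rt‖ * (1 / 2) := by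
    calc ‖Rt‖ = ‖R + Rt * ((t : ℂ) • (D * R))‖ := by
          rw [Matrix.mul_smul, ← Matrix.mul_assoc, ← pencil_inv_sub hs hunit]; congr 1; abel
      _ ≤ ‖R‖ + ‖Rt * ((t : ℂ) • (D * R))‖ := norm_add_le _ _
      _ ≤ _ := by gcongr; exact (norm_mul_le _ _).trans (by gcongr)
  linarith

theorem norm_mul_apply_le (C : Matrix (Fin p) (Fin r) ℂ) (M : Matrix (Fin r) (Fin r) ℂ) (k : Fin p)
    (q : Fin r) : ‖(C * M) k q‖ ≤ (∑ a, ‖C k a‖) * ‖M‖ := by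
  rw [Matrix.mul_apply, Finset.sum_mul]
  refine (norm_sum_le _ _).trans (Finset.sum_le_sum fun a _ => ?_)
  rw [norm_mul]
  exact mul_le_mul_of_nonneg_left (norm_apply_le_linfty M a q) (norm_nonneg _)

end ModelReduction

/-! ### Hardy-type functions on the right half-plane: Cauchy's theorem and evaluation by the Szegő
kernel. -/

namespace ModelReduction
open Filter Topology Asymptotics
open Bornology (cobounded)
open Complex MeasureTheory

/-- Functions holomorphic on the closed right half plane (and near it) which are `O(1/s)` at
infinity. -/
structure HardyLike (f : ℂ → ℂ) : Prop where
  differentiableAt : ∀ s : ℂ, 0 ≤ s.re → DifferentiableAt ℂ f s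
  isBigO : f =O[cobounded ℂ] fun s => s⁻¹

/-- Functions continuous on the imaginary axis and `O(1/s)` at infinity. -/
structure AxisDecay (f : ℂ → ℂ) : Prop where
  continuous : Continuous fun ω : ℝ => f (I * ω)
  isBigO : f =O[cobounded ℂ] fun s => s⁻¹

theorem HardyLike.axisDecay {f : ℂ → ℂ} (hf : HardyLike f) : AxisDecay f where
  continuous := by
    refine continuous_iff_continuousAt.2 fun ω => ?_
    have h1 : ContinuousAt f (I * ω) := (hf.differentiableAt (I * ω) (by simp)).continuousAt
    have h2 : ContinuousAt (fun ω : ℝ => I * (ω : ℂ)) ω := by fun_prop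
    exact ContinuousAt.comp (f := fun ω : ℝ => I * (ω : ℂ)) h1 h2
  isBigO := hf.isBigO

theorem HardyLike.add {f g : ℂ → ℂ} (hf : HardyLike f) (hg : HardyLike g) :
    HardyLike (fun s => f s + g s) where
  differentiableAt s hs := (hf.differentiableAt s hs).add (hg.differentiableAt s hs)
  isBigO := hf.isBigO.add hg.isBigO

theorem HardyLike.const_mul {f : ℂ → ℂ} (hf : HardyLike f) (a : ℂ) :
    HardyLike (fun s => a * f s) where
  differentiableAt s hs := (hf.differentiableAt s hs).const_mul a
  isBigO := hf.isBigO.const_mul_left a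

theorem HardyLike.sub {f g : ℂ → ℂ} (hf : HardyLike f) (hg : HardyLike g) :
    HardyLike (fun s => f s - g s) where
  differentiableAt s hs := (hf.differentiableAt s hs).sub (hg.differentiableAt s hs)
  isBigO := hf.isBigO.sub hg.isBigO

theorem HardyLike.zero : HardyLike (fun _ => 0) where
  differentiableAt _ _ := differentiableAt_const _
  isBigO := isBigO_zero _ _

theorem HardyLike.sum {ι : Type*} {f : ι → ℂ → ℂ} (u : Finset ι) (hf : ∀ i ∈ u, HardyLike (f i)) :
    HardyLike (fun s => ∑ i ∈ u, f i s) where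
  differentiableAt s hs := DifferentiableAt.fun_sum fun i hi => (hf i hi).differentiableAt s hs
  isBigO := IsBigO.fun_sum fun i hi => (hf i hi).isBigO

theorem AxisDecay.const_mul {f : ℂ → ℂ} (hf : AxisDecay f) (a : ℂ) :
    AxisDecay (fun s => a * f s) :=
  ⟨continuous_const.mul hf.continuous, hf.isBigO.const_mul_left a⟩

theorem AxisDecay.sum {ι : Type*} {f : ι → ℂ → ℂ} (u : Finset ι) (hf : ∀ i ∈ u, AxisDecay (f i)) :
    AxisDecay (fun s => ∑ i ∈ u, f i s) :=
  ⟨continuous_finsetSum _ fun i hi => (hf i hi).continuous,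
    IsBigO.fun_sum fun i hi => (hf i hi).isBigO⟩

theorem isBigO_inv_sub (c : ℂ) : (fun s : ℂ => (s - c)⁻¹) =O[cobounded ℂ] fun s => s⁻¹ := by
  refine IsBigO.of_bound 2 ?_
  filter_upwards [(tendsto_norm_cobounded_atTop (E := ℂ)).eventually
    (eventually_ge_atTop (2 * ‖c‖ + 1))] with s hs
  have h1 : ‖s‖ - ‖c‖ ≤ ‖s - c‖ := norm_sub_norm_le _ _
  have h0 := norm_nonneg c
  have hs0 : 0 < ‖s‖ := by linarith
  rw [norm_inv, norm_inv, ← div_eq_mul_inv, inv_le_comm₀ (by linarith) (by positivity), inv_div]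
  linarith

theorem hardyLike_inv_sub {c : ℂ} (hc : c.re < 0) : HardyLike fun s => (s - c)⁻¹ where
  differentiableAt s hs := by
    have : s - c ≠ 0 := fun h => by
      rw [sub_eq_zero.1 h] at hs; linarith
    exact (differentiableAt_id.sub_const c).inv this
  isBigO := isBigO_inv_sub c

theorem axisDecay_inv_sub {c : ℂ} (hc : c.re ≠ 0) : AxisDecay fun s => (s - c)⁻¹ where
  continuous := by
    refine Continuous.inv₀ (by fun_prop) fun ω h => hc ?_
    rw [← sub_eq_zero.1 h]; simp
  isBigO := isBigO_inv_sub c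

theorem tendsto_axis_cobounded :
    Tendsto (fun ω : ℝ => I * (ω : ℂ)) (cocompact ℝ) (cobounded ℂ) := by
  rw [← tendsto_norm_atTop_iff_cobounded]
  simpa only [norm_mul, norm_I, one_mul, Complex.norm_real] using
    tendsto_norm_cocompact_atTop (E := ℝ)

/-- Continuity controls a compact set and decay controls its complement. The majorant `(1 +
ω²)^(-1/2)` is square integrable, and is the common dominating function used in all limits below. -/
theorem AxisDecay.exists_bound {f : ℂ → ℂ} (hf : AxisDecay f) :
    ∃ M : ℝ, 0 ≤ M ∧ ∀ ω : ℝ, ‖f (I * ω)‖ ≤ M * (√(1 + ω ^ 2))⁻¹ := by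
  obtain ⟨c, hc0, hc⟩ := (hf.isBigO.comp_tendsto tendsto_axis_cobounded).exists_pos
  obtain ⟨K, hK, hKc⟩ := mem_cocompact.1 (inter_mem hc.bound
    ((tendsto_norm_cocompact_atTop (E := ℝ)).eventually (eventually_ge_atTop 1)))
  obtain ⟨M, hM⟩ := hK.exists_bound_of_continuousOn
    (f := fun ω : ℝ => f (I * ω) * (√(1 + ω ^ 2) : ℝ))
    (Continuous.continuousOn (hf.continuous.mul (by fun_prop)))
  refine ⟨max M (2 * c), le_max_of_le_right (by positivity), fun ω => ?_⟩
  have hpos : 0 < √(1 + ω ^ 2) := Real.sqrt_pos.2 (by positivity)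
  by_cases hω : ω ∈ K
  · rw [← div_eq_mul_inv, le_div_iff₀ hpos]
    refine le_trans ?_ (le_max_left _ _)
    have := hM ω hω
    rwa [norm_mul, Complex.norm_real, Real.norm_eq_abs, abs_of_pos hpos] at this
  · obtain ⟨h1, h2⟩ := hKc hω
    simp only [Set.mem_ofPred_eq, Function.comp_apply, norm_inv, norm_mul, norm_I, one_mul,
      Complex.norm_real, Real.norm_eq_abs] at h1 h2
    refine h1.trans ?_
    -- Valid since `|ω| ≥ 1` off `K`; it is the source of the constant `2 * c`.
    have h3 : √(1 + ω ^ 2) ≤ 2 * |ω| := by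
      rw [Real.sqrt_le_left (by positivity)]
      rw [mul_pow, sq_abs]
      nlinarith [sq_abs ω]
    calc c * |ω|⁻¹ = (2 * c) * (2 * |ω|)⁻¹ := by rw [mul_inv]; ring
      _ ≤ (2 * c) * (√(1 + ω ^ 2))⁻¹ := by gcongr
      _ ≤ _ := by gcongr; exact le_max_right _ _

theorem sqrt_inv_sq (ω : ℝ) : (√(1 + ω ^ 2))⁻¹ * (√(1 + ω ^ 2))⁻¹ = (1 + ω ^ 2)⁻¹ := by
  rw [← mul_inv, Real.mul_self_sqrt (by positivity)]

theorem AxisDecay.integrable_mul {f g : ℂ → ℂ} (hf : AxisDecay f) (hg : AxisDecay g) :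
    Integrable fun ω : ℝ => f (I * ω) * g (I * ω) := by
  obtain ⟨M, hM0, hM⟩ := hf.exists_bound
  obtain ⟨N, hN0, hN⟩ := hg.exists_bound
  refine (integrable_inv_one_add_sq.const_mul (M * N)).mono'
    (hf.continuous.mul hg.continuous).aestronglyMeasurable (Eventually.of_forall fun ω => ?_)
  rw [norm_mul, ← sqrt_inv_sq]
  calc _ ≤ (M * (√(1 + ω ^ 2))⁻¹) * (N * (√(1 + ω ^ 2))⁻¹) :=
        mul_le_mul (hM ω) (hN ω) (norm_nonneg _) (by positivity)
    _ = _ := by ring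

theorem memLp_sqrt_inv : MemLp (fun ω : ℝ => (√(1 + ω ^ 2))⁻¹) 2 := by
  have hc : Continuous fun ω : ℝ => (√(1 + ω ^ 2))⁻¹ :=
    Continuous.inv₀ (by fun_prop) fun ω => (Real.sqrt_pos.2 (by positivity)).ne'
  rw [memLp_two_iff_integrable_sq hc.aestronglyMeasurable]
  exact integrable_inv_one_add_sq.congr (Eventually.of_forall fun ω =>
    (sqrt_inv_sq ω).symm.trans (pow_two _).symm)

theorem AxisDecay.memLp {f : ℂ → ℂ} (hf : AxisDecay f) :
    MemLp (fun ω : ℝ => f (I * ω)) 2 := by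
  obtain ⟨M, hM0, hM⟩ := hf.exists_bound
  refine (memLp_sqrt_inv.const_mul M).mono hf.continuous.aestronglyMeasurable
    (Eventually.of_forall fun ω => (hM ω).trans (le_abs_self _))

/-- Cauchy's theorem on the right half plane. -/
theorem integral_axis_eq_zero {f : ℂ → ℂ} (hd : ∀ s : ℂ, 0 ≤ s.re → DifferentiableAt ℂ f s)
    (hO : f =O[cobounded ℂ] fun s => s⁻¹ * s⁻¹)
    (hi : Integrable fun ω : ℝ => f (I * ω)) : ∫ ω : ℝ, f (I * ω) = 0 := by
  have h1 := intervalIntegral_tendsto_integral hi tendsto_neg_atTop_atBot tendsto_id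
  refine tendsto_nhds_unique h1 ?_
  obtain ⟨c, hc0, hc⟩ := hO.exists_pos
  obtain ⟨R, -, hR⟩ := (Metric.hasBasis_cobounded_compl_closedBall (0 : ℂ)).mem_iff.1 hc.bound
  have hlim : Tendsto (fun T : ℝ => 4 * c * T⁻¹) atTop (𝓝 0) := by
    simpa using tendsto_inv_atTop_zero.const_mul (4 * c)
  refine squeeze_zero_norm' ?_ hlim
  filter_upwards [eventually_gt_atTop (max R 0)] with T hT
  have hTR : R < T := (le_max_left _ _).trans_lt hT
  have hT0 : 0 < T := (le_max_right _ _).trans_lt hT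
  have hb : ∀ s : ℂ, T ≤ ‖s‖ → ‖f s‖ ≤ c * (T⁻¹ * T⁻¹) := fun s hs => by
    have h := hR (show s ∈ (Metric.closedBall (0 : ℂ) R)ᶜ by simp; linarith)
    refine (show ‖f s‖ ≤ c * ‖s⁻¹ * s⁻¹‖ from h).trans ?_
    rw [norm_mul, norm_inv]
    gcongr
  -- The rectangle is `[0, T] × [-T, T]`. Its three sides off the axis have length at most `2 T` and
  -- carry values `O(T⁻²)`, hence contribute `O(T⁻¹)`.
  have hrect := integral_boundary_rect_eq_zero_of_differentiableOn f (-(T : ℂ) * I) (T + T * I)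
    (fun s hs => (hd s (by
      have := hs.1
      simp [hT0.le] at this
      exact this.1)).differentiableWithinAt)
  simp only [neg_mul, neg_re, mul_re, ofReal_re, I_re, mul_zero, ofReal_im, I_im, mul_one, sub_self,
    neg_zero, add_re, add_zero, neg_im, mul_im, add_im, zero_add, ofReal_neg, ofReal_zero] at hrect
  have e1 : ‖∫ x in (0 : ℝ)..T, f (x + -(T * I))‖ ≤ c * (T⁻¹ * T⁻¹) * |T - 0| :=
    intervalIntegral.norm_integral_le_of_norm_le_const fun x _ => hb _ (by
      have := abs_im_le_norm ((x : ℂ) + -(T * I)); simpa [abs_of_pos hT0] using this)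
  have e2 : ‖∫ x in (0 : ℝ)..T, f (x + T * I)‖ ≤ c * (T⁻¹ * T⁻¹) * |T - 0| :=
    intervalIntegral.norm_integral_le_of_norm_le_const fun x _ => hb _ (by
      have := abs_im_le_norm ((x : ℂ) + T * I); simpa [abs_of_pos hT0] using this)
  have e3 : ‖∫ y in (-T)..T, f (T + y * I)‖ ≤ c * (T⁻¹ * T⁻¹) * |T - (-T)| :=
    intervalIntegral.norm_integral_le_of_norm_le_const fun y _ => hb _ (by
      have := abs_re_le_norm ((T : ℂ) + y * I); simpa [abs_of_pos hT0] using this)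
  have e4 : I • (∫ y in (-T)..T, f (I * y)) =
      (∫ x in (0 : ℝ)..T, f (x + -(T * I))) - (∫ x in (0 : ℝ)..T, f (x + T * I)) +
        I • ∫ y in (-T)..T, f (T + y * I) := by
    rw [← sub_eq_zero, ← neg_eq_zero, ← hrect]
    simp only [mul_comm I]
    ring
  have e5 : ‖∫ y in (-T)..T, f (I * y)‖ = ‖I • (∫ y in (-T)..T, f (I * y))‖ := by simp
  have hTT : T⁻¹ * T = 1 := inv_mul_cancel₀ hT0.ne'
  rw [sub_zero, abs_of_pos hT0] at e1 e2
  rw [sub_neg_eq_add, abs_of_pos (by linarith)] at e3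
  simp only [id]
  rw [e5, e4]
  refine (norm_add_le _ _).trans ((add_le_add (norm_sub_le _ _) le_rfl).trans ?_)
  rw [norm_smul, norm_I, one_mul]
  have : c * (T⁻¹ * T⁻¹) * T = c * T⁻¹ := by rw [mul_assoc, mul_assoc, hTT, mul_one]
  have : c * (T⁻¹ * T⁻¹) * (T + T) = 2 * (c * T⁻¹) := by rw [mul_add, this]; ring
  linarith

theorem HardyLike.integral_mul_eq_zero {f g : ℂ → ℂ} (hf : HardyLike f) (hg : HardyLike g) :
    ∫ ω : ℝ, f (I * ω) * g (I * ω) = 0 :=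
  integral_axis_eq_zero (f := fun s => f s * g s)
    (fun s hs => (hf.differentiableAt s hs).mul (hg.differentiableAt s hs))
    (hf.isBigO.mul hg.isBigO) (hf.axisDecay.integrable_mul hg.axisDecay)

/-- The singularity of the divided difference at `μ` is removable, and `μ` lies in the open
half-plane, where `f` is holomorphic in a neighbourhood. -/
theorem HardyLike.differentiableAt_dslope {f : ℂ → ℂ} (hf : HardyLike f) {μ : ℂ} (hμ : 0 < μ.re)
    {s : ℂ} (hs : 0 ≤ s.re) : DifferentiableAt ℂ (dslope f μ) s := by
  by_cases h : s = μ
  · subst h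
    have ho : {z : ℂ | 0 < z.re} ∈ 𝓝 s :=
      (isOpen_lt continuous_const Complex.continuous_re).mem_nhds hμ
    exact ((Complex.differentiableOn_dslope ho).2 fun z hz =>
      (hf.differentiableAt z (le_of_lt hz)).differentiableWithinAt).differentiableAt ho
  · exact (differentiableAt_dslope_of_ne h).2 (hf.differentiableAt s hs)

theorem dslope_eq_div {f : ℂ → ℂ} {μ s : ℂ} (hs : s ≠ μ) :
    dslope f μ s = (f s - f μ) * (s - μ)⁻¹ := by
  rw [dslope_of_ne _ hs, slope_def_field, div_eq_mul_inv]

theorem HardyLike.divDiff {f : ℂ → ℂ} (hf : HardyLike f) {μ : ℂ} (hμ : 0 < μ.re) :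
    HardyLike (dslope f μ) where
  differentiableAt s hs := hf.differentiableAt_dslope hμ hs
  isBigO := by
    have hb : (fun s => f s - f μ) =O[cobounded ℂ] fun _ => (1 : ℂ) := by
      refine (hf.isBigO.trans ?_).sub (isBigO_const_const _ one_ne_zero _)
      exact (tendsto_inv₀_cobounded (α := ℂ)).isBigO_one ℂ
    have := hb.mul (isBigO_inv_sub μ)
    simp only [one_mul] at this
    refine this.congr' ?_ .rfl
    filter_upwards [Bornology.eventually_ne_cobounded μ] with s hs
    rw [dslope_eq_div hs]

theorem axis_ne {μ : ℂ} (hμ : μ.re ≠ 0) (ω : ℝ) : I * (ω : ℂ) ≠ μ := fun h => hμ (by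
  rw [← h]; simp)

/-- If `f` is orthogonal on the axis to the Szegő kernel at `μ`, then `f μ = 0`. -/
theorem HardyLike.eq_zero_of_integral {f : ℂ → ℂ} (hf : HardyLike f) {μ : ℂ} (hμ : 0 < μ.re)
    (h : ∫ ω : ℝ, f (I * ω) * (I * ω - μ)⁻¹ = 0) : f μ = 0 := by
  -- The mirror image of `μ` in the imaginary axis. The divided difference behaves like `-f μ / s`
  -- at infinity; adding `f μ / (s - ν)` cancels this term, giving the decay `O(s⁻²)` that Cauchy's
  -- theorem needs, and creates no pole in the right half-plane.
  set ν : ℂ := -(starRingEnd ℂ) μ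
  have hν : ν.re < 0 := by simp [ν, hμ]
  have hint1 : Integrable fun ω : ℝ => f (I * ω) * (I * ω - μ)⁻¹ :=
    hf.axisDecay.integrable_mul (axisDecay_inv_sub hμ.ne')
  have hint2 : Integrable fun ω : ℝ => (I * (ω : ℂ) - ν)⁻¹ * (I * ω - μ)⁻¹ :=
    (axisDecay_inv_sub hν.ne).integrable_mul (axisDecay_inv_sub hμ.ne')
  have key : ∀ s, s ≠ μ → s ≠ ν → dslope f μ s + f μ * (s - ν)⁻¹ =
      f s * (s - μ)⁻¹ + (f μ * (ν - μ)) * ((s - ν)⁻¹ * (s - μ)⁻¹) := fun s h1 h2 => by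
    have h1' := sub_ne_zero.2 h1
    have h2' := sub_ne_zero.2 h2
    rw [dslope_eq_div h1]
    field_simp
    ring
  have hzero : ∫ ω : ℝ, (dslope f μ (I * ω) + f μ * (I * ω - ν)⁻¹) = 0 := by
    refine integral_axis_eq_zero (f := fun s => dslope f μ s + f μ * (s - ν)⁻¹) ?_ ?_ ?_
    · exact ((hf.divDiff hμ).add ((hardyLike_inv_sub hν).const_mul (f μ))).differentiableAt
    · have h1 := (hf.isBigO.mul (isBigO_inv_sub μ)).add
        (((isBigO_inv_sub ν).mul (isBigO_inv_sub μ)).const_mul_left (f μ * (ν - μ)))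
      refine h1.congr' ?_ .rfl
      filter_upwards [Bornology.eventually_ne_cobounded μ, Bornology.eventually_ne_cobounded ν]
        with s h1 h2
      exact (key s h1 h2).symm
    · refine (hint1.add (hint2.const_mul (f μ * (ν - μ)))).congr (Eventually.of_forall fun ω => ?_)
      exact (key _ (axis_ne hμ.ne' ω) (axis_ne hν.ne ω)).symm
  -- On the axis the two factors are conjugate up to sign, so the remaining integral is strictly
  -- negative. Its exact value is not needed: being nonzero is enough to conclude `f μ = 0`.
  have hnorm : ∀ ω : ℝ, (I * (ω : ℂ) - ν)⁻¹ * (I * ω - μ)⁻¹ =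
      ((-(normSq (I * ω - μ))⁻¹ : ℝ) : ℂ) := fun ω => by
    have : I * (ω : ℂ) - ν = -(starRingEnd ℂ) (I * ω - μ) := by
      simp [ν]
      ring
    rw [← mul_inv, this, neg_mul, mul_comm, mul_conj, inv_neg]
    push_cast
    rfl
  have hpos : 0 < ∫ ω : ℝ, (normSq (I * ω - μ))⁻¹ := by
    have hsq : ∀ ω : ℝ, 0 < normSq (I * ω - μ) := fun ω =>
      normSq_pos.2 (sub_ne_zero.2 (axis_ne hμ.ne' ω))
    have hi : Integrable fun ω : ℝ => (normSq (I * ω - μ))⁻¹ := by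
      refine hint2.norm.congr (Eventually.of_forall fun ω => ?_)
      show ‖_‖ = _
      rw [hnorm, Complex.norm_real, norm_neg, Real.norm_eq_abs, abs_of_pos (inv_pos.2 (hsq ω))]
    rw [integral_pos_iff_support_of_nonneg (fun ω => (inv_pos.2 (hsq ω)).le) hi]
    have : (Function.support fun ω : ℝ => (normSq (I * ω - μ))⁻¹) = Set.univ :=
      Set.eq_univ_of_forall fun ω => (inv_pos.2 (hsq ω)).ne'
    rw [this]
    simp
  have hsplit : ∫ ω : ℝ, (dslope f μ (I * ω) + f μ * (I * ω - ν)⁻¹) =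
      (f μ * (ν - μ)) * ((-∫ ω : ℝ, (normSq (I * ω - μ))⁻¹ : ℝ) : ℂ) := by
    rw [integral_congr_ae (Eventually.of_forall fun ω : ℝ =>
      key _ (axis_ne hμ.ne' ω) (axis_ne hν.ne ω)),
      integral_add hint1 (hint2.const_mul _), h, zero_add, integral_const_mul]
    simp_rw [hnorm]
    rw [integral_complex_ofReal, integral_neg]
  rw [hsplit, mul_eq_zero, mul_eq_zero] at hzero
  rcases hzero with (h0 | h0) | h0
  · exact h0
  · have := congrArg re h0
    simp [ν] at this
    linarith
  · rw [ofReal_eq_zero] at h0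
    linarith

/-- The zeros accumulate at `1`, so the identity theorem applies in the open half-plane; continuity
from the right extends the conclusion to the imaginary axis. -/
theorem HardyLike.eq_zero_of_finite {f : ℂ → ℂ} (hf : HardyLike f)
    (h : {x : ℝ | 0 < x ∧ f x ≠ 0}.Finite) {s : ℂ} (hs : 0 ≤ s.re) : f s = 0 := by
  have hopen : IsOpen {z : ℂ | 0 < z.re} := isOpen_lt continuous_const Complex.continuous_re
  have hconn : IsPreconnected {z : ℂ | 0 < z.re} := (convex_halfSpace_re_gt 0).isPreconnected
  have han : AnalyticOnNhd ℂ f {z : ℂ | 0 < z.re} := DifferentiableOn.analyticOnNhd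
    (fun z hz => (hf.differentiableAt z (le_of_lt hz)).differentiableWithinAt) hopen
  have hfreq : ∃ᶠ z in 𝓝[≠] (1 : ℂ), f z = 0 := by
    have hev : ∀ᶠ x : ℝ in 𝓝[≠] 1, f x = 0 := by
      have h1 : ∀ᶠ x : ℝ in 𝓝[≠] 1, x ∉ {x : ℝ | 0 < x ∧ f x ≠ 0} \ {1} :=
        mem_nhdsWithin_of_mem_nhds ((h.subset Set.sdiff_subset).isClosed.isOpen_compl.mem_nhds
          (by simp))
      filter_upwards [h1, self_mem_nhdsWithin,
        mem_nhdsWithin_of_mem_nhds (lt_mem_nhds one_pos)] with x h1 h2 h3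
      by_contra h4
      exact h1 ⟨⟨h3, h4⟩, h2⟩
    have ht : Tendsto (fun x : ℝ => (x : ℂ)) (𝓝[≠] 1) (𝓝[≠] 1) := by
      refine tendsto_nhdsWithin_of_tendsto_nhds_of_eventually_within _ ?_ ?_
      · exact (Complex.continuous_ofReal.tendsto' 1 1 (by simp)).mono_left nhdsWithin_le_nhds
      · filter_upwards [self_mem_nhdsWithin] with x hx
        simpa using hx
    exact ht.frequently hev.frequently
  have hzero := han.eqOn_zero_of_preconnected_of_frequently_eq_zero hconn
    (show (1 : ℂ) ∈ {z : ℂ | 0 < z.re} by simp) hfreq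
  have hlim : Tendsto (fun x : ℝ => f (s + x)) (𝓝[>] 0) (𝓝 (f s)) := by
    have h1 : ContinuousAt f (s + (0 : ℝ)) := by
      simpa using (hf.differentiableAt s hs).continuousAt
    have h2 : ContinuousAt (fun x : ℝ => s + (x : ℂ)) 0 := by fun_prop
    have := (ContinuousAt.comp (f := fun x : ℝ => s + (x : ℂ)) h1 h2).tendsto
    simpa [Function.comp_def] using this.mono_left nhdsWithin_le_nhds
  refine tendsto_nhds_unique (hlim.congr' ?_) (tendsto_const_nhds (x := (0 : ℂ)))
  filter_upwards [self_mem_nhdsWithin] with x hx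
  exact hzero (show 0 < (s + x).re by simp; exact add_pos_of_nonneg_of_pos hs hx)

end ModelReduction

/-! ### First variation of a squared `L²` error. -/

namespace ModelReduction
open Filter Topology Asymptotics
open Bornology (cobounded)
open Complex MeasureTheory

theorem lintegral_sum_enorm_sq {ι : Type*} [Fintype ι] {f : ι → ℝ → ℂ}
    (hf : ∀ i, MemLp (f i) 2) :
    ∫⁻ ω : ℝ, ∑ i, ‖f i ω‖ₑ ^ 2 = ENNReal.ofReal (∑ i, ∫ ω : ℝ, normSq (f i ω)) := by
  have hi : ∀ i, Integrable fun ω => normSq (f i ω) := fun i => by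
    simp_rw [normSq_eq_norm_sq]
    exact (hf i).integrable_norm_pow two_ne_zero
  rw [← integral_finsetSum _ fun i _ => hi i, ofReal_integral_eq_lintegral_ofReal
    (integrable_finsetSum _ fun i _ => hi i)
    (Eventually.of_forall fun ω => Finset.sum_nonneg fun i _ => normSq_nonneg _)]
  refine lintegral_congr fun ω => ?_
  rw [ENNReal.ofReal_sum_of_nonneg fun i _ => normSq_nonneg _]
  refine Finset.sum_congr rfl fun i _ => ?_
  rw [normSq_eq_norm_sq, ENNReal.ofReal_pow (norm_nonneg _), ofReal_norm]

/-- First order necessary condition for a minimal `L²` error along a curve with a dominated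
difference quotient. -/
theorem re_sum_integral_eq_zero {ι : Type*} [Fintype ι] {e : ι → ℝ → ℂ} {d : ℝ → ι → ℝ → ℂ}
    {g : ℝ → ℝ} (he : ∀ i, MemLp (e i) 2) (hg : MemLp g 2)
    (hd : ∀ᶠ t in 𝓝 0, ∀ i, AEStronglyMeasurable (d t i))
    (hb : ∀ᶠ t in 𝓝 0, ∀ i ω, ‖d t i ω‖ ≤ g ω)
    (hlim : ∀ i ω, Tendsto (fun t => d t i ω) (𝓝 0) (𝓝 (d 0 i ω)))
    (hmin : ∀ᶠ t : ℝ in 𝓝 0, ∫⁻ ω : ℝ, ∑ i, ‖e i ω‖ₑ ^ 2 ≤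
      ∫⁻ ω : ℝ, ∑ i, ‖e i ω - t * d t i ω‖ₑ ^ 2) :
    (∑ i, ∫ ω : ℝ, e i ω * (starRingEnd ℂ) (d 0 i ω)).re = 0 := by
  set J : ℝ → ℝ := fun t => (∑ i, ∫ ω : ℝ, e i ω * (starRingEnd ℂ) (d t i ω)).re with hJ
  set K : ℝ := ∑ _i : ι, ∫ ω : ℝ, g ω ^ 2 with hK
  have hJlim : Tendsto J (𝓝 0) (𝓝 (J 0)) := by
    refine (Complex.continuous_re.tendsto _).comp (tendsto_finsetSum _ fun i _ => ?_)
    refine tendsto_integral_filter_of_dominated_convergence (fun ω => ‖e i ω‖ * g ω) ?_ ?_ ?_ ?_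
    · filter_upwards [hd] with t ht
      exact (he i).aestronglyMeasurable.mul
        (Complex.continuous_conj.comp_aestronglyMeasurable (ht i))
    · filter_upwards [hb] with t ht
      refine Eventually.of_forall fun ω => ?_
      rw [norm_mul, RCLike.norm_conj]
      exact mul_le_mul_of_nonneg_left (ht i ω) (norm_nonneg _)
    · exact (he i).norm.integrable_mul hg
    · refine Eventually.of_forall fun ω => ?_
      exact ((Complex.continuous_conj.tendsto _).comp (hlim i ω)).const_mul _
  -- Expand `‖e - t d‖² = ‖e‖² - 2 t Re⟨e, d⟩ + t² ‖d‖²` and cancel `‖e‖²` in the minimality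
  -- inequality.
  have hineq : ∀ᶠ t in 𝓝 (0 : ℝ), 2 * t * J t ≤ t ^ 2 * K := by
    filter_upwards [hd, hb, hmin] with t htd htb htm
    have hdm : ∀ i, MemLp (d t i) 2 := fun i => hg.mono (htd i)
      (Eventually.of_forall fun ω => (htb i ω).trans (le_abs_self _))
    have hem : ∀ i, MemLp (fun ω => e i ω - t * d t i ω) 2 := fun i =>
      (he i).sub ((hdm i).const_mul (t : ℂ))
    have hsq : ∀ {f : ℝ → ℂ}, MemLp f 2 → Integrable fun ω => normSq (f ω) := fun hf => by
      simp_rw [normSq_eq_norm_sq]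
      exact hf.integrable_norm_pow two_ne_zero
    have hcr : ∀ i, Integrable fun ω => e i ω * (starRingEnd ℂ) (d t i ω) := fun i =>
      (he i).integrable_mul (hdm i).star
    rw [lintegral_sum_enorm_sq he, lintegral_sum_enorm_sq hem] at htm
    have htm' := (ENNReal.ofReal_le_ofReal_iff (Finset.sum_nonneg fun i _ =>
      integral_nonneg fun ω => normSq_nonneg _)).1 htm
    have hexp : ∀ i, ∫ ω : ℝ, normSq (e i ω - t * d t i ω) = (∫ ω : ℝ, normSq (e i ω)) -
        2 * t * (∫ ω : ℝ, e i ω * (starRingEnd ℂ) (d t i ω)).re +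
          t ^ 2 * ∫ ω : ℝ, normSq (d t i ω) := fun i => by
      have hre : (∫ ω : ℝ, e i ω * (starRingEnd ℂ) (d t i ω)).re =
          ∫ ω : ℝ, (e i ω * (starRingEnd ℂ) (d t i ω)).re :=
        (integral_re (hcr i)).symm
      have hcr' : Integrable fun ω : ℝ => (e i ω * (starRingEnd ℂ) (d t i ω)).re := (hcr i).re
      have hsub : Integrable fun ω : ℝ => normSq (e i ω) -
          2 * t * (e i ω * (starRingEnd ℂ) (d t i ω)).re := (hsq (he i)).sub (hcr'.const_mul _)
      rw [hre, ← integral_const_mul, ← integral_const_mul,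
        ← integral_sub (hsq (he i)) (hcr'.const_mul _),
        ← integral_add hsub ((hsq (hdm i)).const_mul _)]
      refine integral_congr_ae (Eventually.of_forall fun ω => ?_)
      simp only
      rw [normSq_sub, normSq_mul, normSq_ofReal, map_mul, conj_ofReal,
        show e i ω * (t * (starRingEnd ℂ) (d t i ω)) =
          (t : ℂ) * (e i ω * (starRingEnd ℂ) (d t i ω)) by ring, re_ofReal_mul]
      ring
    have hdK : ∀ i, ∫ ω : ℝ, normSq (d t i ω) ≤ ∫ ω : ℝ, g ω ^ 2 := fun i => by
      refine integral_mono (hsq (hdm i)) hg.integrable_sq fun ω => ?_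
      simp only [normSq_eq_norm_sq]
      exact pow_le_pow_left₀ (norm_nonneg _) (htb i ω) 2
    simp_rw [hexp] at htm'
    rw [Finset.sum_add_distrib, Finset.sum_sub_distrib, ← Finset.mul_sum, ← Finset.mul_sum] at htm'
    have h3 : ∑ i, ∫ ω : ℝ, normSq (d t i ω) ≤ K := Finset.sum_le_sum fun i _ => hdK i
    have h4 : J t = ∑ i, (∫ ω : ℝ, e i ω * (starRingEnd ℂ) (d t i ω)).re := by
      simp only [hJ, Complex.re_sum]
    rw [← h4] at htm'
    nlinarith [mul_le_mul_of_nonneg_left h3 (sq_nonneg t)]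
  have hK0 : Tendsto (fun t : ℝ => t * K / 2) (𝓝 0) (𝓝 0) :=
    Continuous.tendsto' (by fun_prop) _ _ (by simp)
  -- Divide `2 t J t ≤ t² K` by `2 t`: positive `t` bounds the limit of `J` from above, negative `t`
  -- from below.
  apply le_antisymm
  · refine le_of_tendsto_of_tendsto (hJlim.mono_left (nhdsWithin_le_nhds (s := Set.Ioi 0)))
      (hK0.mono_left nhdsWithin_le_nhds) ?_
    filter_upwards [self_mem_nhdsWithin, nhdsWithin_le_nhds hineq] with t ht h
    have ht' : 0 < t := ht
    by_contra hc
    rw [not_le] at hc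
    nlinarith
  · refine le_of_tendsto_of_tendsto (hK0.mono_left nhdsWithin_le_nhds)
      (hJlim.mono_left (nhdsWithin_le_nhds (s := Set.Iio 0))) ?_
    filter_upwards [self_mem_nhdsWithin, nhdsWithin_le_nhds hineq] with t ht h
    have ht' : t < 0 := ht
    by_contra hc
    rw [not_le] at hc
    nlinarith

end ModelReduction

/-! ### Hidden modes: adding a first order term without raising the order. -/

namespace ModelReduction
open Filter Topology Asymptotics
open Bornology (cobounded)

variable {r p m : ℕ}

/-- The rank one first order model `u vᵀ / (s - a)`. -/
noncomputable def simplePole (u : Fin p → ℝ) (v : Fin m → ℝ) (a : ℝ) : RatMatrix p m :=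
  Matrix.of fun i j => algebraMap ℝ[X] (RatFunc ℝ) (Polynomial.C (u i * v j)) /
    algebraMap ℝ[X] (RatFunc ℝ) (Polynomial.X - Polynomial.C a)

theorem aeval_X_sub_C_ne_zero {a : ℝ} {s : ℂ} (hs : s ≠ a) :
    Polynomial.aeval s (Polynomial.X - Polynomial.C a : ℝ[X]) ≠ 0 := by
  simpa [sub_eq_zero] using hs

theorem not_isPole_simplePole (u : Fin p → ℝ) (v : Fin m → ℝ) {a : ℝ} {s : ℂ} (hs : s ≠ a) :
    ¬ IsPole (simplePole u v a) s :=
  not_isPole_iff.2 fun _ _ => regular_div (aeval_X_sub_C_ne_zero hs)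

theorem evalAt_simplePole (u : Fin p → ℝ) (v : Fin m → ℝ) {a : ℝ} {s : ℂ} (hs : s ≠ a)
    (i : Fin p) (j : Fin m) :
    evalAt (simplePole u v a) s i j = (u i * v j : ℂ) * (s - a)⁻¹ := by
  rw [evalAt_apply, simplePole, Matrix.of_apply, ratVal_div (aeval_X_sub_C_ne_zero hs)]
  simp [div_eq_mul_inv]

theorem isStable_simplePole (u : Fin p → ℝ) (v : Fin m → ℝ) {a : ℝ} (ha : a < 0) :
    IsStable (simplePole u v a) :=
  isStable_of fun s hs => not_isPole_simplePole u v fun h => by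
    rw [h, Complex.ofReal_re] at hs
    linarith

/-- Lets identities between rational matrices be proved pointwise, away from the finitely many
points where something is singular. -/
theorem ratMatrix_ext {H K : RatMatrix p m} (h : ∀ᶠ s in cofinite, evalAt H s = evalAt K s) :
    H = K := by
  ext i j
  rw [← sub_eq_zero]
  have h2 : ∀ᶠ s in cofinite, ratVal (H i j - K i j) s = 0 := by
    filter_upwards [h, eventually_not_isPole_cofinite H, eventually_not_isPole_cofinite K]
      with s hs hH hK
    rw [ratVal_sub (not_isPole_iff.1 hH i j) (not_isPole_iff.1 hK i j), ← evalAt_apply,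
      ← evalAt_apply, hs, sub_self]
  refine eq_zero_of_frequently_ratVal (T := {s | ratVal (H i j - K i j) s = 0}) ?_ fun s hs => hs
  exact fun hfin => (frequently_cofinite_iff_infinite.2 (Set.infinite_univ (α := ℂ))
    |>.and_eventually (h2.and (hfin.eventually_cofinite_notMem))).exists.elim
      fun s hs => hs.2.2 hs.2.1

/-- With `Δ = A' - A`, the resolvent identity gives `R' - R = (s - a)⁻¹ Δ R`, which `C` annihilates,
so the replacement of `A` by `A'` is invisible at the output. In the expanded product, `C R' n`
vanishes, while the term with `u w` contributes `(s - a)⁻¹ u (w B + v - w B)`; the correction `- w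
B` in the input matrix is chosen for this cancellation. -/
theorem realization_add_simplePole {A A' : Matrix (Fin r) (Fin r) ℝ} (B : Matrix (Fin r) (Fin m) ℝ)
    {C : Matrix (Fin p) (Fin r) ℝ} {a : ℝ} {n w : Fin r → ℝ} (hD : A' * (A' - A) = a • (A' - A))
    (hC : C * (A' - A) = 0) (hn : A' *ᵥ n = a • n) (hCn : C *ᵥ n = 0) (hw : w ᵥ* A' = a • w)
    (hwn : w ⬝ᵥ n = 1) (u : Fin p → ℝ) (v : Fin m → ℝ) :
    transferFunction 1 A' (B + Matrix.vecMulVec n (v - w ᵥ* B)) (C + Matrix.vecMulVec u w) =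
      transferFunction 1 A B C + simplePole u v a := by
  refine ratMatrix_ext ?_
  filter_upwards [eventually_isUnit_pencil_cofinite A, eventually_isUnit_pencil_cofinite A',
    (Set.finite_singleton (a : ℂ)).eventually_cofinite_notMem] with s hA hA' hsa
  have hsa' : s ≠ a := hsa
  have hsa0 : s - a ≠ 0 := sub_ne_zero.2 hsa'
  rw [evalAt_add (not_isPole_transferFunction hA B C) (not_isPole_simplePole u v hsa'),
    evalAt_transferFunction hA', evalAt_transferFunction hA]
  set R := (pencil A s)⁻¹
  set R' := (pencil A' s)⁻¹
  have hR' : R' * pencil A' s = 1 := Matrix.nonsing_inv_mul _ hA'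
  have hR'2 : pencil A' s * R' = 1 := Matrix.mul_nonsing_inv _ hA'
  have hR : pencil A s * R = 1 := Matrix.mul_nonsing_inv _ hA
  have hmapmul : ∀ {k l q : ℕ} (M : Matrix (Fin k) (Fin l) ℝ) (N : Matrix (Fin l) (Fin q) ℝ),
      (M * N).map Complex.ofReal = M.map Complex.ofReal * N.map Complex.ofReal := fun M N =>
    Matrix.map_mul (f := Complex.ofRealHom)
  have h1 : R' * (A' - A).map Complex.ofReal = (s - a)⁻¹ • (A' - A).map Complex.ofReal := by
    have e : pencil A' s * (A' - A).map Complex.ofReal = (s - a) • (A' - A).map Complex.ofReal := by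
      rw [pencil, Matrix.sub_mul, ← hmapmul, hD, sub_smul, Matrix.smul_mul, one_mul]
      congr 1
      ext i j; simp
    rw [eq_inv_smul_iff₀ hsa0, ← Matrix.mul_smul, ← e, ← Matrix.mul_assoc, hR', one_mul]
  have h2 : C.map Complex.ofReal * R' = C.map Complex.ofReal * R := by
    have e : pencil A s - pencil A' s = (A' - A).map Complex.ofReal := by
      ext i j; simp [pencil]
    have e2 : R' - R = R' * (A' - A).map Complex.ofReal * R := by
      rw [← e, Matrix.mul_sub, hR', Matrix.sub_mul, Matrix.mul_assoc, hR, mul_one, one_mul]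
    rw [← sub_eq_zero, ← Matrix.mul_sub, e2, h1, Matrix.smul_mul, Matrix.mul_smul,
      ← Matrix.mul_assoc, ← hmapmul, hC]
    simp
  have hvm : ∀ {k l : ℕ} (x : Fin k → ℝ) (y : Fin l → ℝ),
      (Matrix.vecMulVec x y).map Complex.ofReal =
        Matrix.vecMulVec (fun i => (x i : ℂ)) (fun i => (y i : ℂ)) := fun x y => by
    ext i j; simp [Matrix.vecMulVec_apply]
  have h3 : R' *ᵥ (fun i => (n i : ℂ)) = (s - a)⁻¹ • fun i => (n i : ℂ) := by
    have e : pencil A' s *ᵥ (fun i => (n i : ℂ)) = (s - a) • fun i => (n i : ℂ) := by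
      rw [pencil, Matrix.sub_mulVec, Matrix.smul_mulVec, Matrix.one_mulVec, sub_smul]
      congr 1
      ext i
      have := congrArg Complex.ofReal (congrFun hn i)
      simpa [Matrix.mulVec, dotProduct] using this
    rw [eq_inv_smul_iff₀ hsa0, ← Matrix.mulVec_smul, ← e, Matrix.mulVec_mulVec, hR',
      Matrix.one_mulVec]
  have h4 : (fun i => (w i : ℂ)) ᵥ* R' = (s - a)⁻¹ • fun i => (w i : ℂ) := by
    have e : (fun i => (w i : ℂ)) ᵥ* pencil A' s = (s - a) • fun i => (w i : ℂ) := by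
      rw [pencil, Matrix.vecMul_sub, Matrix.vecMul_smul, Matrix.vecMul_one, sub_smul]
      congr 1
      ext i
      have := congrArg Complex.ofReal (congrFun hw i)
      simpa [Matrix.vecMul, dotProduct] using this
    rw [eq_inv_smul_iff₀ hsa0, ← Matrix.smul_vecMul, ← e, Matrix.vecMul_vecMul, hR'2,
      Matrix.vecMul_one]
  have h5 : C.map Complex.ofReal *ᵥ (fun i => (n i : ℂ)) = 0 := by
    ext i
    have := congrArg Complex.ofReal (congrFun hCn i)
    simpa [Matrix.mulVec, dotProduct] using this
  have h6 : (fun i => (w i : ℂ)) ⬝ᵥ (fun i => (n i : ℂ)) = 1 := by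
    have := congrArg Complex.ofReal hwn
    simpa [dotProduct] using this
  have hCadd : (C + Matrix.vecMulVec u w).map Complex.ofReal = C.map Complex.ofReal +
      Matrix.vecMulVec (fun i => (u i : ℂ)) (fun i => (w i : ℂ)) := by
    rw [← hvm]; ext i j; simp
  have hBadd : (B + Matrix.vecMulVec n (v - w ᵥ* B)).map Complex.ofReal = B.map Complex.ofReal +
      Matrix.vecMulVec (fun i => (n i : ℂ)) (fun i => ((v - w ᵥ* B) i : ℂ)) := by
    rw [← hvm]; ext i j; simp
  have hwB : (fun i => (w i : ℂ)) ᵥ* B.map Complex.ofReal = fun j => (((w ᵥ* B) j : ℝ) : ℂ) := by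
    ext j; simp [Matrix.vecMul, dotProduct]
  rw [hCadd, hBadd, Matrix.add_mul, Matrix.mul_add, Matrix.add_mul, Matrix.add_mul, h2,
    Matrix.mul_vecMulVec, ← h2, ← Matrix.mulVec_mulVec, h3, Matrix.mulVec_smul, h5,
    Matrix.vecMulVec_mul, h4, Matrix.vecMulVec_mul, Matrix.vecMulVec_mul_vecMulVec,
    Matrix.smul_vecMul, hwB, smul_dotProduct, h6]
  ext i j
  simp only [Matrix.add_apply, evalAt_simplePole u v hsa']
  simp [Matrix.vecMulVec_apply]
  ring

/-- Meant for the real and imaginary parts of a complex eigenvector, which may be linearly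
dependent; hence a left inverse of the inclusion of their span instead of a formula. -/
theorem exists_projection (x y : Fin r → ℝ) : ∃ Q : Matrix (Fin r) (Fin r) ℝ,
    Q *ᵥ x = x ∧ Q *ᵥ y = y ∧ ∀ v, Q *ᵥ v ∈ Submodule.span ℝ {x, y} := by
  set N := Submodule.span ℝ {x, y}
  obtain ⟨g, hg⟩ := N.subtype.exists_leftInverse_of_injective (Submodule.ker_subtype N)
  have hfix : ∀ v ∈ N, (g v : Fin r → ℝ) = v := fun v hv => by
    have := LinearMap.congr_fun hg ⟨v, hv⟩
    exact congrArg Subtype.val this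
  refine ⟨LinearMap.toMatrix' (N.subtype ∘ₗ g), ?_, ?_, fun v => ?_⟩
  · rw [LinearMap.toMatrix'_mulVec]
    exact hfix x (Submodule.subset_span (by simp))
  · rw [LinearMap.toMatrix'_mulVec]
    exact hfix y (Submodule.subset_span (by simp))
  · rw [LinearMap.toMatrix'_mulVec]
    exact (g v).2

/-- A model with an unobservable mode keeps its order when a first order model is added. -/
theorem hasOrder_add_simplePole_of_unobservable {A : Matrix (Fin r) (Fin r) ℝ}
    (B : Matrix (Fin r) (Fin m) ℝ) {C : Matrix (Fin p) (Fin r) ℝ} {z : Fin r → ℂ} {l : ℂ}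
    (hz : z ≠ 0) (hAz : A.map Complex.ofReal *ᵥ z = l • z) (hCz : C.map Complex.ofReal *ᵥ z = 0)
    {a : ℝ} (ha : IsUnit (A - a • 1).det) (u : Fin p → ℝ) (v : Fin m → ℝ) :
    HasOrder r (transferFunction 1 A B C + simplePole u v a) := by
  -- The eigenvector is complex while realizations must be real. The real span of its two parts is
  -- `A`-invariant and is killed by `C`.
  set x : Fin r → ℝ := fun i => (z i).re
  set y : Fin r → ℝ := fun i => (z i).im
  obtain ⟨Q, hx, hy, hspan⟩ := exists_projection x y
  have hAx : A *ᵥ x = l.re • x - l.im • y := by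
    ext i
    have := congrArg Complex.re (congrFun hAz i)
    simpa [Matrix.mulVec, dotProduct, x, y] using this
  have hAy : A *ᵥ y = l.im • x + l.re • y := by
    ext i
    have := congrArg Complex.im (congrFun hAz i)
    simp [Matrix.mulVec, dotProduct] at this
    simp [Matrix.mulVec, dotProduct, x, y, this]
    ring
  have hCx : C *ᵥ x = 0 := by
    ext i
    have := congrArg Complex.re (congrFun hCz i)
    simpa [Matrix.mulVec, dotProduct, x] using this
  have hCy : C *ᵥ y = 0 := by
    ext i
    have := congrArg Complex.im (congrFun hCz i)
    simpa [Matrix.mulVec, dotProduct, y] using this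
  have hCs : ∀ q ∈ Submodule.span ℝ {x, y}, C *ᵥ q = 0 := fun q hq => by
    obtain ⟨α, β, rfl⟩ := Submodule.mem_span_pair.1 hq
    simp [Matrix.mulVec_add, Matrix.mulVec_smul, hCx, hCy]
  have hfix : ∀ q ∈ Submodule.span ℝ {x, y}, Q *ᵥ q = q := fun q hq => by
    obtain ⟨α, β, rfl⟩ := Submodule.mem_span_pair.1 hq
    simp [Matrix.mulVec_add, Matrix.mulVec_smul, hx, hy]
  set K := A - a • (1 : Matrix (Fin r) (Fin r) ℝ)
  have hKinv : ∀ q ∈ Submodule.span ℝ {x, y}, K *ᵥ q ∈ Submodule.span ℝ {x, y} := fun q hq => by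
    have hxm : x ∈ Submodule.span ℝ {x, y} := Submodule.subset_span (by simp)
    have hym : y ∈ Submodule.span ℝ {x, y} := Submodule.subset_span (by simp)
    rw [Matrix.sub_mulVec, Matrix.smul_mulVec, Matrix.one_mulVec]
    refine Submodule.sub_mem _ ?_ (Submodule.smul_mem _ _ hq)
    obtain ⟨α, β, rfl⟩ := Submodule.mem_span_pair.1 hq
    rw [Matrix.mulVec_add, Matrix.mulVec_smul, Matrix.mulVec_smul, hAx, hAy]
    exact Submodule.add_mem _
      (Submodule.smul_mem _ _ (Submodule.sub_mem _ (Submodule.smul_mem _ _ hxm)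
        (Submodule.smul_mem _ _ hym)))
      (Submodule.smul_mem _ _ (Submodule.add_mem _ (Submodule.smul_mem _ _ hxm)
        (Submodule.smul_mem _ _ hym)))
  have hQK : Q * (K * Q) = K * Q := by
    refine Matrix.ext_of_mulVec_single fun i => ?_
    rw [← Matrix.mulVec_mulVec, ← Matrix.mulVec_mulVec]
    exact hfix _ (hKinv _ (hspan _))
  have hCK : C * (K * Q) = 0 := by
    refine Matrix.ext_of_mulVec_single fun i => ?_
    rw [← Matrix.mulVec_mulVec, ← Matrix.mulVec_mulVec, Matrix.zero_mulVec]
    exact hCs _ (hKinv _ (hspan _))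
  obtain ⟨q, hq, hq0⟩ : ∃ q ∈ Submodule.span ℝ {x, y}, q ≠ 0 := by
    by_contra! hcon
    have h1 := hcon x (Submodule.subset_span (by simp))
    have h2 := hcon y (Submodule.subset_span (by simp))
    refine hz (funext fun i => Complex.ext ?_ ?_)
    · exact congrFun h1 i
    · exact congrFun h2 i
  obtain ⟨k, hk⟩ := Function.ne_iff.1 hq0
  -- A coordinate functional normalized to take the value `1` at `q`; it supplies the left
  -- eigenvector of `A'`.
  set ψ : Fin r → ℝ := Pi.single k (q k)⁻¹
  have hψ : ψ ⬝ᵥ q = 1 := by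
    rw [single_dotProduct]
    exact inv_mul_cancel₀ hk
  have hKi : K⁻¹ * K = 1 := Matrix.nonsing_inv_mul _ ha
  have hAK : A = K + a • 1 := by simp [K]
  -- Moves the hidden modes to `a`: on the invariant span, `1 - Q` vanishes and `A'` acts as the
  -- scalar `a`. Invertibility of `K = A - a` makes `(ψ Q) K⁻¹` a left eigenvector for `a`, paired
  -- to `1` with `K q`.
  have hA' : A - K * Q = K * (1 - Q) + a • 1 := by
    rw [Matrix.mul_sub, mul_one]
    nth_rewrite 1 [hAK]
    abel
  have hsub : A - K * Q - A = -(K * Q) := by abel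
  have hKK : K * (1 - Q) * (K * Q) = 0 := by
    have h1 : (1 - Q) * (K * Q) = 0 := by rw [Matrix.sub_mul, one_mul, hQK, sub_self]
    rw [Matrix.mul_assoc, h1, mul_zero]
  rw [← realization_add_simplePole (A' := A - K * Q) (n := K *ᵥ q) (w := (ψ ᵥ* Q) ᵥ* K⁻¹) B
    ?_ ?_ ?_ ?_ ?_ ?_ u v]
  · exact hasOrder_one _ _ _
  · rw [hsub, hA', Matrix.mul_neg, Matrix.add_mul, hKK, zero_add, Matrix.smul_mul, one_mul, smul_neg]
  · rw [hsub, Matrix.mul_neg, hCK, neg_zero]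
  · have e : K *ᵥ q = (K * Q) *ᵥ q := by rw [← Matrix.mulVec_mulVec, hfix q hq]
    rw [hA', Matrix.add_mulVec, Matrix.smul_mulVec, Matrix.one_mulVec]
    nth_rewrite 1 [e]
    rw [Matrix.mulVec_mulVec, hKK, Matrix.zero_mulVec, zero_add]
  · exact hCs _ (hKinv _ hq)
  · have hPi : Q * (1 - Q) = 0 := by
      refine Matrix.ext_of_mulVec_single fun i => ?_
      rw [Matrix.mul_sub, mul_one, Matrix.sub_mulVec, ← Matrix.mulVec_mulVec, hfix _ (hspan _),
        sub_self, Matrix.zero_mulVec]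
    rw [hA', Matrix.vecMul_add, Matrix.vecMul_smul, Matrix.vecMul_one, ← Matrix.vecMul_vecMul,
      Matrix.vecMul_vecMul _ K⁻¹, hKi, Matrix.vecMul_one, Matrix.vecMul_vecMul, hPi,
      Matrix.vecMul_zero, zero_add]
  · rw [← Matrix.dotProduct_mulVec, Matrix.mulVec_mulVec, hKi, Matrix.one_mulVec,
      ← Matrix.dotProduct_mulVec, hfix q hq, hψ]

theorem transferFunction_transpose (A : Matrix (Fin r) (Fin r) ℝ) (B : Matrix (Fin r) (Fin m) ℝ)
    (C : Matrix (Fin p) (Fin r) ℝ) :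
    (transferFunction 1 A B C)ᵀ = transferFunction 1 Aᵀ Cᵀ Bᵀ := by
  rw [transferFunction, transferFunction, Matrix.transpose_mul, Matrix.transpose_mul,
    Matrix.transpose_nonsing_inv, Matrix.transpose_sub, Matrix.transpose_smul, Matrix.mul_assoc]
  simp only [Matrix.transpose_map]
  have h1 : ((1 : Matrix (Fin r) (Fin r) ℝ).map RatFunc.C)ᵀ =
      (1 : Matrix (Fin r) (Fin r) ℝ).map RatFunc.C := by
    rw [← Matrix.transpose_map, Matrix.transpose_one]
  rw [h1]

theorem HasOrder.transpose {H : RatMatrix p m} (h : HasOrder r H) : HasOrder r Hᵀ := by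
  obtain ⟨A, B, C, rfl⟩ := h.exists_one
  rw [transferFunction_transpose]
  exact hasOrder_one _ _ _

/-- Transposition exchanges inputs and outputs and reduces this to the unobservable case. -/
theorem hasOrder_add_simplePole_of_uncontrollable {A : Matrix (Fin r) (Fin r) ℝ}
    {B : Matrix (Fin r) (Fin m) ℝ} (C : Matrix (Fin p) (Fin r) ℝ) {y : Fin r → ℂ} {l : ℂ}
    (hy : y ≠ 0) (hyA : y ᵥ* A.map Complex.ofReal = l • y) (hyB : y ᵥ* B.map Complex.ofReal = 0)
    {a : ℝ} (ha : IsUnit (A - a • 1).det) (u : Fin p → ℝ) (v : Fin m → ℝ) :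
    HasOrder r (transferFunction 1 A B C + simplePole u v a) := by
  have h := hasOrder_add_simplePole_of_unobservable (A := Aᵀ) (B := Cᵀ) (C := Bᵀ) (z := y) (l := l)
    (a := a) hy (by rw [Matrix.transpose_map, Matrix.mulVec_transpose, hyA])
    (by rw [Matrix.transpose_map, Matrix.mulVec_transpose, hyB])
    (by
      have : Aᵀ - a • 1 = (A - a • 1)ᵀ := by simp
      rwa [this, Matrix.det_transpose]) v u
  have h2 := h.transpose
  rw [Matrix.transpose_add, ← transferFunction_transpose, Matrix.transpose_transpose] at h2
  have h3 : (simplePole v u a)ᵀ = simplePole u v a := by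
    ext i j
    simp [simplePole, mul_comm]
  rwa [h3] at h2

end ModelReduction

/-! ### Energy on the imaginary axis and removal of the polynomial part. -/

namespace ModelReduction
open Filter Topology Asymptotics
open Bornology (cobounded)
open Complex MeasureTheory

variable {r p m : ℕ}

/-- The squared `L²` norm on the imaginary axis. -/
noncomputable def axisEnergy (H : RatMatrix p m) : ℝ≥0∞ :=
  ∫⁻ ω : ℝ, ∑ i, ∑ j, ‖evalAt H (I * (ω : ℂ)) i j‖ₑ ^ 2

theorem h2Norm_eq (H : RatMatrix p m) :
    h2Norm H = (ENNReal.ofReal (1 / (2 * Real.pi)) * axisEnergy H) ^ (1 / 2 : ℝ) := rfl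

theorem h2Norm_le_iff {H K : RatMatrix p m} : h2Norm H ≤ h2Norm K ↔ axisEnergy H ≤ axisEnergy K := by
  rw [h2Norm_eq, h2Norm_eq, ENNReal.rpow_le_rpow_iff (by norm_num),
    ENNReal.mul_le_mul_iff_right (by simp [Real.pi_pos]) ENNReal.ofReal_ne_top]

/-- The energy does not see the finitely many points at which `evalAt` takes a default value, so
algebra valid off the poles suffices. -/
theorem ae_axis_of_cofinite {q : ℂ → Prop} (h : ∀ᶠ s in cofinite, q s) :
    ∀ᵐ ω : ℝ, q (I * (ω : ℂ)) := by
  have hinj : Function.Injective fun ω : ℝ => I * (ω : ℂ) := fun x y hxy => by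
    simpa using hxy
  exact (Set.Finite.preimage hinj.injOn (eventually_cofinite.1 h)).measure_zero volume

theorem axisEnergy_congr {H : RatMatrix p m} {f : Fin p → Fin m → ℂ → ℂ}
    (h : ∀ᶠ s in cofinite, ∀ i j, evalAt H s i j = f i j s) :
    axisEnergy H = ∫⁻ ω : ℝ, ∑ x : Fin p × Fin m, ‖f x.1 x.2 (I * ω)‖ₑ ^ 2 := by
  refine lintegral_congr_ae ?_
  filter_upwards [ae_axis_of_cofinite h] with ω hω
  simp only [hω, Fintype.sum_prod_type]

theorem axisEnergy_lt_top {H : RatMatrix p m}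
    (h : ∀ i j, MemLp (fun ω : ℝ => evalAt H (I * ω) i j) 2) : axisEnergy H < ⊤ := by
  rw [axisEnergy_congr (f := fun i j s => evalAt H s i j) (Eventually.of_forall fun s i j => rfl),
    lintegral_sum_enorm_sq (f := fun (x : Fin p × Fin m) (ω : ℝ) => evalAt H (I * ω) x.1 x.2)
      fun x => h x.1 x.2]
  exact ENNReal.ofReal_lt_top

theorem measurable_ratVal_axis (f : RatFunc ℝ) : Measurable fun ω : ℝ => ratVal f (I * ω) := by
  simp_rw [ratVal_eq]
  refine Measurable.div ?_ ?_
  · exact ((Polynomial.continuous_aeval _).comp (by fun_prop)).measurable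
  · exact ((Polynomial.continuous_aeval _).comp (by fun_prop)).measurable

theorem memLp_of_axisEnergy {H : RatMatrix p m} (h : axisEnergy H < ⊤) (i : Fin p) (j : Fin m) :
    MemLp (fun ω : ℝ => evalAt H (I * ω) i j) 2 := by
  refine ⟨(measurable_ratVal_axis (H i j)).aestronglyMeasurable, ?_⟩
  rw [eLpNorm_lt_top_iff_lintegral_rpow_enorm_lt_top two_ne_zero ENNReal.ofNat_ne_top]
  refine lt_of_le_of_lt (lintegral_mono fun ω => ?_) h
  simp only [ENNReal.toReal_ofNat, ENNReal.rpow_ofNat]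
  refine le_trans ?_ (Finset.single_le_sum
    (f := fun i => ∑ j, ‖evalAt H (I * (ω : ℂ)) i j‖ₑ ^ 2) (fun _ _ => zero_le)
    (Finset.mem_univ i))
  exact Finset.single_le_sum (f := fun j => ‖evalAt H (I * (ω : ℂ)) i j‖ₑ ^ 2)
    (fun _ _ => zero_le) (Finset.mem_univ j)

theorem hardyLike_ratVal {H : RatMatrix p m} (hH : IsStable H) (i : Fin p) (j : Fin m)
    (hO : ratVal (H i j) =O[cobounded ℂ] fun s => s⁻¹) : HardyLike (ratVal (H i j)) where
  differentiableAt _ hs := (not_isPole_iff.1 (hH.not_isPole hs) i j).differentiableAt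
  isBigO := hO

theorem axisEnergy_lt_top_of_isStable {H : RatMatrix p m} (hH : IsStable H)
    (hsp : IsStrictlyProper H) : axisEnergy H < ⊤ :=
  axisEnergy_lt_top fun i j => (hardyLike_ratVal hH i j (ratVal_isBigO (hsp i j))).axisDecay.memLp

/-- A function bounded below at infinity is not square integrable. -/
theorem not_memLp_of_isBigO {f : ℝ → ℂ} (hf : (fun _ => (1 : ℂ)) =O[atTop] f) : ¬ MemLp f 2 := by
  intro hm
  obtain ⟨c, hc0, hc⟩ := hf.exists_pos
  obtain ⟨R, hR⟩ := eventually_atTop.1 hc.bound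
  have hi := hm.integrable_norm_pow two_ne_zero
  have hconst : IntegrableOn (fun _ : ℝ => (c⁻¹) ^ 2) (Set.Ici R) := by
    refine (hi.integrableOn (s := Set.Ici R)).mono' aestronglyMeasurable_const ?_
    filter_upwards [ae_restrict_mem measurableSet_Ici] with ω hω
    have h1 := hR ω hω
    rw [norm_one] at h1
    rw [Real.norm_of_nonneg (by positivity)]
    refine pow_le_pow_left₀ (by positivity) ?_ 2
    rw [inv_le_iff_one_le_mul₀ hc0]
    linarith
  rw [integrableOn_const_iff] at hconst
  rcases hconst with h | h
  · simp [hc0.ne'] at h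
  · simp at h

/-- A nonzero polynomial is bounded below near infinity, and the decaying term `k` is negligible
beside it; then `f` is bounded below too and cannot be square integrable. -/
theorem eq_zero_of_memLp_add_polynomial {f k : ℂ → ℂ} {q : ℝ[X]}
    (hf : MemLp (fun ω : ℝ => f (I * ω)) 2) (hk : k =O[cobounded ℂ] fun s => s⁻¹)
    (h : ∀ᶠ s in cobounded ℂ, f s = k s + Polynomial.aeval s q) : q = 0 := by
  by_contra hq
  have h1 := polynomial_isBigO_one_of_ne_zero hq
  have h2 : k =o[cobounded ℂ] fun _ => (1 : ℂ) := by
    refine hk.trans_isLittleO ?_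
    rw [isLittleO_one_iff]
    exact tendsto_inv₀_cobounded
  have h3 : (fun _ => (1 : ℂ)) =O[cobounded ℂ] f :=
    (h1.trans (h2.trans_isBigO h1).right_isBigO_add).congr' .rfl
      (h.mono fun s hs => by rw [hs])
  have h4 : Tendsto (fun ω : ℝ => I * (ω : ℂ)) atTop (cobounded ℂ) :=
    tendsto_axis_cobounded.mono_left atTop_le_cocompact
  exact not_memLp_of_isBigO (h3.comp_tendsto h4) hf

theorem hasOrder_zero (r : ℕ) : HasOrder r (0 : RatMatrix p m) := by
  have : (0 : RatMatrix p m) = transferFunction 1 (0 : Matrix (Fin r) (Fin r) ℝ) 0 0 := by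
    simp [transferFunction]
  rw [this]
  exact hasOrder_one _ _ _

/-- Shifting a competitor by `P` preserves stability and leaves the error `Gsp - H`. Besides part 1,
the finiteness of the optimal error is recorded, since every variational argument needs it. -/
theorem minimizer_polynomial_part {G Gsp : RatMatrix p m} {P : Matrix (Fin p) (Fin m) ℝ[X]}
    (hG : G = Gsp + ofPoly P) (hGsp : IsStrictlyProper Gsp) (hstable : IsStable G)
    {Gr Grsp : RatMatrix p m} {Pr : Matrix (Fin p) (Fin m) ℝ[X]}
    (hGr : Gr = Grsp + ofPoly Pr) (hGrsp : HasOrder r Grsp)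
    {S : Set (RatMatrix p m)} (hS : S = Set.univ ∨ S = {H | IsStable H})
    (hmin : IsH2Minimizer G (models p m r ∩ S) Gr) :
    Pr = P ∧ axisEnergy (Gsp - Grsp) < ⊤ ∧
      IsH2Minimizer Gsp (strictlyProperModels p m r ∩ S) Grsp := by
  have hGsps : IsStable Gsp := by
    have : Gsp = G - ofPoly P := by rw [hG, add_sub_cancel_right]
    rw [this]
    exact hstable.sub (isStable_ofPoly P)
  have haddS : ∀ H ∈ S, H + ofPoly P ∈ S := fun H hH => by
    rcases hS with rfl | rfl
    · trivial
    · exact IsStable.add hH (isStable_ofPoly P)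
  have hcomp : ∀ H, HasOrder r H → H ∈ S → axisEnergy (G - Gr) ≤ axisEnergy (Gsp - H) :=
    fun H hH hHS => by
      have := hmin.2 (show H + ofPoly P ∈ models p m r ∩ S from ⟨⟨H, P, hH, rfl⟩, haddS H hHS⟩)
      have h2 := h2Norm_le_iff.1 this
      rwa [hG, add_sub_add_right_eq_sub, ← hG] at h2
  have h0S : (0 : RatMatrix p m) ∈ S := by
    rcases hS with rfl | rfl
    · trivial
    · intro s hs
      exact absurd hs (not_isPole_iff.2 fun i j => by
        simpa using regular_algebraMap 0 s)
  -- Comparison with the zero model, realized in dimension `r` with zero matrices.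
  have hfin : axisEnergy (G - Gr) < ⊤ := by
    refine (hcomp 0 (hasOrder_zero r) h0S).trans_lt ?_
    rw [sub_zero]
    exact axisEnergy_lt_top_of_isStable hGsps hGsp
  have hP : Pr = P := by
    ext1 i j
    have := eq_zero_of_memLp_add_polynomial (f := ratVal ((G - Gr) i j))
      (k := fun s => ratVal (Gsp i j) s - ratVal (Grsp i j) s) (q := P i j - Pr i j)
      (memLp_of_axisEnergy hfin i j)
      ((ratVal_isBigO (hGsp i j)).sub (hGrsp.isBigO i j)) ?_
    · exact (sub_eq_zero.1 this).symm
    · filter_upwards [eventually_regular_cobounded (Gsp i j),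
        eventually_regular_cobounded (Grsp i j)] with s h1 h2
      have e : (G - Gr) i j = (Gsp i j - Grsp i j) +
          algebraMap ℝ[X] (RatFunc ℝ) (P i j - Pr i j) := by
        rw [hG, hGr, map_sub]
        simp only [Matrix.sub_apply, Matrix.add_apply, ofPoly, Matrix.map_apply]
        ring
      rw [e, ratVal_add (h1.sub h2) (regular_algebraMap _ s), ratVal_sub h1 h2, ratVal_algebraMap]
  have hD : G - Gr = Gsp - Grsp := by rw [hG, hGr, hP, add_sub_add_right_eq_sub]
  refine ⟨hP, hD ▸ hfin, ⟨hGrsp, ?_⟩, fun H hH => ?_⟩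
  · rcases hS with rfl | rfl
    · trivial
    · have : Grsp = Gr - ofPoly Pr := by rw [hGr, add_sub_cancel_right]
      rw [this]
      exact IsStable.sub hmin.1.2 (isStable_ofPoly Pr)
  · show h2Norm (Gsp - Grsp) ≤ h2Norm (Gsp - H)
    rw [← hD, h2Norm_le_iff]
    exact hcomp H hH.1 hH.2

end ModelReduction

/-! ### Optimality conditions in bilinear form and modal partial fractions. -/

namespace ModelReduction
open Filter Topology Asymptotics
open Bornology (cobounded)
open Complex MeasureTheory

variable {r p m : ℕ}

theorem conj_axis (ω : ℝ) : (starRingEnd ℂ) (I * ω) = -(I * ω) := by simp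

theorem neg_axis (ω : ℝ) : -(I * (ω : ℂ)) = I * ((-ω : ℝ) : ℂ) := by push_cast; ring

theorem evalAt_neg_axis (H : RatMatrix p m) (ω : ℝ) (k : Fin p) (l : Fin m) :
    evalAt H (-(I * ω)) k l = (starRingEnd ℂ) (evalAt H (I * ω) k l) := by
  rw [← conj_axis, evalAt_apply, ratVal_conj]
  rfl

/-- First order optimality along a curve of models of order `r`, in bilinear form. -/
theorem variation_bilinear {Gsp Grsp : RatMatrix p m} {S : Set (RatMatrix p m)}
    (hmin : ∀ H, HasOrder r H → H ∈ S → axisEnergy (Gsp - Grsp) ≤ axisEnergy (Gsp - H))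
    (hfin : axisEnergy (Gsp - Grsp) < ⊤)
    (H : ℝ → RatMatrix p m) (d : ℝ → Fin p → Fin m → ℂ → ℂ) (M : ℝ)
    (hH : ∀ᶠ t in 𝓝 0, HasOrder r (H t) ∧ H t ∈ S ∧ ∀ᶠ s in cofinite, ∀ k l,
      evalAt (H t) s k l = evalAt Grsp s k l + t * d t k l s)
    (hmeas : ∀ᶠ t in 𝓝 0, ∀ k l, Measurable fun ω : ℝ => d t k l (I * ω))
    (hb : ∀ᶠ t in 𝓝 0, ∀ k l, ∀ ω : ℝ, ‖d t k l (I * ω)‖ ≤ M * (√(1 + ω ^ 2))⁻¹)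
    (hlim : ∀ k l, ∀ ω : ℝ, Tendsto (fun t => d t k l (I * ω)) (𝓝 0) (𝓝 (d 0 k l (I * ω))))
    (hconj : ∀ k l, ∀ ω : ℝ, d 0 k l (-(I * ω)) = (starRingEnd ℂ) (d 0 k l (I * ω))) :
    ∑ k, ∑ l, ∫ ω : ℝ, evalAt (Gsp - Grsp) (I * ω) k l * d 0 k l (-(I * ω)) = 0 := by
  have hre := re_sum_integral_eq_zero (ι := Fin p × Fin m)
    (e := fun x ω => evalAt (Gsp - Grsp) (I * ω) x.1 x.2)
    (d := fun t x ω => d t x.1 x.2 (I * ω)) (g := fun ω => M * (√(1 + ω ^ 2))⁻¹)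
    (fun x => memLp_of_axisEnergy hfin x.1 x.2) (memLp_sqrt_inv.const_mul M)
    (hmeas.mono fun t ht x => (ht x.1 x.2).aestronglyMeasurable)
    (hb.mono fun t ht x ω => ht x.1 x.2 ω) (fun x ω => hlim x.1 x.2 ω) ?_
  · rw [Fintype.sum_prod_type] at hre
    simp_rw [← hconj] at hre
    -- The imaginary part vanishes for free: the coefficients are real, so `ω ↦ -ω` conjugates the
    -- integrand.
    refine Complex.ext hre ?_
    rw [zero_im, ← conj_eq_iff_im, map_sum]
    refine Finset.sum_congr rfl fun k _ => ?_
    rw [map_sum]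
    refine Finset.sum_congr rfl fun l _ => ?_
    rw [← integral_conj, ← integral_neg_eq_self]
    refine integral_congr_ae (Eventually.of_forall fun ω => ?_)
    simp only
    have h1 : evalAt (Gsp - Grsp) (-(I * ω)) k l =
        (starRingEnd ℂ) (evalAt (Gsp - Grsp) (I * ω) k l) := evalAt_neg_axis _ ω k l
    rw [map_mul, ← neg_axis, neg_neg, hconj, h1, conj_conj]
  · filter_upwards [hH] with t ht
    have h := hmin (H t) ht.1 ht.2.1
    rw [axisEnergy_congr (H := Gsp - Grsp) (f := fun k l s => evalAt (Gsp - Grsp) s k l)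
        (Eventually.of_forall fun _ _ _ => rfl),
      axisEnergy_congr (H := Gsp - H t)
        (f := fun k l s => evalAt (Gsp - Grsp) s k l - t * d t k l s)] at h
    · exact h
    · filter_upwards [ht.2.2, eventually_not_isPole_cofinite Gsp,
        eventually_not_isPole_cofinite Grsp, eventually_not_isPole_cofinite (H t)]
        with s h1 h2 h3 h4 k l
      rw [evalAt_sub h2 h4, evalAt_sub h2 h3, Matrix.sub_apply, Matrix.sub_apply, h1]
      ring

/-- The case of curves affine in `t`, as obtained by varying `B`, `C` or an added first order term:
the difference quotient does not depend on `t`, so domination is automatic. -/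
theorem variation_linear {Gsp Grsp : RatMatrix p m} {S : Set (RatMatrix p m)}
    (hmin : ∀ H, HasOrder r H → H ∈ S → axisEnergy (Gsp - Grsp) ≤ axisEnergy (Gsp - H))
    (hfin : axisEnergy (Gsp - Grsp) < ⊤) (H : ℝ → RatMatrix p m) {K : RatMatrix p m}
    (hK : ∀ k l, AxisDecay fun s => evalAt K s k l)
    (hH : ∀ t, HasOrder r (H t) ∧ H t ∈ S ∧ ∀ᶠ s in cofinite,
      evalAt (H t) s = evalAt Grsp s + (t : ℂ) • evalAt K s) :
    ∑ k, ∑ l, ∫ ω : ℝ, evalAt (Gsp - Grsp) (I * ω) k l * evalAt K (-(I * ω)) k l = 0 := by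
  choose M hM0 hM using fun k l => (hK k l).exists_bound
  refine variation_bilinear hmin hfin H (fun _ k l s => evalAt K s k l) (∑ k, ∑ l, M k l)
    (Eventually.of_forall fun t => ⟨(hH t).1, (hH t).2.1, (hH t).2.2.mono fun s hs k l => by
      rw [hs]; rfl⟩)
    (Eventually.of_forall fun t k l => measurable_ratVal_axis (K k l))
    (Eventually.of_forall fun t k l ω => (hM k l ω).trans ?_) (fun _ _ _ => tendsto_const_nhds)
    (fun k l ω => evalAt_neg_axis K ω k l)
  · refine mul_le_mul_of_nonneg_right ?_ (by positivity)
    exact (Finset.single_le_sum (f := fun l => M k l) (fun l _ => hM0 k l) (Finset.mem_univ l)).trans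
      (Finset.single_le_sum (f := fun k => ∑ l, M k l)
        (fun k _ => Finset.sum_nonneg fun l _ => hM0 k l) (Finset.mem_univ k))

/-- A biorthogonal eigensystem of a real matrix with distinct eigenvalues. -/
structure IsModal (A : Matrix (Fin r) (Fin r) ℝ) (lam : Fin r → ℂ) (z y : Fin r → Fin r → ℂ) :
    Prop where
  inj : Function.Injective lam
  right : ∀ i, A.map Complex.ofReal *ᵥ z i = lam i • z i
  left : ∀ i, y i ᵥ* A.map Complex.ofReal = lam i • y i
  biorth : ∀ i j, y i ⬝ᵥ z j = if i = j then 1 else 0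

namespace IsModal

variable {A : Matrix (Fin r) (Fin r) ℝ} {lam : Fin r → ℂ} {z y : Fin r → Fin r → ℂ}

/-- Biorthogonality says that one product of the two eigenvector matrices is the identity; a
one-sided inverse of a square matrix is two-sided. This resolution of the identity yields the
partial fraction form of the resolvent. -/
theorem sum_vecMulVec (h : IsModal A lam z y) :
    ∑ i, Matrix.vecMulVec (z i) (y i) = 1 := by
  have h1 : Matrix.of y * (Matrix.of z)ᵀ = 1 := by
    ext i j
    rw [Matrix.mul_apply, Matrix.one_apply, ← h.biorth i j]
    rfl
  have h2 := mul_eq_one_comm.1 h1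
  rw [← h2]
  ext i j
  simp [Matrix.mul_apply, Matrix.sum_apply, Matrix.vecMulVec_apply]

theorem pencil_mulVec (h : IsModal A lam z y) (s : ℂ) (i : Fin r) :
    pencil A s *ᵥ z i = (s - lam i) • z i := by
  rw [pencil, Matrix.sub_mulVec, Matrix.smul_mulVec, Matrix.one_mulVec, h.right, sub_smul]

theorem vecMul_pencil (h : IsModal A lam z y) (s : ℂ) (i : Fin r) :
    y i ᵥ* pencil A s = (s - lam i) • y i := by
  rw [pencil, Matrix.vecMul_sub, Matrix.vecMul_smul, Matrix.vecMul_one, h.left, sub_smul]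

theorem pencil_mul_sum (h : IsModal A lam z y) {s : ℂ} (hs : ∀ i, s ≠ lam i) :
    pencil A s * ∑ i, (s - lam i)⁻¹ • Matrix.vecMulVec (z i) (y i) = 1 := by
  rw [Matrix.mul_sum, ← h.sum_vecMulVec]
  refine Finset.sum_congr rfl fun i _ => ?_
  rw [Matrix.mul_smul, Matrix.mul_vecMulVec, h.pencil_mulVec, Matrix.smul_vecMulVec,
    inv_smul_smul₀ (sub_ne_zero.2 (hs i))]

theorem isUnit (h : IsModal A lam z y) {s : ℂ} (hs : ∀ i, s ≠ lam i) : IsUnit (pencil A s).det :=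
  Matrix.isUnit_det_of_right_inverse (h.pencil_mul_sum hs)

theorem inv_eq (h : IsModal A lam z y) {s : ℂ} (hs : ∀ i, s ≠ lam i) :
    (pencil A s)⁻¹ = ∑ i, (s - lam i)⁻¹ • Matrix.vecMulVec (z i) (y i) :=
  Matrix.inv_eq_right_inv (h.pencil_mul_sum hs)

theorem evalAt_eq (h : IsModal A lam z y) (B : Matrix (Fin r) (Fin m) ℝ)
    (C : Matrix (Fin p) (Fin r) ℝ) {s : ℂ} (hs : ∀ i, s ≠ lam i) (k : Fin p) (l : Fin m) :
    evalAt (transferFunction 1 A B C) s k l =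
      ∑ i, (C.map Complex.ofReal *ᵥ z i) k * (y i ᵥ* B.map Complex.ofReal) l * (s - lam i)⁻¹ := by
  rw [evalAt_transferFunction (h.isUnit hs), h.inv_eq hs, Matrix.mul_sum, Matrix.sum_mul,
    Matrix.sum_apply]
  refine Finset.sum_congr rfl fun i _ => ?_
  rw [Matrix.mul_smul, Matrix.smul_mul, Matrix.mul_vecMulVec, Matrix.vecMulVec_mul,
    Matrix.smul_apply, Matrix.vecMulVec_apply, smul_eq_mul]
  ring

theorem eventually_ne (lam : Fin r → ℂ) : ∀ᶠ s in cofinite, ∀ i, s ≠ lam i := by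
  refine eventually_all.2 fun i => ?_
  exact (Set.finite_singleton (lam i)).eventually_cofinite_notMem

theorem left_ne_zero (h : IsModal A lam z y) (i : Fin r) : y i ≠ 0 := fun h0 => by
  have := h.biorth i i
  simp [h0] at this

theorem right_ne_zero (h : IsModal A lam z y) (i : Fin r) : z i ≠ 0 := fun h0 => by
  have := h.biorth i i
  simp [h0] at this

theorem axisDecay (h : IsModal A lam z y) (hre : ∀ i, (lam i).re ≠ 0)
    (B : Matrix (Fin r) (Fin m) ℝ) (C : Matrix (Fin p) (Fin r) ℝ) (k : Fin p) (l : Fin m) :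
    AxisDecay fun s => evalAt (transferFunction 1 A B C) s k l where
  continuous := by
    have : (fun ω : ℝ => evalAt (transferFunction 1 A B C) (I * ω) k l) = fun ω : ℝ =>
        ∑ i, (C.map Complex.ofReal *ᵥ z i) k * (y i ᵥ* B.map Complex.ofReal) l *
          (I * ω - lam i)⁻¹ := by
      ext ω
      exact h.evalAt_eq B C (fun i => axis_ne (hre i) ω) k l
    rw [this]
    exact continuous_finsetSum _ fun i _ =>
      continuous_const.mul (axisDecay_inv_sub (hre i)).continuous
  isBigO := evalAt_transferFunction_isBigO A B C k l

theorem isStable (h : IsModal A lam z y) (hre : ∀ i, (lam i).re < 0)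
    (B : Matrix (Fin r) (Fin m) ℝ) (C : Matrix (Fin p) (Fin r) ℝ) :
    IsStable (transferFunction 1 A B C) :=
  isStable_of fun s hs => not_isPole_transferFunction (h.isUnit fun i hi => by
    have := hre i
    rw [← hi] at this
    linarith) B C

end IsModal

theorem tendsto_residue {lam : Fin r → ℂ} (hinj : Function.Injective lam) (α : Fin r → ℂ)
    (i : Fin r) : Tendsto (fun s => (s - lam i) * ∑ j, α j * (s - lam j)⁻¹) (𝓝[≠] lam i)
      (𝓝 (α i)) := by
  have h1 : Tendsto (fun s => α i + (s - lam i) * ∑ j ∈ Finset.univ.erase i, α j * (s - lam j)⁻¹)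
      (𝓝 (lam i)) (𝓝 (α i)) := by
    have : ContinuousAt (fun s => α i + (s - lam i) *
        ∑ j ∈ Finset.univ.erase i, α j * (s - lam j)⁻¹) (lam i) := by
      refine continuousAt_const.add ((continuousAt_id.sub continuousAt_const).mul ?_)
      refine tendsto_finsetSum _ fun j hj => ?_
      refine continuousAt_const.mul (ContinuousAt.inv₀ (by fun_prop) (sub_ne_zero.2 fun h => ?_))
      exact (Finset.ne_of_mem_erase hj) (hinj h.symm)
    simpa [ContinuousAt] using this
  refine (h1.mono_left nhdsWithin_le_nhds).congr' ?_
  filter_upwards [self_mem_nhdsWithin] with s hs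
  have hs' : s - lam i ≠ 0 := sub_ne_zero.2 hs
  rw [← Finset.add_sum_erase _ _ (Finset.mem_univ i), mul_add]
  congr 1
  field_simp

theorem punctured_le_cofinite (c : ℂ) : 𝓝[≠] c ≤ cofinite := by
  intro U hU
  have hfin : (Uᶜ \ {c}).Finite := (mem_cofinite.1 hU).subset Set.sdiff_subset
  filter_upwards [nhdsWithin_le_nhds (hfin.isClosed.isOpen_compl.mem_nhds (x := c) (by simp)),
    self_mem_nhdsWithin] with s hs hc
  by_contra hU'
  exact hs ⟨hU', hc⟩

/-- Clearing denominators produces a polynomial with infinitely many roots; its value at `lam i` is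
`α i` times a nonzero product. -/
theorem coeff_eq_zero_of_infinite {lam : Fin r → ℂ} (hinj : Function.Injective lam) {α : Fin r → ℂ}
    {T : Set ℂ} (hT : T.Infinite) (h : ∀ s ∈ T, ∑ j, α j * (s - lam j)⁻¹ = 0) (i : Fin r) :
    α i = 0 := by
  set q : ℂ[X] := ∑ j, Polynomial.C (α j) *
    ∏ k ∈ Finset.univ.erase j, (Polynomial.X - Polynomial.C (lam k)) with hq
  have hq0 : q = 0 := by
    refine Polynomial.eq_zero_of_infinite_isRoot q
      ((hT.sdiff (Set.finite_range lam)).mono fun s hs => ?_)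
    have hne : ∀ k, s - lam k ≠ 0 := fun k => sub_ne_zero.2 fun hk => hs.2 ⟨k, hk.symm⟩
    have h1 : q.eval s = (∏ k, (s - lam k)) * ∑ j, α j * (s - lam j)⁻¹ := by
      rw [hq, Polynomial.eval_finsetSum, Finset.mul_sum]
      refine Finset.sum_congr rfl fun j _ => ?_
      rw [← Finset.mul_prod_erase _ _ (Finset.mem_univ j), Polynomial.eval_mul, Polynomial.eval_C,
        Polynomial.eval_prod]
      simp only [Polynomial.eval_sub, Polynomial.eval_X, Polynomial.eval_C]
      have := hne j
      field_simp
    show q.eval s = 0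
    rw [h1, h s hs.1, mul_zero]
  have h2 : q.eval (lam i) = α i * ∏ k ∈ Finset.univ.erase i, (lam i - lam k) := by
    rw [hq, Polynomial.eval_finsetSum, Finset.sum_eq_single i]
    · simp [Polynomial.eval_prod]
    · intro j _ hj
      rw [Polynomial.eval_mul, Polynomial.eval_prod, Finset.prod_eq_zero
        (Finset.mem_erase.2 ⟨hj.symm, Finset.mem_univ i⟩) (by simp), mul_zero]
    · simp
  rw [hq0, Polynomial.eval_zero] at h2
  refine (mul_eq_zero.1 h2.symm).resolve_right (Finset.prod_ne_zero_iff.2 fun k hk => ?_)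
  exact sub_ne_zero.2 fun h => (Finset.ne_of_mem_erase hk) (hinj h.symm)

end ModelReduction

/-! ### Splitting into stable and antistable parts, and exactness in the presence of hidden modes.
-/

namespace ModelReduction
open Filter Topology Asymptotics
open Bornology (cobounded)
open Complex MeasureTheory

variable {r p m : ℕ}

/-- The part of a partial fraction with poles in the open right half plane. -/
noncomputable def antistablePart (lam α : Fin r → ℂ) (s : ℂ) : ℂ :=
  ∑ j, (if 0 < (lam j).re then α j else 0) * (s - lam j)⁻¹

/-- The part of a partial fraction with poles in the open left half plane. -/
noncomputable def stablePart (lam α : Fin r → ℂ) (s : ℂ) : ℂ :=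
  ∑ j, (if (lam j).re < 0 then α j else 0) * (s - lam j)⁻¹

theorem sum_eq_stablePart_add {lam α : Fin r → ℂ} (h : ∀ j, (lam j).re = 0 → α j = 0) (s : ℂ) :
    ∑ j, α j * (s - lam j)⁻¹ = stablePart lam α s + antistablePart lam α s := by
  rw [stablePart, antistablePart, ← Finset.sum_add_distrib]
  refine Finset.sum_congr rfl fun j _ => ?_
  rw [← add_mul]
  congr 1
  rcases lt_trichotomy (lam j).re 0 with h1 | h1 | h1
  · simp [h1, h1.not_gt]
  · simp [h1, h j h1]
  · simp [h1, h1.not_gt]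

theorem hardyLike_stablePart (lam α : Fin r → ℂ) : HardyLike (stablePart lam α) := by
  refine HardyLike.sum _ fun j _ => ?_
  by_cases h : (lam j).re < 0
  · exact (hardyLike_inv_sub h).const_mul _
  · simpa [h] using HardyLike.zero

theorem hardyLike_antistablePart_neg (lam α : Fin r → ℂ) :
    HardyLike fun s => antistablePart lam α (-s) := by
  refine HardyLike.sum _ fun j _ => ?_
  by_cases h : 0 < (lam j).re
  · have := (hardyLike_inv_sub (c := -lam j) (by simpa using h)).const_mul (-α j)
    convert this using 2 with s
    rw [if_pos h, show -s - lam j = -(s - -lam j) by ring, inv_neg]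
    ring
  · simpa [h] using HardyLike.zero

theorem axisDecay_antistablePart (lam α : Fin r → ℂ) : AxisDecay (antistablePart lam α) := by
  refine AxisDecay.sum _ fun j _ => ?_
  by_cases h : 0 < (lam j).re
  · exact (axisDecay_inv_sub h.ne').const_mul _
  · simpa [h] using HardyLike.zero.axisDecay

/-- On the imaginary axis, the conjugate of an antistable partial fraction is a stable one. -/
theorem conj_antistablePart (lam α : Fin r → ℂ) : ∃ f : ℂ → ℂ, HardyLike f ∧
    ∀ ω : ℝ, (starRingEnd ℂ) (antistablePart lam α (I * ω)) = f (I * ω) := by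
  refine ⟨fun s => antistablePart (fun j => (starRingEnd ℂ) (lam j))
    (fun j => (starRingEnd ℂ) (α j)) (-s), hardyLike_antistablePart_neg _ _, fun ω => ?_⟩
  simp only [antistablePart, conj_re]
  rw [map_sum]
  refine Finset.sum_congr rfl fun j _ => ?_
  rw [map_mul, map_inv₀, map_sub, conj_axis]
  split_ifs <;> simp

/-- The substitution `ω ↦ -ω` turns an antistable function into one of Hardy type. -/
theorem integral_reflect (f : ℂ → ℂ) (b : ℂ) :
    ∫ ω : ℝ, f (I * ω) * (I * ω - b)⁻¹ = -∫ ω : ℝ, f (-(I * ω)) * (I * ω - -b)⁻¹ := by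
  rw [← integral_neg_eq_self, ← integral_neg]
  refine integral_congr_ae (Eventually.of_forall fun ω => ?_)
  simp only
  rw [← neg_axis, show -(I * (ω : ℂ)) - b = -(I * ω - -b) by ring, inv_neg, mul_neg]

namespace IsModal

variable {A : Matrix (Fin r) (Fin r) ℝ} {lam : Fin r → ℂ} {z y : Fin r → Fin r → ℂ}

/-- The `(k, l)` entry of the residue of `C (s - A)⁻¹ B` at the `j`-th eigenvalue. -/
noncomputable def coeff (z y : Fin r → Fin r → ℂ) (B : Matrix (Fin r) (Fin m) ℝ)
    (C : Matrix (Fin p) (Fin r) ℝ) (k : Fin p) (l : Fin m) (j : Fin r) : ℂ :=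
  (C.map Complex.ofReal *ᵥ z j) k * (y j ᵥ* B.map Complex.ofReal) l

theorem tendsto_residue_evalAt (h : IsModal A lam z y) (B : Matrix (Fin r) (Fin m) ℝ)
    (C : Matrix (Fin p) (Fin r) ℝ) (k : Fin p) (l : Fin m) (i : Fin r) :
    Tendsto (fun s => (s - lam i) * evalAt (transferFunction 1 A B C) s k l) (𝓝[≠] lam i)
      (𝓝 (coeff z y B C k l i)) := by
  refine (tendsto_residue h.inj (coeff z y B C k l) i).congr' ?_
  filter_upwards [(eventually_ne lam).filter_mono (punctured_le_cofinite _)] with s hs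
  rw [h.evalAt_eq B C hs]
  rfl

theorem tendsto_residue_regular {f : RatFunc ℝ} {c : ℂ} (hf : Regular f c) :
    Tendsto (fun s => (s - c) * ratVal f s) (𝓝[≠] c) (𝓝 0) := by
  have : ContinuousAt (fun s => (s - c) * ratVal f s) c :=
    ContinuousAt.mul (by fun_prop) hf.differentiableAt.continuousAt
  simpa [ContinuousAt] using this.mono_left (nhdsWithin_le_nhds (s := {c}ᶜ))

/-- Stability restricts the poles of the transfer function and not the eigenvalues of `A`: an
unstable eigenvalue may survive, but only with residue zero. -/
theorem coeff_eq_zero_of_isStable (h : IsModal A lam z y) {B : Matrix (Fin r) (Fin m) ℝ}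
    {C : Matrix (Fin p) (Fin r) ℝ} (hst : IsStable (transferFunction 1 A B C)) {i : Fin r}
    (hi : 0 ≤ (lam i).re) (k : Fin p) (l : Fin m) : coeff z y B C k l i = 0 :=
  tendsto_nhds_unique (h.tendsto_residue_evalAt B C k l i)
    (tendsto_residue_regular (not_isPole_iff.1 (hst.not_isPole hi) k l))

/-- With a nonzero residue the error would grow like `1 / (ω - ω₀)` on the axis. This is not
integrable near `ω₀`, whereas finite energy gives `L²`, hence `L¹`, on bounded intervals. -/
theorem coeff_eq_zero_of_axis (h : IsModal A lam z y) {Gsp : RatMatrix p m} (hG : IsStable Gsp)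
    {B : Matrix (Fin r) (Fin m) ℝ} {C : Matrix (Fin p) (Fin r) ℝ}
    (hfin : axisEnergy (Gsp - transferFunction 1 A B C) < ⊤) {i : Fin r}
    (hi : (lam i).re = 0) (k : Fin p) (l : Fin m) : coeff z y B C k l i = 0 := by
  by_contra hne
  set D := Gsp - transferFunction 1 A B C
  set ω₀ := (lam i).im
  have hlam : lam i = I * (ω₀ : ℂ) := Complex.ext (by simp [hi]) (by simp [ω₀])
  have h1 : Tendsto (fun s => (s - lam i) * evalAt D s k l) (𝓝[≠] lam i)
      (𝓝 (-coeff z y B C k l i)) := by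
    have h2 := (tendsto_residue_regular (not_isPole_iff.1 (hG.not_isPole hi.ge) k l)).sub
      (h.tendsto_residue_evalAt B C k l i)
    rw [zero_sub] at h2
    refine h2.congr' ?_
    filter_upwards [(eventually_not_isPole_cofinite Gsp).filter_mono (punctured_le_cofinite _),
      (eventually_not_isPole_cofinite (transferFunction 1 A B C)).filter_mono
        (punctured_le_cofinite _)] with s hs1 hs2
    rw [evalAt_sub hs1 hs2, Matrix.sub_apply, mul_sub]
    rfl
  have h3 : Tendsto (fun ω : ℝ => I * (ω : ℂ)) (𝓝[≠] ω₀) (𝓝[≠] lam i) := by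
    refine tendsto_nhdsWithin_of_tendsto_nhds_of_eventually_within _ ?_ ?_
    · rw [hlam]
      exact (Continuous.tendsto (f := fun ω : ℝ => I * (ω : ℂ)) (by fun_prop) ω₀).mono_left
        nhdsWithin_le_nhds
    · filter_upwards [self_mem_nhdsWithin] with ω hω
      rw [hlam]
      simpa using hω
  have hpos : 0 < ‖coeff z y B C k l i‖ := norm_pos_iff.2 hne
  have h4 : ∀ᶠ ω : ℝ in 𝓝[≠] ω₀, ‖coeff z y B C k l i‖ / 2 <
      ‖(I * (ω : ℂ) - lam i) * evalAt D (I * ω) k l‖ := by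
    have := (h1.comp h3).norm
    rw [norm_neg] at this
    exact this.eventually (lt_mem_nhds (half_lt_self hpos))
  have h5 : (fun ω : ℝ => (ω - ω₀)⁻¹) =O[𝓝[≠] ω₀] fun ω : ℝ => evalAt D (I * ω) k l := by
    refine IsBigO.of_bound (2 / ‖coeff z y B C k l i‖) ?_
    filter_upwards [h4, self_mem_nhdsWithin] with ω hω hne'
    have h6 : ‖I * (ω : ℂ) - lam i‖ = |ω - ω₀| := by
      rw [hlam, ← mul_sub, ← ofReal_sub, norm_mul, norm_I, one_mul, Complex.norm_real,
        Real.norm_eq_abs]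
    rw [norm_mul, h6] at hω
    have h7 : 0 < |ω - ω₀| := abs_pos.2 (sub_ne_zero.2 hne')
    rw [norm_inv, Real.norm_eq_abs, inv_le_iff_one_le_mul₀ h7, div_mul_eq_mul_div,
      div_mul_eq_mul_div, one_le_div hpos]
    linarith
  have h8 : IntervalIntegrable (fun ω : ℝ => evalAt D (I * ω) k l) volume (ω₀ - 1) (ω₀ + 1) := by
    have h9 := (memLp_of_axisEnergy hfin k l).restrict (Set.uIoc (ω₀ - 1) (ω₀ + 1))
    have : IsFiniteMeasure (volume.restrict (Set.uIoc (ω₀ - 1) (ω₀ + 1))) := by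
      rw [Set.uIoc_of_le (by linarith)]
      infer_instance
    rw [intervalIntegrable_iff]
    exact h9.integrable one_le_two
  refine not_intervalIntegrable_of_sub_inv_isBigO_punctured h5 (by linarith) ?_ h8
  rw [Set.uIcc_of_le (by linarith)]
  exact ⟨by linarith, by linarith⟩

theorem eventually_error_eq (h : IsModal A lam z y) (Gsp : RatMatrix p m)
    {B : Matrix (Fin r) (Fin m) ℝ} {C : Matrix (Fin p) (Fin r) ℝ} (k : Fin p) (l : Fin m)
    (h0 : ∀ i, (lam i).re = 0 → coeff z y B C k l i = 0) : ∀ᶠ s in cofinite,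
      evalAt (Gsp - transferFunction 1 A B C) s k l =
        (ratVal (Gsp k l) s - stablePart lam (coeff z y B C k l) s) -
          antistablePart lam (coeff z y B C k l) s := by
  filter_upwards [eventually_not_isPole_cofinite Gsp, eventually_ne lam] with s hs1 hs2
  rw [evalAt_sub hs1 (not_isPole_transferFunction (h.isUnit hs2) B C), Matrix.sub_apply,
    h.evalAt_eq B C hs2]
  have := sum_eq_stablePart_add h0 s
  simp only [coeff] at this
  rw [this, evalAt_apply]
  unfold coeff
  ring

/-- A real number at which the complex pencil is invertible is not an eigenvalue. -/
theorem isUnit_sub_smul {a : ℝ} (ha : IsUnit (pencil A (a : ℂ)).det) : IsUnit (A - a • 1).det := by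
  have h1 : pencil A (a : ℂ) = Complex.ofRealHom.mapMatrix (-(A - a • 1)) := by
    ext i j
    by_cases hij : i = j
    · subst hij; simp [pencil]
    · simp [pencil, Matrix.one_apply_ne hij]
  rw [h1, ← RingHom.map_det] at ha
  have h2 : (-(A - a • 1)).det ≠ 0 := fun h0 => by
    rw [h0, map_zero] at ha
    exact not_isUnit_zero ha
  rw [Matrix.det_neg] at h2
  exact isUnit_iff_ne_zero.2 (right_ne_zero_of_mul h2)

/-- An optimal model with an unobservable or uncontrollable mode is exact. -/
theorem eq_of_hidden (h : IsModal A lam z y) {Gsp : RatMatrix p m} (hG : IsStable Gsp)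
    (hGsp : IsStrictlyProper Gsp) {B : Matrix (Fin r) (Fin m) ℝ} {C : Matrix (Fin p) (Fin r) ℝ}
    {S : Set (RatMatrix p m)} (hS : S = Set.univ ∨ S = {H | IsStable H})
    (hmem : transferFunction 1 A B C ∈ S)
    (hmin : ∀ H, HasOrder r H → H ∈ S →
      axisEnergy (Gsp - transferFunction 1 A B C) ≤ axisEnergy (Gsp - H))
    (hfin : axisEnergy (Gsp - transferFunction 1 A B C) < ⊤)
    (hid : ∃ i, C.map Complex.ofReal *ᵥ z i = 0 ∨ y i ᵥ* B.map Complex.ofReal = 0) :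
    Gsp = transferFunction 1 A B C := by
  obtain ⟨i₀, hid⟩ := hid
  have horder : ∀ a : ℝ, IsUnit (A - a • 1).det → ∀ (u : Fin p → ℝ) (v : Fin m → ℝ),
      HasOrder r (transferFunction 1 A B C + simplePole u v a) := fun a ha u v => by
    rcases hid with hid | hid
    · exact hasOrder_add_simplePole_of_unobservable B (h.right_ne_zero i₀) (h.right i₀) hid ha u v
    · exact hasOrder_add_simplePole_of_uncontrollable C (h.left_ne_zero i₀) (h.left i₀) hid ha u v
  set D := Gsp - transferFunction 1 A B C with hD
  have h0 : ∀ k l i, (lam i).re = 0 → coeff z y B C k l i = 0 := fun k l i hi =>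
    h.coeff_eq_zero_of_axis hG hfin hi k l
  have hneg : ∀ k l, HardyLike fun s => ratVal (Gsp k l) s -
      stablePart lam (coeff z y B C k l) s := fun k l =>
    (hardyLike_ratVal hG k l (ratVal_isBigO (hGsp k l))).sub (hardyLike_stablePart _ _)
  -- The perturbation `simplePole` with unit vectors isolates the entry `(k, l)` of the error,
  -- tested against a single kernel with pole `-a`.
  have hstat : ∀ a : ℝ, a ≠ 0 → (∀ u v, transferFunction 1 A B C + simplePole u v a ∈ S) →
      IsUnit (A - a • 1).det → ∀ k l,
      ∫ ω : ℝ, evalAt D (I * ω) k l * (I * ω - ((-a : ℝ) : ℂ))⁻¹ = 0 := fun a ha0 hSt hu k l => by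
    have hne : ∀ ω : ℝ, I * (ω : ℂ) ≠ (a : ℂ) := fun ω => axis_ne (by simpa using ha0) ω
    have hv := variation_linear (K := simplePole (Pi.single k 1) (Pi.single l 1) a) hmin hfin
      (fun t => transferFunction 1 A B C + simplePole (t • Pi.single k 1) (Pi.single l 1) a)
      (fun k' l' => ?_) (fun t => ⟨horder a hu _ _, hSt _ _, ?_⟩)
    · have hval : ∀ k' l' (ω : ℝ), evalAt (simplePole (Pi.single k 1) (Pi.single l 1) a)
          (-(I * (ω : ℂ))) k' l' = if k' = k ∧ l' = l then -(I * ω - ((-a : ℝ) : ℂ))⁻¹ else 0 :=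
        fun k' l' ω => by
          rw [neg_axis, evalAt_simplePole _ _ (hne _), ← neg_axis]
          by_cases hk : k' = k
          · by_cases hl : l' = l
            · subst hk hl
              rw [← inv_neg]
              simp
              ring_nf
            · simp [hl]
          · simp [hk]
      simp_rw [hval] at hv
      rw [Finset.sum_eq_single k (fun k' _ hk => by simp [hk]) (by simp),
        Finset.sum_eq_single l (fun l' _ hl => by simp [hl]) (by simp)] at hv
      simp only [and_self, if_true, mul_neg] at hv
      rw [integral_neg, neg_eq_zero] at hv
      exact hv
    · constructor
      · have : (fun ω : ℝ => evalAt (simplePole (Pi.single k 1) (Pi.single l 1) a)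
            (I * (ω : ℂ)) k' l') = fun ω : ℝ =>
            ((Pi.single k 1 : Fin p → ℝ) k' * (Pi.single l 1 : Fin m → ℝ) l' : ℂ) *
              (I * ω - a)⁻¹ := by
          ext ω
          exact evalAt_simplePole _ _ (hne ω) k' l'
        rw [this]
        exact continuous_const.mul (axisDecay_inv_sub (by simpa using ha0)).continuous
      · refine ((isBigO_inv_sub (a : ℂ)).const_mul_left
          ((Pi.single k 1 : Fin p → ℝ) k' * (Pi.single l 1 : Fin m → ℝ) l' : ℂ)).congr' ?_ .rfl
        filter_upwards [Bornology.eventually_ne_cobounded (a : ℂ)] with s hs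
        rw [evalAt_simplePole _ _ hs]
    · filter_upwards [eventually_not_isPole_cofinite (transferFunction 1 A B C),
        (Set.finite_singleton (a : ℂ)).eventually_cofinite_notMem] with s hs1 hs2
      rw [evalAt_add hs1 (not_isPole_simplePole _ _ hs2)]
      congr 1
      ext k' l'
      rw [Matrix.smul_apply, evalAt_simplePole _ _ hs2, evalAt_simplePole _ _ hs2]
      simp only [Pi.smul_apply, smul_eq_mul, ofReal_mul]
      ring
  have hbad : {a : ℝ | ¬ IsUnit (A - a • 1).det}.Finite := by
    refine (Set.Finite.preimage (ofReal_injective.injOn)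
      (eventually_cofinite.1 (eventually_isUnit_pencil_cofinite A))).subset fun a ha => ?_
    exact fun hu => ha (isUnit_sub_smul hu)
  -- Stationarity rewritten so that both sides pair functions of Hardy type; the sign of `a` decides
  -- which kernel, at `-a` on the left or at `a` on the right, has its pole in the right half-plane.
  have hsplit : ∀ a : ℝ, a ≠ 0 → (∀ u v, transferFunction 1 A B C + simplePole u v a ∈ S) →
      IsUnit (A - a • 1).det → ∀ k l,
      ∫ ω : ℝ, (ratVal (Gsp k l) (I * ω) - stablePart lam (coeff z y B C k l) (I * ω)) *
        (I * ω - ((-a : ℝ) : ℂ))⁻¹ =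
      -∫ ω : ℝ, antistablePart lam (coeff z y B C k l) (-(I * ω)) * (I * ω - a)⁻¹ :=
    fun a ha0 ha hu k l => by
      have h1 := hstat a ha0 ha hu k l
      have hdec : AxisDecay fun s => (s - ((-a : ℝ) : ℂ))⁻¹ :=
        axisDecay_inv_sub (by simpa using ha0)
      have hint1 := (hneg k l).axisDecay.integrable_mul hdec
      have hint2 := (axisDecay_antistablePart lam (coeff z y B C k l)).integrable_mul hdec
      have h2 := integral_reflect (antistablePart lam (coeff z y B C k l)) ((-a : ℝ) : ℂ)
      rw [show -((-a : ℝ) : ℂ) = a by simp] at h2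
      rw [← h2, ← sub_eq_zero, ← integral_sub hint1 hint2, ← h1]
      refine integral_congr_ae ?_
      filter_upwards [ae_axis_of_cofinite (h.eventually_error_eq Gsp k l (h0 k l))] with ω hω
      rw [hω]
      ring
  -- For `a = -x < 0` the right side vanishes by Cauchy, and the left side evaluates the stable part
  -- of the error at `x`. Only the finitely many real eigenvalues are excluded.
  have hneg0 : ∀ k l, ∀ ω : ℝ, ratVal (Gsp k l) (I * ω) -
      stablePart lam (coeff z y B C k l) (I * ω) = 0 := fun k l ω => by
    refine (hneg k l).eq_zero_of_finite ?_ (by simp)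
    refine (hbad.preimage neg_injective.injOn).subset fun x hx => ?_
    intro hu
    refine hx.2 ((hneg k l).eq_zero_of_integral (by simpa using hx.1) ?_)
    have hSt : ∀ u v, transferFunction 1 A B C + simplePole u v (-x) ∈ S := fun u v => by
      rcases hS with rfl | rfl
      · trivial
      · exact IsStable.add hmem (isStable_simplePole u v (by linarith [hx.1]))
    have h1 := hsplit (-x) (by linarith [hx.1]) hSt hu k l
    rw [(hardyLike_antistablePart_neg lam (coeff z y B C k l)).integral_mul_eq_zero
      (hardyLike_inv_sub (c := ((-x : ℝ) : ℂ)) (by simpa using hx.1)), neg_zero, neg_neg] at h1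
    exact h1
  have hpos0 : ∀ k l, ∀ ω : ℝ, antistablePart lam (coeff z y B C k l) (I * ω) = 0 :=
    fun k l ω => by
      -- If all models compete, `a = x > 0` is admissible and evaluates the reflected antistable
      -- part at `x`. If only stable ones compete, that `a` is unavailable, but the antistable
      -- coefficients vanish by stability.
      rcases hS with hS | hS
      · have h1 : antistablePart lam (coeff z y B C k l) (-(I * ((-ω : ℝ) : ℂ))) = 0 := by
          refine (hardyLike_antistablePart_neg lam (coeff z y B C k l)).eq_zero_of_finite
            (s := I * ((-ω : ℝ) : ℂ)) ?_ (by simp)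
          refine hbad.subset fun x hx => ?_
          intro hu
          refine hx.2 ((hardyLike_antistablePart_neg lam (coeff z y B C k l)).eq_zero_of_integral
            (by simpa using hx.1) ?_)
          have h1 := hsplit x hx.1.ne' (fun u v => by rw [hS]; trivial) hu k l
          rw [(hneg k l).integral_mul_eq_zero
            (hardyLike_inv_sub (c := ((-x : ℝ) : ℂ)) (by simpa using hx.1))] at h1
          exact neg_eq_zero.1 h1.symm
        rwa [neg_axis, neg_neg] at h1
      · rw [hS] at hmem
        refine Finset.sum_eq_zero fun j _ => ?_
        split_ifs with hj
        · rw [h.coeff_eq_zero_of_isStable hmem hj.le, zero_mul]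
        · rw [zero_mul]
  rw [← sub_eq_zero]
  ext k l
  have hinj : Function.Injective fun ω : ℝ => I * (ω : ℂ) := fun x y hxy => by simpa using hxy
  have hcof := hinj.tendsto_cofinite.eventually (h.eventually_error_eq Gsp k l (h0 k l))
  have hfinc := eventually_cofinite.1 hcof
  refine eq_zero_of_frequently_ratVal
    (T := (fun ω : ℝ => I * (ω : ℂ)) '' {ω : ℝ | ratVal (D k l) (I * ω) = 0})
    (Set.Infinite.image hinj.injOn fun hf => ?_) ?_
  · refine Set.infinite_univ (α := ℝ) ((hf.union hfinc).subset fun ω _ => ?_)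
    by_cases hω : ratVal (D k l) (I * ω) = 0
    · exact Or.inl hω
    · refine Or.inr fun he => hω ?_
      rw [← evalAt_apply, he, hneg0, hpos0, sub_zero]
  · rintro _ ⟨ω, hω, rfl⟩
    exact hω

end IsModal

end ModelReduction

/-! ### Perturbing `B` and `C`, and excluding antistable modes. -/

namespace ModelReduction
open Filter Topology Asymptotics
open Bornology (cobounded)
open Complex MeasureTheory

variable {r p m : ℕ}

namespace IsModal

variable {A : Matrix (Fin r) (Fin r) ℝ} {lam : Fin r → ℂ} {z y : Fin r → Fin r → ℂ}
  {Gsp : RatMatrix p m} {B : Matrix (Fin r) (Fin m) ℝ} {C : Matrix (Fin p) (Fin r) ℝ}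
  {S : Set (RatMatrix p m)}

/-- The resolvent times the input matrix. -/
noncomputable abbrev inputMap (A : Matrix (Fin r) (Fin r) ℝ) (B : Matrix (Fin r) (Fin m) ℝ) :
    RatMatrix r m := transferFunction 1 A B 1

/-- The output matrix times the resolvent. -/
noncomputable abbrev outputMap (A : Matrix (Fin r) (Fin r) ℝ) (C : Matrix (Fin p) (Fin r) ℝ) :
    RatMatrix p r := transferFunction 1 A 1 C

theorem map_ofReal_one : (1 : Matrix (Fin r) (Fin r) ℝ).map Complex.ofReal = 1 := by
  ext i j
  by_cases h : i = j
  · subst h; simp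
  · simp [Matrix.one_apply_ne h]

/-- A left eigenvector diagonalizes the resolvent, so this combination of rows collapses to one
simple pole with direction `bᵢ`. -/
theorem left_inputMap (h : IsModal A lam z y) {s : ℂ} (hs : ∀ i, s ≠ lam i) (i : Fin r) :
    y i ᵥ* evalAt (inputMap A B) s = (s - lam i)⁻¹ • (y i ᵥ* B.map Complex.ofReal) := by
  have hu := h.isUnit hs
  rw [evalAt_transferFunction hu, map_ofReal_one, one_mul, ← Matrix.vecMul_vecMul,
    ← Matrix.smul_vecMul]
  congr 1
  rw [eq_inv_smul_iff₀ (sub_ne_zero.2 (hs i)), ← Matrix.smul_vecMul, ← h.vecMul_pencil,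
    Matrix.vecMul_vecMul, Matrix.mul_nonsing_inv _ hu, Matrix.vecMul_one]

theorem outputMap_right (h : IsModal A lam z y) {s : ℂ} (hs : ∀ i, s ≠ lam i) (i : Fin r) :
    evalAt (outputMap A C) s *ᵥ z i = (s - lam i)⁻¹ • (C.map Complex.ofReal *ᵥ z i) := by
  have hu := h.isUnit hs
  rw [evalAt_transferFunction hu, map_ofReal_one, Matrix.mul_one, ← Matrix.mulVec_mulVec,
    ← Matrix.mulVec_smul]
  congr 1
  rw [eq_inv_smul_iff₀ (sub_ne_zero.2 (hs i)), ← Matrix.mulVec_smul, ← h.pencil_mulVec,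
    Matrix.mulVec_mulVec, Matrix.nonsing_inv_mul _ hu, Matrix.one_mulVec]

theorem evalAt_single_output {s : ℂ} (hs : IsUnit (pencil A s).det) (B : Matrix (Fin r) (Fin m) ℝ)
    (k : Fin p) (q : Fin r) (k' : Fin p) (l : Fin m) :
    evalAt (transferFunction 1 A B (Matrix.single k q 1)) s k' l =
      if k' = k then evalAt (inputMap A B) s q l else 0 := by
  have h1 : (Matrix.single k q (1 : ℝ)).map Complex.ofReal = Matrix.single k q 1 := by
    ext i j; simp [Matrix.single_apply, apply_ite]
  rw [evalAt_transferFunction hs, evalAt_transferFunction hs, h1, map_ofReal_one, one_mul,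
    Matrix.mul_assoc]
  split_ifs with hk
  · subst hk; simp
  · exact Matrix.single_mul_apply_of_ne _ _ _ _ _ hk _

theorem evalAt_single_input {s : ℂ} (hs : IsUnit (pencil A s).det) (C : Matrix (Fin p) (Fin r) ℝ)
    (q : Fin r) (l : Fin m) (k : Fin p) (l' : Fin m) :
    evalAt (transferFunction 1 A (Matrix.single q l 1) C) s k l' =
      if l' = l then evalAt (outputMap A C) s k q else 0 := by
  have h1 : (Matrix.single q l (1 : ℝ)).map Complex.ofReal = Matrix.single q l 1 := by
    ext i j; simp [Matrix.single_apply, apply_ite]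
  rw [evalAt_transferFunction hs, evalAt_transferFunction hs, h1, map_ofReal_one, Matrix.mul_one]
  split_ifs with hl
  · subst hl; simp
  · exact Matrix.mul_single_apply_of_ne _ _ _ _ _ hl _

theorem map_add_smul {k l : ℕ} (M N : Matrix (Fin k) (Fin l) ℝ) (t : ℝ) :
    (M + t • N).map Complex.ofReal = M.map Complex.ofReal + (t : ℂ) • N.map Complex.ofReal := by
  ext i j; simp

/-- Vary the single entry `(k, q)` of `C`: the model changes only in its row `k`, by a multiple of
row `q` of the input map. -/
theorem output_stationary (h : IsModal A lam z y) (hre : ∀ i, (lam i).re ≠ 0)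
    (hmem : ∀ C', transferFunction 1 A B C' ∈ S)
    (hmin : ∀ H, HasOrder r H → H ∈ S →
      axisEnergy (Gsp - transferFunction 1 A B C) ≤ axisEnergy (Gsp - H))
    (hfin : axisEnergy (Gsp - transferFunction 1 A B C) < ⊤) (k : Fin p) (q : Fin r) :
    ∑ l, ∫ ω : ℝ, evalAt (Gsp - transferFunction 1 A B C) (I * ω) k l *
      evalAt (inputMap A B) (-(I * ω)) q l = 0 := by
  have hv := variation_linear (K := transferFunction 1 A B (Matrix.single k q 1)) hmin hfin
    (fun t => transferFunction 1 A B (C + t • Matrix.single k q 1)) (h.axisDecay hre _ _)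
    (fun t => ⟨hasOrder_one _ _ _, hmem _, ?_⟩)
  · have hu : ∀ ω : ℝ, IsUnit (pencil A (-(I * (ω : ℂ)))).det := fun ω => by
      rw [neg_axis]; exact h.isUnit fun i => axis_ne (hre i) _
    simp_rw [evalAt_single_output (hu _)] at hv
    rw [Finset.sum_eq_single k (fun k' _ hk => by simp [hk]) (by simp)] at hv
    simpa using hv
  · filter_upwards [eventually_isUnit_pencil_cofinite A] with s hs
    rw [evalAt_transferFunction hs, evalAt_transferFunction hs, evalAt_transferFunction hs,
      map_add_smul, Matrix.add_mul, Matrix.add_mul, Matrix.smul_mul, Matrix.smul_mul]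

theorem input_stationary (h : IsModal A lam z y) (hre : ∀ i, (lam i).re ≠ 0)
    (hmem : ∀ B', transferFunction 1 A B' C ∈ S)
    (hmin : ∀ H, HasOrder r H → H ∈ S →
      axisEnergy (Gsp - transferFunction 1 A B C) ≤ axisEnergy (Gsp - H))
    (hfin : axisEnergy (Gsp - transferFunction 1 A B C) < ⊤) (l : Fin m) (q : Fin r) :
    ∑ k, ∫ ω : ℝ, evalAt (Gsp - transferFunction 1 A B C) (I * ω) k l *
      evalAt (outputMap A C) (-(I * ω)) k q = 0 := by
  have hv := variation_linear (K := transferFunction 1 A (Matrix.single q l 1) C) hmin hfin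
    (fun t => transferFunction 1 A (B + t • Matrix.single q l 1) C) (h.axisDecay hre _ _)
    (fun t => ⟨hasOrder_one _ _ _, hmem _, ?_⟩)
  · have hu : ∀ ω : ℝ, IsUnit (pencil A (-(I * (ω : ℂ)))).det := fun ω => by
      rw [neg_axis]; exact h.isUnit fun i => axis_ne (hre i) _
    simp_rw [evalAt_single_input (hu _)] at hv
    rw [Finset.sum_comm, Finset.sum_eq_single l (fun l' _ hl => by simp [hl]) (by simp)] at hv
    simpa using hv
  · filter_upwards [eventually_isUnit_pencil_cofinite A] with s hs
    rw [evalAt_transferFunction hs, evalAt_transferFunction hs, evalAt_transferFunction hs,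
      map_add_smul, Matrix.mul_add, Matrix.mul_smul]

theorem axisDecay_error (h : IsModal A lam z y) (hre : ∀ i, (lam i).re ≠ 0)
    (hG : IsStable Gsp) (hGsp : IsStrictlyProper Gsp) (k : Fin p) (l : Fin m) :
    AxisDecay fun s => evalAt (Gsp - transferFunction 1 A B C) s k l where
  continuous := by
    have h1 := (hardyLike_ratVal hG k l (ratVal_isBigO (hGsp k l))).axisDecay.continuous.sub
      (h.axisDecay hre B C k l).continuous
    refine h1.congr fun ω => ?_
    rw [evalAt_sub (hG.not_isPole (by simp))
      (not_isPole_transferFunction (h.isUnit fun i => axis_ne (hre i) ω) B C)]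
    rfl
  isBigO := by
    refine ((ratVal_isBigO (hGsp k l)).sub (evalAt_transferFunction_isBigO A B C k l)).congr' ?_ .rfl
    filter_upwards [eventually_not_isPole_cobounded Gsp,
      eventually_not_isPole_cobounded (transferFunction 1 A B C)] with s h1 h2
    rw [evalAt_sub h1 h2]
    rfl

/-- Row `k` of the antistable part is itself a direction reachable by varying row `k` of `C`, so the
error is orthogonal to it. The error is a Hardy function minus that antistable part, and the two are
orthogonal on the axis, so the pairing equals minus the energy of the row, which must be zero. -/
theorem coeff_eq_zero_of_unstable (h : IsModal A lam z y) (hre : ∀ i, (lam i).re ≠ 0)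
    (hG : IsStable Gsp) (hGsp : IsStrictlyProper Gsp) (hmem : ∀ C', transferFunction 1 A B C' ∈ S)
    (hmin : ∀ H, HasOrder r H → H ∈ S →
      axisEnergy (Gsp - transferFunction 1 A B C) ≤ axisEnergy (Gsp - H))
    (hfin : axisEnergy (Gsp - transferFunction 1 A B C) < ⊤) {i : Fin r} (hi : 0 < (lam i).re)
    (k : Fin p) (l : Fin m) : coeff z y B C k l i = 0 := by
  set D := Gsp - transferFunction 1 A B C
  set f : Fin m → ℂ → ℂ := fun l => antistablePart lam (coeff z y B C k l) with hf
  have hdecf : ∀ l, AxisDecay (f l) := fun l => axisDecay_antistablePart _ _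
  have hdecK : ∀ q l, AxisDecay fun s => evalAt (inputMap A B) s q l := fun q l =>
    h.axisDecay hre B 1 q l
  have hconjK : ∀ (ω : ℝ) q l, evalAt (inputMap A B) (-(I * ω)) q l =
      (starRingEnd ℂ) (evalAt (inputMap A B) (I * ω) q l) := fun ω q l => evalAt_neg_axis _ ω q l
  -- The complex row by which `C` is perturbed: the antistable left eigenvectors weighted by entry
  -- `k` of their output directions.
  set w : Fin r → ℂ := fun q =>
    ∑ j, (if 0 < (lam j).re then (C.map Complex.ofReal *ᵥ z j) k else 0) * y j q with hw
  have hfw : ∀ (ω : ℝ) l, f l (I * ω) = ∑ q, w q * evalAt (inputMap A B) (I * ω) q l :=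
    fun ω l => by
      have h1 : ∀ j, ∑ q, y j q * evalAt (inputMap A B) (I * ω) q l =
          (I * ω - lam j)⁻¹ * (y j ᵥ* B.map Complex.ofReal) l := fun j => by
        have := congrFun (h.left_inputMap (B := B) (s := I * ω) (fun i => axis_ne (hre i) ω) j) l
        simpa [Matrix.vecMul, dotProduct] using this
      simp only [hw, Finset.sum_mul]
      rw [Finset.sum_comm]
      simp only [mul_assoc, ← Finset.mul_sum, h1]
      simp only [hf, antistablePart, coeff]
      refine Finset.sum_congr rfl fun j _ => ?_
      split_ifs
      · ring
      · simp
  have hint : ∀ q l, Integrable fun ω : ℝ => evalAt D (I * ω) k l *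
      evalAt (inputMap A B) (-(I * ω)) q l := fun q l => by
    have hD := h.axisDecay_error (B := B) (C := C) hre hG hGsp k l
    simp_rw [hconjK]
    exact hD.memLp.integrable_mul (hdecK q l).memLp.star
  have hzero : ∑ l, ∫ ω : ℝ, evalAt D (I * ω) k l * (starRingEnd ℂ) (f l (I * ω)) = 0 := by
    have h1 : ∀ l, ∫ ω : ℝ, evalAt D (I * ω) k l * (starRingEnd ℂ) (f l (I * ω)) =
        ∑ q, (starRingEnd ℂ) (w q) * ∫ ω : ℝ, evalAt D (I * ω) k l *
          evalAt (inputMap A B) (-(I * ω)) q l := fun l => by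
      simp_rw [← integral_const_mul]
      rw [← integral_finsetSum _ fun q _ => (hint q l).const_mul _]
      refine integral_congr_ae (Eventually.of_forall fun ω => ?_)
      simp only
      rw [hfw, map_sum, Finset.mul_sum]
      refine Finset.sum_congr rfl fun q _ => ?_
      rw [map_mul, hconjK]
      ring
    simp_rw [h1]
    rw [Finset.sum_comm]
    refine Finset.sum_eq_zero fun q _ => ?_
    rw [← Finset.mul_sum, h.output_stationary hre hmem hmin hfin k q, mul_zero]
  have hnsq : ∀ l, ∫ ω : ℝ, evalAt D (I * ω) k l * (starRingEnd ℂ) (f l (I * ω)) =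
      -((∫ ω : ℝ, normSq (f l (I * ω)) : ℝ) : ℂ) := fun l => by
    obtain ⟨g, hg, hgf⟩ := conj_antistablePart lam (coeff z y B C k l)
    have hn : HardyLike fun s => ratVal (Gsp k l) s - stablePart lam (coeff z y B C k l) s :=
      (hardyLike_ratVal hG k l (ratVal_isBigO (hGsp k l))).sub (hardyLike_stablePart _ _)
    have h1 := hn.integral_mul_eq_zero hg
    have hi1 := hn.axisDecay.integrable_mul hg.axisDecay
    have hi2 := (hdecf l).integrable_mul hg.axisDecay
    rw [← integral_complex_ofReal, ← integral_neg, ← zero_add (∫ ω : ℝ, -((_ : ℝ) : ℂ)), ← h1]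
    have h2 : ∀ ω : ℝ, (normSq (f l (I * ω)) : ℂ) = f l (I * ω) * g (I * ω) := fun ω => by
      rw [← hgf, ← mul_conj]
    simp_rw [h2]
    have hi3 : Integrable fun ω : ℝ => -(f l (I * ω) * g (I * ω)) := hi2.neg
    rw [← integral_add hi1 hi3]
    refine integral_congr_ae ?_
    filter_upwards [ae_axis_of_cofinite (h.eventually_error_eq Gsp k l
      fun i hi => absurd hi (hre i))] with ω hω
    rw [hω, ← hgf]
    simp only [hf]
    ring
  simp_rw [hnsq] at hzero
  rw [Finset.sum_neg_distrib, neg_eq_zero] at hzero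
  have hzero' : ∑ l, ∫ ω : ℝ, normSq (f l (I * ω)) = 0 := by exact_mod_cast hzero
  have hl := (Finset.sum_eq_zero_iff_of_nonneg fun l _ =>
    integral_nonneg fun ω : ℝ => normSq_nonneg (f l (I * (ω : ℂ)))).1 hzero' l (Finset.mem_univ l)
  have hint2 : Integrable fun ω : ℝ => normSq (f l (I * ω)) := by
    simp_rw [normSq_eq_norm_sq]
    exact (hdecf l).memLp.integrable_norm_pow two_ne_zero
  rw [integral_eq_zero_iff_of_nonneg (fun ω => normSq_nonneg _) hint2] at hl
  have hall := Continuous.ae_eq_iff_eq (μ := volume)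
    (Complex.continuous_normSq.comp (hdecf l).continuous) continuous_const |>.1 hl
  have hinj : Function.Injective fun ω : ℝ => I * (ω : ℂ) := fun x y hxy => by simpa using hxy
  have := coeff_eq_zero_of_infinite h.inj (Set.infinite_range_of_injective hinj)
    (α := fun j => if 0 < (lam j).re then coeff z y B C k l j else 0) (by
      rintro _ ⟨ω, rfl⟩
      exact normSq_eq_zero.1 (congrFun hall ω)) i
  simpa [hi] using this

end IsModal

end ModelReduction

/-! ### Perturbing `A`, and the Hermite interpolation conditions. -/

namespace ModelReduction
open Filter Topology Asymptotics
open Bornology (cobounded)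
open Complex MeasureTheory

variable {r p m : ℕ}

theorem AxisDecay.mul {f g : ℂ → ℂ} (hf : AxisDecay f) (hg : AxisDecay g) :
    AxisDecay (fun s => f s * g s) where
  continuous := hf.continuous.mul hg.continuous
  isBigO := by
    have h1 : g =O[cobounded ℂ] fun _ => (1 : ℂ) :=
      hg.isBigO.trans ((tendsto_inv₀_cobounded (α := ℂ)).isBigO_one ℂ)
    simpa using hf.isBigO.mul h1

/-- Passes from real entrywise perturbations to complex combinations along eigenvectors; the
bilinear form of the conditions makes this legitimate. -/
theorem integral_combination_eq_zero {ι κ : Type*} [Fintype ι] [Fintype κ] {e : ι → ℝ → ℂ}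
    {w : κ → ι → ℝ → ℂ} (a : κ → ℂ) (hint : ∀ q x, Integrable fun ω => e x ω * w q x ω)
    (h0 : ∀ q, ∑ x, ∫ ω, e x ω * w q x ω = 0) :
    ∫ ω, ∑ x, e x ω * ∑ q, a q * w q x ω = 0 := by
  have h1 : ∀ ω, ∑ x, e x ω * ∑ q, a q * w q x ω = ∑ q, ∑ x, a q * (e x ω * w q x ω) := fun ω => by
    rw [Finset.sum_comm]
    refine Finset.sum_congr rfl fun x _ => ?_
    rw [Finset.mul_sum]
    exact Finset.sum_congr rfl fun q _ => by ring
  simp_rw [h1]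
  rw [integral_finsetSum _ fun q _ => integrable_finsetSum _ fun x _ => (hint q x).const_mul _]
  refine Finset.sum_eq_zero fun q _ => ?_
  rw [integral_finsetSum _ fun x _ => (hint q x).const_mul _]
  simp_rw [integral_const_mul]
  rw [← Finset.mul_sum, h0 q, mul_zero]

namespace IsModal

variable {A : Matrix (Fin r) (Fin r) ℝ} {lam : Fin r → ℂ} {z y : Fin r → Fin r → ℂ}
  {Gsp : RatMatrix p m} {B : Matrix (Fin r) (Fin m) ℝ} {C : Matrix (Fin p) (Fin r) ℝ}
  {S : Set (RatMatrix p m)}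

section

attribute [local instance] Matrix.linftyOpNormedRing Matrix.linftyOpNormedAlgebra

/-- In the modal expansion, `|s - λᵢ| ≥ -Re λᵢ` on the closed right half-plane. Uniformity of the
bound keeps a small perturbation of `A` stable. -/
theorem exists_resolvent_bound (h : IsModal A lam z y) (hre : ∀ i, (lam i).re < 0) :
    ∃ K : ℝ, 0 ≤ K ∧ ∀ s : ℂ, 0 ≤ s.re → ‖(pencil A s)⁻¹‖ ≤ K := by
  refine ⟨∑ i, (-(lam i).re)⁻¹ * ‖Matrix.vecMulVec (z i) (y i)‖,
    Finset.sum_nonneg fun i _ => mul_nonneg (inv_nonneg.2 (by linarith [hre i])) (norm_nonneg _),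
    fun s hs => ?_⟩
  rw [h.inv_eq fun i hi => by have := hre i; rw [← hi] at this; linarith]
  refine (norm_sum_le _ _).trans (Finset.sum_le_sum fun i _ => ?_)
  rw [norm_smul, norm_inv]
  refine mul_le_mul_of_nonneg_right ?_ (norm_nonneg _)
  refine inv_anti₀ (by linarith [hre i]) ?_
  have := re_le_norm (s - lam i)
  rw [sub_re] at this
  linarith

/-- Vary the entry `(q, q')` of `A`. The resolvent identity gives the exact difference quotient `C
R_t e_q e_q'ᵀ R B`, in which only the left factor depends on `t`; it is uniformly bounded and
converges, while the right factor supplies the square integrable decay. -/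
theorem state_stationary (h : IsModal A lam z y) (hre : ∀ i, (lam i).re < 0)
    (hmem : ∀ H, IsStable H → H ∈ S)
    (hmin : ∀ H, HasOrder r H → H ∈ S →
      axisEnergy (Gsp - transferFunction 1 A B C) ≤ axisEnergy (Gsp - H))
    (hfin : axisEnergy (Gsp - transferFunction 1 A B C) < ⊤) (q q' : Fin r) :
    ∑ k, ∑ l, ∫ ω : ℝ, evalAt (Gsp - transferFunction 1 A B C) (I * ω) k l *
      (evalAt (outputMap A C) (-(I * ω)) k q * evalAt (inputMap A B) (-(I * ω)) q' l) = 0 := by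
  obtain ⟨K, hK0, hK⟩ := h.exists_resolvent_bound hre
  set Δ : Matrix (Fin r) (Fin r) ℝ := Matrix.single q q' 1
  have hu : ∀ s : ℂ, 0 ≤ s.re → IsUnit (pencil A s).det := fun s hs =>
    h.isUnit fun i hi => by have := hre i; rw [← hi] at this; linarith
  have hsmall : ∀ᶠ t : ℝ in 𝓝 0, |t| * (‖Δ.map Complex.ofReal‖ * K) ≤ 1 / 2 := by
    have : Tendsto (fun t : ℝ => |t| * (‖Δ.map Complex.ofReal‖ * K)) (𝓝 0) (𝓝 0) :=
      Continuous.tendsto' (by fun_prop) _ _ (by simp)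
    exact this.eventually (ge_mem_nhds (by norm_num))
  have hpert : ∀ t : ℝ, |t| * (‖Δ.map Complex.ofReal‖ * K) ≤ 1 / 2 → ∀ s : ℂ, 0 ≤ s.re →
      IsUnit (pencil (A + t • Δ) s).det ∧ ‖(pencil (A + t • Δ) s)⁻¹‖ ≤ 2 * K := fun t ht s hs => by
    have h1 := pencil_perturb (Δ := Δ) (t := t) (hu s hs) (le_trans (by gcongr; exact hK s hs) ht)
    exact ⟨h1.1, h1.2.trans (by linarith [hK s hs])⟩
  have hout : ∀ t : ℝ, |t| * (‖Δ.map Complex.ofReal‖ * K) ≤ 1 / 2 → ∀ s : ℂ, 0 ≤ s.re → ∀ k,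
      evalAt (outputMap (A + t • Δ) C) s k q =
        (C.map Complex.ofReal * (pencil (A + t • Δ) s)⁻¹) k q := fun t ht s hs k => by
    rw [evalAt_transferFunction (hpert t ht s hs).1, map_ofReal_one, Matrix.mul_one]
  have hax : ∀ ω : ℝ, 0 ≤ (I * (ω : ℂ)).re := fun ω => by simp
  choose N hN0 hN using fun l => (h.axisDecay (fun i => (hre i).ne) B 1 q' l).exists_bound
  set c : Fin p → ℝ := fun k => (∑ a, ‖C.map Complex.ofReal k a‖) * (2 * K)
  have hc0 : ∀ k, 0 ≤ c k := fun k =>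
    mul_nonneg (Finset.sum_nonneg fun _ _ => norm_nonneg _) (by linarith)
  have hv := variation_bilinear hmin hfin (fun t => transferFunction 1 (A + t • Δ) B C)
    (fun t k l s => evalAt (outputMap (A + t • Δ) C) s k q * evalAt (inputMap A B) s q' l)
    (∑ k, ∑ l, c k * N l) ?_ ?_ ?_ ?_ ?_
  · simpa using hv
  · filter_upwards [hsmall] with t ht
    refine ⟨hasOrder_one _ _ _, hmem _ (isStable_of fun s hs =>
      not_isPole_transferFunction (hpert t ht s hs).1 B C), ?_⟩
    filter_upwards [eventually_isUnit_pencil_cofinite A,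
      eventually_isUnit_pencil_cofinite (A + t • Δ)] with s hs hst k l
    have h1 := pencil_inv_sub hs hst
    have h2 : Δ.map Complex.ofReal = Matrix.vecMulVec (Pi.single q 1) (Pi.single q' 1) := by
      rw [← Matrix.single_eq_single_vecMulVec_single]
      ext i j
      simp [Δ, Matrix.single_apply, apply_ite]
    have h3 : C.map Complex.ofReal * (pencil (A + t • Δ) s)⁻¹ * B.map Complex.ofReal =
        C.map Complex.ofReal * (pencil A s)⁻¹ * B.map Complex.ofReal +
        (t : ℂ) • Matrix.vecMulVec
          ((C.map Complex.ofReal * (pencil (A + t • Δ) s)⁻¹) *ᵥ Pi.single q 1)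
          (Pi.single q' 1 ᵥ* ((pencil A s)⁻¹ * B.map Complex.ofReal)) := by
      rw [← Matrix.vecMulVec_mul, ← Matrix.mul_vecMulVec, ← h2, ← sub_eq_iff_eq_add',
        ← Matrix.sub_mul, ← Matrix.mul_sub, h1, Matrix.mul_smul, Matrix.smul_mul]
      simp only [Matrix.mul_assoc]
    rw [evalAt_transferFunction hs, evalAt_transferFunction hst, evalAt_transferFunction hs,
      evalAt_transferFunction hst, map_ofReal_one, Matrix.mul_one, one_mul, h3]
    simp [Matrix.vecMulVec_apply]
  · refine Eventually.of_forall fun t k l => ?_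
    exact (measurable_ratVal_axis _).mul (measurable_ratVal_axis _)
  · filter_upwards [hsmall] with t ht k l ω
    rw [norm_mul, hout t ht _ (hax ω)]
    have h1 : ‖(C.map Complex.ofReal * (pencil (A + t • Δ) (I * ω))⁻¹) k q‖ ≤ c k :=
      (norm_mul_apply_le _ _ k q).trans (mul_le_mul_of_nonneg_left (hpert t ht _ (hax ω)).2
        (Finset.sum_nonneg fun _ _ => norm_nonneg _))
    have h2 : c k * N l ≤ ∑ k, ∑ l, c k * N l :=
      (Finset.single_le_sum (f := fun l => c k * N l) (fun l _ => mul_nonneg (hc0 k) (hN0 l))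
        (Finset.mem_univ l)).trans
      (Finset.single_le_sum (f := fun k => ∑ l, c k * N l)
        (fun k _ => Finset.sum_nonneg fun l _ => mul_nonneg (hc0 k) (hN0 l)) (Finset.mem_univ k))
    calc _ ≤ c k * (N l * (√(1 + ω ^ 2))⁻¹) :=
          mul_le_mul h1 (hN l ω) (norm_nonneg _) (hc0 k)
      _ = c k * N l * (√(1 + ω ^ 2))⁻¹ := by ring
      _ ≤ _ := mul_le_mul_of_nonneg_right h2 (by positivity)
  · intro k l ω
    refine Tendsto.mul_const _ ?_
    rw [tendsto_iff_norm_sub_tendsto_zero]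
    have hlim : Tendsto (fun t : ℝ => (∑ a, ‖C.map Complex.ofReal k a‖) *
        (|t| * (2 * K * ‖Δ.map Complex.ofReal‖ * K))) (𝓝 0) (𝓝 0) :=
      Continuous.tendsto' (by fun_prop) _ _ (by simp)
    refine squeeze_zero' (Eventually.of_forall fun _ => norm_nonneg _) ?_ hlim
    filter_upwards [hsmall] with t ht
    have h0 : |(0 : ℝ)| * (‖Δ.map Complex.ofReal‖ * K) ≤ 1 / 2 := by simp
    rw [hout t ht _ (hax ω), hout 0 h0 _ (hax ω), ← Matrix.sub_apply, ← Matrix.mul_sub]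
    refine (norm_mul_apply_le _ _ k q).trans (mul_le_mul_of_nonneg_left ?_
        (Finset.sum_nonneg fun _ _ => norm_nonneg _))
    rw [zero_smul, add_zero, pencil_inv_sub (hu _ (hax ω)) (hpert t ht _ (hax ω)).1, norm_smul,
      Complex.norm_real, Real.norm_eq_abs]
    refine mul_le_mul_of_nonneg_left ?_ (abs_nonneg t)
    refine (norm_mul_le _ _).trans (mul_le_mul ((norm_mul_le _ _).trans ?_) (hK _ (hax ω))
      (norm_nonneg _) (by positivity))
    exact mul_le_mul_of_nonneg_right (hpert t ht _ (hax ω)).2 (norm_nonneg _)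
  · intro k l ω
    rw [evalAt_neg_axis, evalAt_neg_axis, ← map_mul]

end

theorem hardyLike_error (h : IsModal A lam z y) (hre : ∀ i, (lam i).re < 0)
    (hG : IsStable Gsp) (hGsp : IsStrictlyProper Gsp) (k : Fin p) (l : Fin m) :
    HardyLike (ratVal ((Gsp - transferFunction 1 A B C) k l)) :=
  hardyLike_ratVal (hG.sub (h.isStable hre B C)) k l
    (h.axisDecay_error (fun i => (hre i).ne) hG hGsp k l).isBigO

/-- The bitangential Hermite interpolation conditions for the error of an optimal model all of
whose eigenvalues are stable. -/
theorem interpolation (h : IsModal A lam z y) (hre : ∀ i, (lam i).re < 0)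
    (hG : IsStable Gsp) (hGsp : IsStrictlyProper Gsp) (hmem : ∀ H, IsStable H → H ∈ S)
    (hmin : ∀ H, HasOrder r H → H ∈ S →
      axisEnergy (Gsp - transferFunction 1 A B C) ≤ axisEnergy (Gsp - H))
    (hfin : axisEnergy (Gsp - transferFunction 1 A B C) < ⊤) (i : Fin r) :
    (∀ k, ∑ l, ratVal ((Gsp - transferFunction 1 A B C) k l) (-lam i) *
      (y i ᵥ* B.map Complex.ofReal) l = 0) ∧
    (∀ l, ∑ k, (C.map Complex.ofReal *ᵥ z i) k *
      ratVal ((Gsp - transferFunction 1 A B C) k l) (-lam i) = 0) ∧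
    ∑ k, ∑ l, coeff z y B C k l i *
      deriv (ratVal ((Gsp - transferFunction 1 A B C) k l)) (-lam i) = 0 := by
  set D := Gsp - transferFunction 1 A B C with hDdef
  set b := y i ᵥ* B.map Complex.ofReal with hb
  set c := C.map Complex.ofReal *ᵥ z i with hc
  have hre' : ∀ i, (lam i).re ≠ 0 := fun i => (hre i).ne
  have hμ : 0 < (-lam i).re := by simpa using hre i
  have hD : ∀ k l, HardyLike (ratVal (D k l)) := fun k l => h.hardyLike_error hre hG hGsp k l
  have hax : ∀ ω : ℝ, ∀ j, -(I * (ω : ℂ)) ≠ lam j := fun ω j => by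
    rw [neg_axis]; exact axis_ne (hre' j) _
  have hneg : ∀ s : ℂ, (-s - lam i)⁻¹ = -(s - -lam i)⁻¹ := fun s => by
    rw [← inv_neg]; ring_nf
  have hin : ∀ (ω : ℝ) l, ∑ q, y i q * evalAt (inputMap A B) (-(I * ω)) q l =
      -(b l * (I * ω - -lam i)⁻¹) := fun ω l => by
    have := congrFun (h.left_inputMap (B := B) (hax ω) i) l
    rw [hneg] at this
    simp only [Matrix.vecMul, dotProduct, Pi.smul_apply, smul_eq_mul] at this
    rw [this, hb, Matrix.vecMul, dotProduct]
    ring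
  have hout : ∀ (ω : ℝ) k, ∑ q, z i q * evalAt (outputMap A C) (-(I * ω)) k q =
      -(c k * (I * ω - -lam i)⁻¹) := fun ω k => by
    have := congrFun (h.outputMap_right (C := C) (hax ω) i) k
    rw [hneg] at this
    simp only [Matrix.mulVec, dotProduct, Pi.smul_apply, smul_eq_mul] at this
    simp_rw [mul_comm (z i _)]
    rw [this, hc, Matrix.mulVec, dotProduct]
    ring
  have hdecin : ∀ q l, AxisDecay fun s => evalAt (inputMap A B) s q l := fun q l =>
    h.axisDecay hre' B 1 q l
  have hdecout : ∀ k q, AxisDecay fun s => evalAt (outputMap A C) s k q := fun k q =>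
    h.axisDecay hre' 1 C k q
  -- Weighting the conditions for `C` by `y i` turns the test function into minus `bᵢ / (s + λᵢ)`,
  -- the Szegő kernel at `-λᵢ`.
  have hR : ∀ k, ∑ l, b l * ratVal (D k l) (-lam i) = 0 := fun k => by
    refine (HardyLike.sum Finset.univ fun l _ => (hD k l).const_mul (b l)).eq_zero_of_integral hμ ?_
    have h1 := integral_combination_eq_zero (e := fun l ω => ratVal (D k l) (I * ω))
      (w := fun q l ω => evalAt (inputMap A B) (-(I * ω)) q l) (y i) (fun q l => ?_)
      fun q => h.output_stationary hre' (fun C' => hmem _ (h.isStable hre B C')) hmin hfin k q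
    · rw [← neg_eq_zero, ← integral_neg, ← h1]
      refine integral_congr_ae (Eventually.of_forall fun ω => ?_)
      simp only [hin]
      rw [Finset.sum_mul, ← Finset.sum_neg_distrib]
      exact Finset.sum_congr rfl fun l _ => by ring
    · simp_rw [evalAt_neg_axis]
      exact (hD k l).axisDecay.memLp.integrable_mul (hdecin q l).memLp.star
  have hL : ∀ l, ∑ k, c k * ratVal (D k l) (-lam i) = 0 := fun l => by
    refine (HardyLike.sum Finset.univ fun k _ => (hD k l).const_mul (c k)).eq_zero_of_integral hμ ?_
    have h1 := integral_combination_eq_zero (e := fun k ω => ratVal (D k l) (I * ω))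
      (w := fun q k ω => evalAt (outputMap A C) (-(I * ω)) k q) (z i) (fun q k => ?_)
      fun q => h.input_stationary hre' (fun B' => hmem _ (h.isStable hre B' C)) hmin hfin l q
    · rw [← neg_eq_zero, ← integral_neg, ← h1]
      refine integral_congr_ae (Eventually.of_forall fun ω => ?_)
      simp only [hout]
      rw [Finset.sum_mul, ← Finset.sum_neg_distrib]
      exact Finset.sum_congr rfl fun l _ => by ring
    · simp_rw [evalAt_neg_axis]
      exact (hD k l).axisDecay.memLp.integrable_mul (hdecout k q).memLp.star
  refine ⟨fun k => ?_, hL, ?_⟩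
  · simp_rw [mul_comm _ (b _)]
    exact hR k
  set f : ℂ → ℂ := fun s => ∑ k, ∑ l, coeff z y B C k l i * ratVal (D k l) s with hf
  have hfH : HardyLike f := HardyLike.sum Finset.univ fun k _ =>
    HardyLike.sum Finset.univ fun l _ => (hD k l).const_mul _
  have hf0 : f (-lam i) = 0 := by
    refine Finset.sum_eq_zero fun k _ => ?_
    have := hR k
    simp only [coeff, mul_assoc, ← Finset.mul_sum]
    rw [this, mul_zero]
  -- Weighting the conditions for `A` by `z i` and `y i` gives the kernel `(s + λᵢ)⁻²`. Since `f`
  -- vanishes at `-λᵢ`, one factor is absorbed into the divided difference, whose value at `-λᵢ` is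
  -- the derivative.
  have hderiv : deriv f (-lam i) = 0 := by
    rw [← dslope_same]
    refine (hfH.divDiff hμ).eq_zero_of_integral hμ ?_
    have h1 := integral_combination_eq_zero (ι := Fin p × Fin m) (κ := Fin r × Fin r)
      (e := fun x ω => ratVal (D x.1 x.2) (I * ω))
      (w := fun q x ω => evalAt (outputMap A C) (-(I * ω)) x.1 q.1 *
        evalAt (inputMap A B) (-(I * ω)) q.2 x.2) (fun q => z i q.1 * y i q.2) (fun q x => ?_)
      fun q => by
        rw [Fintype.sum_prod_type]
        exact h.state_stationary hre hmem hmin hfin q.1 q.2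
    · rw [← h1]
      refine integral_congr_ae (Eventually.of_forall fun ω => ?_)
      have h2 : ∀ k l, ∑ q : Fin r × Fin r, z i q.1 * y i q.2 *
          (evalAt (outputMap A C) (-(I * (ω : ℂ))) k q.1 *
            evalAt (inputMap A B) (-(I * ω)) q.2 l) =
          c k * (I * ω - -lam i)⁻¹ * (b l * (I * ω - -lam i)⁻¹) := fun k l => by
        rw [← neg_mul_neg (c k * _) (b l * _), ← hin, ← hout, Finset.sum_mul_sum, Fintype.sum_prod_type]
        exact Finset.sum_congr rfl fun q _ => Finset.sum_congr rfl fun q' _ => by ring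
      simp only [h2, Fintype.sum_prod_type]
      rw [dslope_eq_div (axis_ne hμ.ne' ω), hf0, sub_zero, hf]
      simp only [Finset.sum_mul]
      refine Finset.sum_congr rfl fun k _ => Finset.sum_congr rfl fun l _ => ?_
      simp only [coeff]
      ring
    · simp_rw [evalAt_neg_axis, ← map_mul]
      exact (hD x.1 x.2).axisDecay.memLp.integrable_mul
        ((hdecout x.1 q.1).mul (hdecin q.2 x.2)).memLp.star
  have hdiff : ∀ k l, DifferentiableAt ℂ (fun s => coeff z y B C k l i * ratVal (D k l) s)
      (-lam i) := fun k l => ((hD k l).const_mul _).differentiableAt _ hμ.le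
  rw [hf, deriv_fun_sum fun k _ => DifferentiableAt.fun_sum fun l _ => hdiff k l] at hderiv
  rw [← hderiv]
  refine Finset.sum_congr rfl fun k _ => ?_
  rw [deriv_fun_sum fun l _ => hdiff k l]
  refine Finset.sum_congr rfl fun l _ => ?_
  rw [deriv_const_mul_field]

end IsModal

end ModelReduction

/-! ### Reduction of the pencil to `E = 1`, stability of the eigenvalues, and the main theorem. -/

namespace ModelReduction
open Filter Topology Asymptotics
open Bornology (cobounded)
open Complex MeasureTheory

variable {r p m : ℕ}

theorem isUnit_det_of_biorth {E : Matrix (Fin r) (Fin r) ℝ} {y z : Fin r → Fin r → ℂ}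
    (h : ∀ i j, star (y i) ⬝ᵥ (E.map Complex.ofReal *ᵥ z j) = if i = j then 1 else 0) :
    IsUnit E.det := by
  have h1 : Matrix.of (fun i => star (y i)) * (E.map Complex.ofReal * (Matrix.of z)ᵀ) = 1 := by
    ext i j
    rw [Matrix.one_apply, ← h i j]
    rfl
  have h2 := congrArg Matrix.det h1
  rw [Matrix.det_mul, Matrix.det_mul, Matrix.det_one] at h2
  have h3 : (E.map Complex.ofReal).det = (E.det : ℂ) := (RingHom.map_det Complex.ofRealHom E).symm
  refine isUnit_iff_ne_zero.2 fun h0 => ?_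
  rw [h3, h0] at h2
  simp at h2

/-- Right eigenvectors carry over to `E⁻¹ A`; left ones must be multiplied by `E`, which turns
`E`-biorthogonality into ordinary biorthogonality. -/
theorem isModal_of_pencil {E A : Matrix (Fin r) (Fin r) ℝ} {lam : Fin r → ℂ}
    {y z : Fin r → Fin r → ℂ} (hinj : Function.Injective lam) (hE : IsUnit E.det)
    (hz : ∀ i, A.map Complex.ofReal *ᵥ z i = lam i • (E.map Complex.ofReal *ᵥ z i))
    (hy : ∀ i, star (y i) ᵥ* A.map Complex.ofReal = lam i • (star (y i) ᵥ* E.map Complex.ofReal))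
    (hyz : ∀ i j, star (y i) ⬝ᵥ (E.map Complex.ofReal *ᵥ z j) = if i = j then 1 else 0) :
    IsModal (E⁻¹ * A) lam z fun i => star (y i) ᵥ* E.map Complex.ofReal where
  inj := hinj
  right i := by
    have h1 : (E⁻¹ * A).map Complex.ofReal = E⁻¹.map Complex.ofReal * A.map Complex.ofReal :=
      Matrix.map_mul (f := Complex.ofRealHom)
    have h2 : E⁻¹.map Complex.ofReal * E.map Complex.ofReal = 1 := by
      have : (E⁻¹ * E).map Complex.ofReal = E⁻¹.map Complex.ofReal * E.map Complex.ofReal :=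
        Matrix.map_mul (f := Complex.ofRealHom)
      rw [← this, Matrix.nonsing_inv_mul _ hE, IsModal.map_ofReal_one]
    rw [h1, ← Matrix.mulVec_mulVec, hz, Matrix.mulVec_smul, Matrix.mulVec_mulVec, h2,
      Matrix.one_mulVec]
  left i := by
    have h1 : E.map Complex.ofReal * (E⁻¹ * A).map Complex.ofReal = A.map Complex.ofReal := by
      have : (E * (E⁻¹ * A)).map Complex.ofReal =
          E.map Complex.ofReal * (E⁻¹ * A).map Complex.ofReal :=
        Matrix.map_mul (f := Complex.ofRealHom)
      rw [← this, Matrix.mul_nonsing_inv_cancel_left _ _ hE]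
    rw [Matrix.vecMul_vecMul, h1, hy]
  biorth i j := by rw [← Matrix.dotProduct_mulVec, hyz]

/-- The eigenvalues of an optimal model without hidden modes are stable. -/
theorem IsModal.re_neg {A : Matrix (Fin r) (Fin r) ℝ} {lam : Fin r → ℂ} {z y : Fin r → Fin r → ℂ}
    (h : IsModal A lam z y) {Gsp : RatMatrix p m} (hG : IsStable Gsp)
    (hGsp : IsStrictlyProper Gsp) {B : Matrix (Fin r) (Fin m) ℝ} {C : Matrix (Fin p) (Fin r) ℝ}
    {S : Set (RatMatrix p m)} (hS : S = Set.univ ∨ S = {H | IsStable H})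
    (hmem : transferFunction 1 A B C ∈ S)
    (hmin : ∀ H, HasOrder r H → H ∈ S →
      axisEnergy (Gsp - transferFunction 1 A B C) ≤ axisEnergy (Gsp - H))
    (hfin : axisEnergy (Gsp - transferFunction 1 A B C) < ⊤)
    (hid : ¬ ∃ i, C.map Complex.ofReal *ᵥ z i = 0 ∨ y i ᵥ* B.map Complex.ofReal = 0) (i : Fin r) :
    (lam i).re < 0 := by
  have hne : ∀ i, ∃ k l, IsModal.coeff z y B C k l i ≠ 0 := fun i => by
    push Not at hid
    obtain ⟨k, hk⟩ := Function.ne_iff.1 (hid i).1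
    obtain ⟨l, hl⟩ := Function.ne_iff.1 (hid i).2
    exact ⟨k, l, mul_ne_zero hk hl⟩
  obtain ⟨k, l, hkl⟩ := hne i
  by_contra hi
  rw [not_lt] at hi
  rcases hS with rfl | rfl
  -- Axis eigenvalues are removed before the right half-plane ones, since the variation of `C` needs
  -- a resolvent without poles on the axis.
  · have hre : ∀ j, (lam j).re ≠ 0 := fun j hj => by
      obtain ⟨k, l, hkl⟩ := hne j
      exact hkl (h.coeff_eq_zero_of_axis hG hfin hj k l)
    exact hkl (h.coeff_eq_zero_of_unstable (S := Set.univ) hre hG hGsp (fun _ => Set.mem_univ _) hmin hfin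
      (lt_of_le_of_ne hi (hre i).symm) k l)
  · exact hkl (h.coeff_eq_zero_of_isStable hmem hi k l)

theorem ratVal_apply_sub {H K : RatMatrix p m} {s : ℂ} (hH : ¬ IsPole H s) (hK : ¬ IsPole K s)
    (k : Fin p) (l : Fin m) :
    ratVal ((H - K) k l) s = (evalAt H s - evalAt K s) k l :=
  ratVal_sub (not_isPole_iff.1 hH k l) (not_isPole_iff.1 hK k l)

theorem deriv_ratVal_apply_sub {H K : RatMatrix p m} {s : ℂ} (hH : ¬ IsPole H s)
    (hK : ¬ IsPole K s) (k : Fin p) (l : Fin m) :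
    deriv (ratVal ((H - K) k l)) s = (derivAt H s - derivAt K s) k l := by
  have h1 := not_isPole_iff.1 hH k l
  have h2 := not_isPole_iff.1 hK k l
  have h3 : ratVal ((H - K) k l) =ᶠ[𝓝 s] fun t => ratVal (H k l) t - ratVal (K k l) t := by
    filter_upwards [h1.eventually, h2.eventually] with t ht1 ht2
    exact ratVal_sub ht1 ht2
  rw [h3.deriv_eq, deriv_fun_sub h1.differentiableAt h2.differentiableAt]
  rfl

end ModelReduction

theorem theorem4p1 {p m r : ℕ}
    -- the full-order model, decomposed into its strictly proper and polynomial parts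
    (G Gsp : RatMatrix p m) (P : Matrix (Fin p) (Fin m) ℝ[X])
    (hG : G = Gsp + ofPoly P) (hGsp : IsStrictlyProper Gsp) (hstable : IsStable G)
    -- the reduced-order model, with a strictly proper part of order `r`
    (Gr Grsp : RatMatrix p m) (Pr : Matrix (Fin p) (Fin m) ℝ[X])
    (hGr : Gr = Grsp + ofPoly Pr) (hGrsp : HasOrder r Grsp)
    -- the minimization is over all models, or over the stable ones only
    (S : Set (RatMatrix p m)) (hS : S = Set.univ ∨ S = {H | IsStable H})
    (hmin : IsH2Minimizer G (models p m r ∩ S) Gr) :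
    (Pr = P ∧ IsH2Minimizer Gsp (strictlyProperModels p m r ∩ S) Grsp) ∧
    ∀ (E A : Matrix (Fin r) (Fin r) ℝ) (B : Matrix (Fin r) (Fin m) ℝ)
      (C : Matrix (Fin p) (Fin r) ℝ), Grsp = transferFunction E A B C →
    ∀ (lam : Fin r → ℂ) (y z : Fin r → Fin r → ℂ),
      Function.Injective lam →
      (∀ i, A.map Complex.ofReal *ᵥ z i = lam i • (E.map Complex.ofReal *ᵥ z i)) →
      (∀ i, star (y i) ᵥ* A.map Complex.ofReal = lam i • (star (y i) ᵥ* E.map Complex.ofReal)) →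
      (∀ i j, star (y i) ⬝ᵥ (E.map Complex.ofReal *ᵥ z j) = if i = j then 1 else 0) →
    ∀ (b : Fin r → Fin m → ℂ) (c : Fin r → Fin p → ℂ),
      (∀ i, c i = C.map Complex.ofReal *ᵥ z i) →
      (∀ i, b i = star (y i) ᵥ* B.map Complex.ofReal) →
    ∀ i,
      (Gr = G ∨ (¬ IsPole G (-lam i) ∧ ¬ IsPole Gr (-lam i))) ∧
      evalAt G (-lam i) *ᵥ b i = evalAt Gr (-lam i) *ᵥ b i ∧
      c i ᵥ* evalAt G (-lam i) = c i ᵥ* evalAt Gr (-lam i) ∧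
      c i ⬝ᵥ (derivAt G (-lam i) *ᵥ b i) = c i ⬝ᵥ (derivAt Gr (-lam i) *ᵥ b i) := by
  obtain ⟨hP, hfin, hminsp⟩ := minimizer_polynomial_part hG hGsp hstable hGr hGrsp hS hmin
  refine ⟨⟨hP, hminsp⟩, ?_⟩
  intro E A B C htf lam y z hinj hz hy hyz b c hc hb i
  have hE := isUnit_det_of_biorth hyz
  have hmod := isModal_of_pencil hinj hE hz hy hyz
  have hBE : E.map Complex.ofReal * (E⁻¹ * B).map Complex.ofReal = B.map Complex.ofReal := by
    have : (E * (E⁻¹ * B)).map Complex.ofReal =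
        E.map Complex.ofReal * (E⁻¹ * B).map Complex.ofReal :=
      Matrix.map_mul (f := Complex.ofRealHom)
    rw [← this, Matrix.mul_nonsing_inv_cancel_left _ _ hE]
  have hb' : ∀ i, b i = (star (y i) ᵥ* E.map Complex.ofReal) ᵥ* (E⁻¹ * B).map Complex.ofReal :=
    fun i => by rw [hb, Matrix.vecMul_vecMul, hBE]
  rw [transferFunction_eq_one hE] at htf
  have hGs : IsStable Gsp := by
    have : Gsp = G - ofPoly P := by rw [hG, add_sub_cancel_right]
    rw [this]
    exact hstable.sub (isStable_ofPoly P)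
  have hmin' : ∀ H, HasOrder r H → H ∈ S → axisEnergy (Gsp - Grsp) ≤ axisEnergy (Gsp - H) :=
    fun H hH hHS => h2Norm_le_iff.1 (hminsp.2 ⟨hH, hHS⟩)
  have hmem : Grsp ∈ S := hminsp.1.2
  subst hP
  -- A hidden mode forces `Gr = G`; the identities then hold by reflexivity, also at a common pole,
  -- where both sides are the same default value.
  by_cases hid : ∃ i, C.map Complex.ofReal *ᵥ z i = 0 ∨
      (star (y i) ᵥ* E.map Complex.ofReal) ᵥ* (E⁻¹ * B).map Complex.ofReal = 0
  · rw [htf] at hmem hmin' hfin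
    have heq := hmod.eq_of_hidden hGs hGsp hS hmem hmin' hfin hid
    have : Gr = G := by rw [hG, hGr, heq, htf]
    subst this
    exact ⟨Or.inl rfl, rfl, rfl, rfl⟩
  -- The polynomial parts cancel, so interpolation by the strictly proper parts is interpolation by
  -- the full models.
  have hDG : G - Gr = Gsp - Grsp := by rw [hG, hGr, add_sub_add_right_eq_sub]
  rw [htf] at hmem hmin' hfin hDG
  have hre := hmod.re_neg hGs hGsp hS hmem hmin' hfin hid
  have hSt : ∀ H, IsStable H → H ∈ S := fun H hH => by
    rcases hS with rfl | rfl
    · trivial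
    · exact hH
  obtain ⟨hR, hL, hD⟩ := hmod.interpolation hre hGs hGsp hSt hmin' hfin i
  have hGrs : IsStable Gr := by
    rw [hGr, htf]
    exact (hmod.isStable hre _ _).add (isStable_ofPoly Pr)
  have hμ : 0 ≤ (-lam i).re := by
    have := hre i
    rw [Complex.neg_re]
    linarith
  have hpG := hstable.not_isPole hμ
  have hpGr := hGrs.not_isPole hμ
  rw [← hDG] at hR hL hD
  simp only [ratVal_apply_sub hpG hpGr] at hR hL
  simp only [deriv_ratVal_apply_sub hpG hpGr, IsModal.coeff] at hD
  rw [← hc i, ← hb' i] at hD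
  refine ⟨Or.inr ⟨hpG, hpGr⟩, ?_, ?_, ?_⟩
  · rw [← sub_eq_zero, ← Matrix.sub_mulVec]
    ext k
    rw [hb']
    exact hR k
  · rw [← sub_eq_zero, ← Matrix.vecMul_sub]
    ext l
    rw [hc]
    exact hL l
  · rw [← sub_eq_zero, ← dotProduct_sub, ← Matrix.sub_mulVec]
    refine Eq.trans ?_ hD
    simp only [dotProduct, Matrix.mulVec, Finset.mul_sum]
    refine Finset.sum_congr rfl fun k _ => Finset.sum_congr rfl fun l _ => ?_
    ring
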